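/- **Setting.** Let $n\ge 3$, $\mathfrak b\ge 0$ be integers, $\tau>0$, $\Omega=\mathbb T^2\times(0,1)$ with $\mathbb T^2=(\mathbb R/\mathbb Z)^2$, $x=(x_\shortparallel,x_3)$, $v=(v_\shortparallel,v_3)\in\mathbb R^3$. Let $Q$ be the Boltzmann collision operator with hard-sphere kernel $|(v-u)\cdot\omega|$, $\mu(v)=(2\pi)^{-3/2}e^{-|v|^2/2}$, $$Lg=-\mu^{-1/2}\{Q(\mu,\sqrt\mu g)+Q(\sqrt\mu g,\mu)\},\qquad \Gamma(g,h)=\mu^{-1/2}Q(\sqrt\mu g,\sqrt\mu h),\qquad \Gamma_s(g,h)=\Gamma(g,h)+\Gamma(h,g).$$ For a function $g$ of $v$ put $\rho=\int\sqrt\mu g\,dv$, $u=\int v\sqrt\mu g\,dv$, $\theta=\frac13\int(|v|^2-3)\sqrt\mu g\,dv$ and $Pg=\{\rho+u\cdot v+\frac\theta2(|v|^2-3)\}\sqrt\mu$. Let $L^{-1}$ be the inverse of $L$ on the orthogonal complement of $\ker L=\mathrm{span}\{\sqrt\mu,v_i\sqrt\mu,|v|^2\sqrt\mu\}$, and $\mathcal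 B_3=\frac{v_3}{2}(|v|^2-5)\sqrt\mu$. The superscripts $+$ and $-$ refer to the walls $x_3=1$ and $x_3=0$; for an interior function $h$, $h^\pm$ also denotes its value on the wall. In $\pm,\mp$ the upper sign belongs to $+$. **The expansions.** Let $f_k(t,x,v)$ (interior), $\bar f_k^\pm(t,x_\shortparallel,y,v)$ (viscous layers, $y\ge0$) and $\hat f_k^\pm(t,x_\shortparallel,\eta,v)$ (Knudsen layers, $\eta\ge0$), $k\in\mathbb Z$, $t\in[0,\tau]$, be periodic in $x_\shortparallel$, with $f_k=0$ for $k<0$ and $\bar f^\pm_k=\hat f^\pm_k=0$ for $k\le0$, such that for every $k\in\mathbb Z$ $$\partial_tf_{k+2-n}+v\cdot\nabla_xf_k=-Lf_{k+n}+\sum_{\substack{i+j=k+2\\ i,j\ge0}}\tfrac12\Gamma_s(f_i,f_j),$$ $$\partial_t\bar f^\pm_{k+2-n}+v_\shortparallel\cdot\nabla_\shortparallel\bar f^\pm_k\mp v_3\partial_y\bar f^\pm_{k+1}=-L\bar f^\pm_{k+n}+\sum_{\substack{i+j=k+2\\ i\ge0,j\ge1}}\Gamma_s(f_i^\pm,\bar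 f_j^\pm)+\sum_{l=1}^{\mathfrak b}\frac{(\mp y)^l}{l!}\sum_{\substack{i+j+l=k+2\\ i\ge0,j\ge1}}\Gamma_s((\partial_{x_3}^lf_i)^\pm,\bar f_j^\pm)+\sum_{\substack{i+j=k+2\\ i,j\ge1}}\tfrac12\Gamma_s(\bar f_i^\pm,\bar f_j^\pm),$$ $$\begin{aligned}\mp v_3\partial_\eta\hat f^\pm_{k+n}+L\hat f^\pm_{k+n}={}&-\partial_t\hat f^\pm_{k+2-n}-v_\shortparallel\cdot\nabla_\shortparallel\hat f^\pm_k+\sum_{\substack{i+j=k+2\\ i\ge0,j\ge1}}\Gamma_s(f_i^\pm,\hat f_j^\pm)+\sum_{\substack{i+j=k+2\\ i,j\ge1}}\Big[\Gamma_s(\bar f_i^\pm|_{y=0},\hat f_j^\pm)+\tfrac12\Gamma_s(\hat f_i^\pm,\hat f_j^\pm)\Big]\\&+\sum_{l=1}^{\mathfrak b}\frac{(\mp\eta)^l}{l!}\sum_{\substack{i+j+nl=k+2\\ i\ge0,j\ge1}}\Gamma_s((\partial^l_{x_3}f_i)^\pm,\hat f_j^\pm)+\sum_{l=1}^{\mathfrak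 b}\frac{\eta^l}{l!}\sum_{\substack{i+j+(n-1)l=k+2\\ i,j\ge1}}\Gamma_s(\partial_y^l\bar f_i^\pm|_{y=0},\hat f_j^\pm),\end{aligned}$$ the last one for $\eta>0$, $v_3\ne0$. Regularity and decay: $f_k$ and $\bar f_k^\pm$ are $C^{\mathfrak b+1}$ in the space-time variables, up to the boundary, with values in the continuous functions of $v$ that are bounded after multiplication by $(1+|v|)^3$; $\bar f_k^\pm$ and its first derivatives in $t,x_\shortparallel$ are $O((1+y)^{-2}(1+|v|)^{-3})$; $\hat f_k^\pm$ is measurable, $C^1$ in $(t,x_\shortparallel)$, for $v_3\ne0$ continuous in $\eta\ge0$ and differentiable in $\eta>0$, and it and its first derivatives in $t,x_\shortparallel$ are $O(e^{-\zeta\eta}(1+|v|)^{-3})$ for some $\zeta>0$ depending on $k$. The *specular condition at order $k$* is: on both walls, for $v_3\neq0$, $(f_k^\pm+\bar f_k^\pm|_{y=0}+\hat f_k^\pm|_{\eta=0})(v)$ is invariant under $v_3\mapsto-v_3$. **Notation.** Moments of $f_k,\bar f_k^\pm$ are $(\rho_k,u_k,\theta_k)$, $(\bar\rho_k^\pm,\bar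 u_k^\pm,\bar\theta_k^\pm)$. The pressures are $p_k=\rho_k+\theta_k$ for $k\le n-3$, $p_{n-2}=\rho_{n-2}+\theta_{n-2}-\frac13|u_0|^2$, $p_{n-2+m}=\rho_{n-2+m}+\theta_{n-2+m}-\frac23u_0\cdot u_m$ for $m\ge1$. Further $$G_{k-1}=L^{-1}\Big\{(I-P)\big[-\partial_tf_{k-n}-v\cdot\nabla_xf_{k-2}\big]+\sum_{\substack{i+j=k\\ i,j\ge1}}\tfrac12\Gamma_s(f_i,f_j)+\Gamma_s(f_0,(I-P)f_k)\Big\}.$$ Write $-P\{\partial_t\hat f^\pm_{k+2-2n}+v_\shortparallel\cdot\nabla_\shortparallel\hat f^\pm_{k-n}\}=\{\hat a_k^\pm+\hat b_k^\pm\cdot v+\hat c_k^\pm|v|^2\}\sqrt\mu$, and let $\hat A_k^\pm,\hat C_k^\pm$ be the solutions, decaying as $\eta\to\infty$, of $\mp\partial_\eta\hat A_k^\pm=2\hat a_k^\pm+3\hat c_k^\pm$, $\mp\partial_\eta\hat C_k^\pm=-\frac15\hat a_k^\pm$. Put $K_k^\pm=(\hat A_k^\pm+5\hat C_k^\pm)|_{\eta=0}$.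 The boundary layers prescribe $u_{k,3}=d_k^\pm:=-\bar u^\pm_{k,3}|_{y=0}-K_k^\pm$ on the walls, and the *compatibility condition at order $k$* (that of $\mathrm{div}_xu_k=-\partial_t\rho_{k+2-n}$ with these boundary values) is $$\int_\Omega-\partial_t\rho_{k+2-n}\,dx=\int_{\mathbb T^2}(d_k^+-d_k^-)\,dx_\shortparallel\qquad\text{for all }t\in[0,\tau].$$ Let $$\begin{aligned}M_k(t)={}&-\frac23\int_0^t\!\!\int_{\mathbb T^2}\big(\langle\mathcal B_3,G_{k-1}^+\rangle-\langle\mathcal B_3,G_{k-1}^-\rangle\big)dx_\shortparallel ds-\frac53\int_{\mathbb T^2}\!\int_0^\infty\Big[(\bar\rho^+_{k-1}+\bar\rho^-_{k-1})(t)-(\bar\rho^+_{k-1}+\bar\rho^-_{k-1})(0)\Big]dy\,dx_\shortparallel\\&-\frac53\int_0^t\!\!\int_{\mathbb T^2}\!\int_0^\infty\Big[\mathrm{div}_\shortparallel\bar u^+_{k-1,\shortparallel}\,\theta_0^++\mathrm{div}_\shortparallel\bar u^-_{k-1,\shortparallel}\,\theta_0^-\Big]dy\,dx_\shortparallel ds.\end{aligned}$$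 **Lemma 2.2.** 1. For $k\ge0$, the specular condition at order $k$ implies the compatibility condition at order $k$. 2. For $0\le k\le n-3$, $p_k(t,x)$ does not depend on $x$. 3. ($k=0$.) Under the specular condition at order $0$, the compatibility condition at order $n-2$ holds if and only if $p_0$ is constant: $p_0(t,x)=(\rho_0+\theta_0)(0,y)$ for all $t\in[0,\tau]$ and $x,y\in\bar\Omega$. 4. ($1\le k\le n-3$.) Under the specular conditions at orders $0$ and $k$, the compatibility condition at order $k+n-2$ holds if and only if $$p_k(t)=(\rho_k+\theta_k)(0)+M_k(t)\qquad\text{for all }t\in[0,\tau].$$ 5. ($k=n-2$.) Under the specular conditions at orders $0$ and $n-2$, the compatibility condition at order $2n-4$ holds if and only if $\int_\Omega p_{n-2}\,dx=\mathfrak c_{n-2}(t)$ for all $t\in[0,\tau]$, where $$\mathfrak c_{n-2}(t)=\int_\Omega(\rho_{n-2}+\theta_{n-2})(0)\,dx-\frac13\int_\Omega|u_0(t)|^2dx+M_{n-2}(t).$$ 6. ($k=n-2+m$, $m\ge1$.) Under the specular conditions at orders $0$ and $n-2+m$, the compatibility condition at order $2n-4+m$ holds if and only if $\int_\Omega p_{n-2+m}\,dx=\mathfrak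 c_{n-2+m}(t)$ for all $t\in[0,\tau]$, where $$\begin{aligned}\mathfrak c_{n-2+m}(t)={}&\int_\Omega(\rho_{n-2+m}+\theta_{n-2+m})(0)\,dx-\frac23\int_\Omega u_0\cdot u_m(t)\,dx+M_{n-2+m}(t)\\&-\frac53\int_0^t\!\!\int_{\mathbb T^2}\!\int_0^\infty\big(\partial_t\bar\rho^+_{m-1}\theta_0^++\partial_t\bar\rho^-_{m-1}\theta_0^-\big)dy\,dx_\shortparallel ds+\frac53\int_0^t\!\!\int_{\mathbb T^2}\big(K^+_{2n-4+m}-K^-_{2n-4+m}\big)dx_\shortparallel ds\\&+\frac53\int_0^t\!\!\int_{\mathbb T^2}\big(K^+_{n-2+m}\theta_0^+-K^-_{n-2+m}\theta_0^-\big)dx_\shortparallel ds.\end{aligned}$$ In 5 and 6, when the compatibility condition holds, this mean makes the pressure unique: $p_k$ is the only function, $C^1$ in $x\in\bar\Omega$, with its gradient $\nabla_xp_k$ and with spatial mean $\mathfrak c_k(t)$. -/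

import Mathlib

open Set MeasureTheory
open scoped BoundedContinuousFunction

noncomputable section

namespace EulerLimit

/-! ### Velocity space and the hard-sphere collision operator -/

/-- The velocity space `ℝ³`; `v 0, v 1, v 2` are the components `v₁, v₂, v₃`. -/
abbrev Vel : Type := EuclideanSpace ℝ (Fin 3)

/-- The normalized global Maxwellian `μ(v) = (2π)^{-3/2} exp(-|v|²/2)`. -/
def maxwellian (v : Vel) : ℝ :=
  (2 * Real.pi) ^ (-(3 / 2 : ℝ)) * Real.exp (-(‖v‖ ^ 2) / 2)

/-- `√μ`. -/
def sqrtM (v : Vel) : ℝ := Real.sqrt (maxwellian v)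

/-- Post-collisional velocity `u' = u + [(v-u)·ω] ω`. -/
def postU (u v ω : Vel) : Vel := u + (inner ℝ (v - u) ω) • ω

/-- Post-collisional velocity `v' = v - [(v-u)·ω] ω`. -/
def postV (u v ω : Vel) : Vel := v - (inner ℝ (v - u) ω) • ω

/-- The collision operator with hard-sphere kernel `B = |(v-u)·ω|`; `ω` ranges over the unit
sphere with its surface measure. -/
def collQ (F₁ F₂ : Vel → ℝ) (v : Vel) : ℝ :=
  (∫ u : Vel, ∫ ω : Metric.sphere (0 : Vel) 1,
      |inner ℝ (v - u) (ω : Vel)| * (F₁ (postU u v ω) * F₂ (postV u v ω))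
        ∂(volume : Measure Vel).toSphere)
    - ∫ u : Vel, ∫ ω : Metric.sphere (0 : Vel) 1,
      |inner ℝ (v - u) (ω : Vel)| * (F₁ u * F₂ v) ∂(volume : Measure Vel).toSphere

/-- The linearized operator `L g = -μ^{-1/2} [Q(μ, √μ g) + Q(√μ g, μ)]`. -/
def linL (g : Vel → ℝ) (v : Vel) : ℝ :=
  -((collQ maxwellian (fun w => sqrtM w * g w) v
      + collQ (fun w => sqrtM w * g w) maxwellian v) / sqrtM v)

/-- `Γ(g, h) = μ^{-1/2} Q(√μ g, √μ h)`. -/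
def Gam (g h : Vel → ℝ) (v : Vel) : ℝ :=
  collQ (fun w => sqrtM w * g w) (fun w => sqrtM w * h w) v / sqrtM v

/-- `Γ(g, h) + Γ(h, g)`. -/
def GamS (g h : Vel → ℝ) (v : Vel) : ℝ := Gam g h v + Gam h g v

/-! ### Macroscopic moments and the macro-micro decomposition -/

/-- `ρ = ∫ √μ g dv`. -/
def rho (g : Vel → ℝ) : ℝ := ∫ v, sqrtM v * g v

/-- `u_i = ∫ v_i √μ g dv`. -/
def vel (i : Fin 3) (g : Vel → ℝ) : ℝ := ∫ v : Vel, v i * (sqrtM v * g v)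

/-- `θ = (1/3) ∫ (|v|² - 3) √μ g dv`. -/
def theta (g : Vel → ℝ) : ℝ := (1 / 3) * ∫ v : Vel, (‖v‖ ^ 2 - 3) * (sqrtM v * g v)

/-- The `L²_v` projection onto the collision invariants:
`P g = {ρ + u·v + (θ/2)(|v|² - 3)} √μ`. -/
def macroP (g : Vel → ℝ) (v : Vel) : ℝ :=
  (rho g + ∑ i, vel i g * v i + theta g / 2 * (‖v‖ ^ 2 - 3)) * sqrtM v

/-- `(I - P) g`. -/
def microP (g : Vel → ℝ) (v : Vel) : ℝ := g v - macroP g v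

/-- `g` is a preimage of `h` under `L` in the orthogonal complement of the collision invariants
(among continuous functions with `|g| ≤ C (1+|v|)^{-3}`; there is at most one). -/
def IsLInv (h g : Vel → ℝ) : Prop :=
  Continuous g ∧ (∃ C : ℝ, ∀ v, |g v| ≤ C * ((1 + ‖v‖) ^ 3)⁻¹) ∧
    rho g = 0 ∧ (∀ i, vel i g = 0) ∧ theta g = 0 ∧ ∀ v, linL g v = h v

open Classical in
/-- `L⁻¹ h` (the value is `0` if `h` has no preimage). -/
def LInv (h : Vel → ℝ) : Vel → ℝ :=
  if H : ∃ g, IsLInv h g then Classical.choose H else 0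

/-- The Burnett function `ℬ_i = (v_i / 2)(|v|² - 5) √μ`. -/
def burnettB (i : Fin 3) (v : Vel) : ℝ := v i / 2 * (‖v‖ ^ 2 - 5) * sqrtM v

/-! ### Fields on the channel, boundary layers, partial derivatives, integrals

The arguments are `t, x₁, x₂` and a normal variable: `x₃ ∈ [0,1]` in the interior,
`y ∈ [0,∞)` in the viscous layers, `η ∈ [0,∞)` in the Knudsen layers.  Functions on the torus
`𝕋²` are functions of `(x₁, x₂) ∈ ℝ²` of period `1` in each variable. -/

/-- Scalar fields. -/
abbrev Field : Type := ℝ → ℝ → ℝ → ℝ → ℝ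

/-- Kinetic profiles: a function of the velocity at each `(t, x₁, x₂, z)`. -/
abbrev Profile : Type := ℝ → ℝ → ℝ → ℝ → Vel → ℝ

/-- A profile at a fixed velocity. -/
def slice (h : Profile) (v : Vel) : Field := fun t x₁ x₂ z => h t x₁ x₂ z v

/-- `∂_t` on `[0, τ]` (one-sided at the end points). -/
def Dt (τ : ℝ) (q : Field) : Field :=
  fun t x₁ x₂ z => derivWithin (fun s => q s x₁ x₂ z) (Icc 0 τ) t

/-- `∂_{x₁}`. -/
def D1 (q : Field) : Field := fun t x₁ x₂ z => deriv (fun s => q t s x₂ z) x₁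

/-- `∂_{x₂}`. -/
def D2 (q : Field) : Field := fun t x₁ x₂ z => deriv (fun s => q t x₁ s z) x₂

/-- The normal derivative, one-sided at the boundary of the interval `I` of the normal variable. -/
def D3 (I : Set ℝ) (q : Field) : Field :=
  fun t x₁ x₂ z => derivWithin (fun s => q t x₁ x₂ s) I z

/-- The `l`-th normal derivative of a profile. -/
def Dnl (I : Set ℝ) (l : ℕ) (h : Profile) : Profile :=
  fun t x₁ x₂ z v => iteratedDerivWithin l (fun s => h t x₁ x₂ s v) I z

/-- `∫_{𝕋²} g dx₁ dx₂`. -/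
def intT (g : ℝ → ℝ → ℝ) : ℝ := ∫ x₁ in (0 : ℝ)..1, ∫ x₂ in (0 : ℝ)..1, g x₁ x₂

/-- `∫_Ω g dx`, `Ω = 𝕋² × (0,1)`. -/
def intO (g : ℝ → ℝ → ℝ → ℝ) : ℝ :=
  ∫ x₁ in (0 : ℝ)..1, ∫ x₂ in (0 : ℝ)..1, ∫ x₃ in (0 : ℝ)..1, g x₁ x₂ x₃

/-- The two walls: `lower` is `x₃ = 0` (superscript `-`), `upper` is `x₃ = 1` (superscript `+`). -/
inductive Side : Type
  | lower : Side
  | upper : Side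

/-- The value of the sign `±`. -/
def Side.sgn : Side → ℝ
  | Side.lower => -1
  | Side.upper => 1

/-- The position of the wall. -/
def Side.pos : Side → ℝ
  | Side.lower => 0
  | Side.upper => 1

/-- Periodicity in `x₁, x₂`. -/
def IsPeriodic (h : Profile) : Prop :=
  ∀ t x₁ x₂ z v, h t (x₁ + 1) x₂ z v = h t x₁ x₂ z v ∧ h t x₁ (x₂ + 1) z v = h t x₁ x₂ z v

/-- `h` is `C^r` on `S` with values in the continuous functions of `v` weighted by `(1+|v|)³`. -/
def SmoothOn (r : ℕ) (S : Set (ℝ × ℝ × ℝ × ℝ)) (h : Profile) : Prop :=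
  ∃ g : ℝ × ℝ × ℝ × ℝ → (Vel →ᵇ ℝ), ContDiffOn ℝ r g S ∧
    ∀ p ∈ S, ∀ v, h p.1 p.2.1 p.2.2.1 p.2.2.2 v = ((1 + ‖v‖) ^ 3)⁻¹ * g p v

/-! ### The three expansions -/

/-- The transport term `v₁ ∂_{x₁} h + v₂ ∂_{x₂} h`. -/
def tangTransport (h : Profile) (t x₁ x₂ z : ℝ) (v : Vel) : ℝ :=
  v 0 * D1 (slice h v) t x₁ x₂ z + v 1 * D2 (slice h v) t x₁ x₂ z

/-- `v·∇_x h` in the channel. -/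
def transport (h : Profile) (t x₁ x₂ x₃ : ℝ) (v : Vel) : ℝ :=
  tangTransport h t x₁ x₂ x₃ v + v 2 * D3 (Icc 0 1) (slice h v) t x₁ x₂ x₃

/-- The interior expansion: `F_i = √μ f_i`, with `f_i = 0` for `i < 0`, solves
`∂_t F_{k+2-n} + v·∇_x F_k = Q(μ,F_{k+n}) + Q(F_{k+n},μ) + ∑_{i+j=k+2} ½[Q(F_i,F_j) + Q(F_j,F_i)]`
for every order `k` (divided here by `√μ`).  No boundary condition is included. -/
structure IsInterior (n 𝔟 : ℕ) (τ : ℝ) (f : ℤ → Profile) : Prop where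
  neg : ∀ i < 0, f i = 0
  periodic : ∀ i, IsPeriodic (f i)
  smooth : ∀ i, SmoothOn (𝔟 + 1) (Icc 0 τ ×ˢ univ ×ˢ univ ×ˢ Icc 0 1) (f i)
  eqn : ∀ k : ℤ, ∀ t ∈ Icc 0 τ, ∀ x₁ x₂ : ℝ, ∀ x₃ ∈ Icc (0 : ℝ) 1, ∀ v : Vel,
    Dt τ (slice (f (k + 2 - n)) v) t x₁ x₂ x₃ + transport (f k) t x₁ x₂ x₃ v =
      - linL (f (k + n) t x₁ x₂ x₃) v
      + ∑ i ∈ Finset.Icc 0 (k + 2), (1 / 2) * GamS (f i t x₁ x₂ x₃) (f (k + 2 - i) t x₁ x₂ x₃) v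

/-- The viscous boundary layer at the wall `s`, `F̄_i = √μ f̄_i`, with `f̄_i = 0` for `i ≤ 0`,
decaying as `y → ∞` with its first time and tangential derivatives. -/
structure IsViscous (n 𝔟 : ℕ) (τ : ℝ) (f : ℤ → Profile) (s : Side) (fb : ℤ → Profile) :
    Prop where
  nonpos : ∀ i ≤ 0, fb i = 0
  periodic : ∀ i, IsPeriodic (fb i)
  smooth : ∀ i, SmoothOn (𝔟 + 1) (Icc 0 τ ×ˢ univ ×ˢ univ ×ˢ Ici 0) (fb i)
  decay : ∀ i, ∃ C : ℝ, ∀ t ∈ Icc 0 τ, ∀ x₁ x₂ : ℝ, ∀ y ∈ Ici (0 : ℝ), ∀ v : Vel,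
    |fb i t x₁ x₂ y v| + |Dt τ (slice (fb i) v) t x₁ x₂ y|
      + |D1 (slice (fb i) v) t x₁ x₂ y| + |D2 (slice (fb i) v) t x₁ x₂ y|
      ≤ C * ((1 + y) ^ 2)⁻¹ * ((1 + ‖v‖) ^ 3)⁻¹
  eqn : ∀ k : ℤ, ∀ t ∈ Icc 0 τ, ∀ x₁ x₂ : ℝ, ∀ y ∈ Ici (0 : ℝ), ∀ v : Vel,
    Dt τ (slice (fb (k + 2 - n)) v) t x₁ x₂ y + tangTransport (fb k) t x₁ x₂ y v
        - s.sgn * (v 2 * D3 (Ici 0) (slice (fb (k + 1)) v) t x₁ x₂ y) =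
      - linL (fb (k + n) t x₁ x₂ y) v
      + ∑ i ∈ Finset.Icc 0 (k + 1), GamS (f i t x₁ x₂ s.pos) (fb (k + 2 - i) t x₁ x₂ y) v
      + ∑ l ∈ Finset.Icc 1 𝔟, ∑ i ∈ Finset.Icc 0 (k + 1 - l),
          (-s.sgn * y) ^ l / l.factorial *
            GamS (Dnl (Icc 0 1) l (f i) t x₁ x₂ s.pos) (fb (k + 2 - l - i) t x₁ x₂ y) v
      + ∑ i ∈ Finset.Icc 1 (k + 1),
          (1 / 2) * GamS (fb i t x₁ x₂ y) (fb (k + 2 - i) t x₁ x₂ y) v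

/-- The Knudsen boundary layer at the wall `s`, `F̂_i = √μ f̂_i`, with `f̂_i = 0` for `i ≤ 0`,
exponentially decaying as `η → ∞`.  Differentiability in `η` is required only off `v₃ = 0`, where
the equation degenerates. -/
structure IsKnudsen (n 𝔟 : ℕ) (τ : ℝ) (f : ℤ → Profile) (s : Side) (fb fk : ℤ → Profile) :
    Prop where
  nonpos : ∀ i ≤ 0, fk i = 0
  periodic : ∀ i, IsPeriodic (fk i)
  measurable : ∀ i, ∀ t ∈ Icc 0 τ,
    Measurable fun p : (ℝ × ℝ) × NNReal × Vel => fk i t p.1.1 p.1.2 p.2.1 p.2.2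
  smooth : ∀ i, ∀ η ∈ Ici (0 : ℝ), ∀ v : Vel,
    ContDiffOn ℝ 1 (fun p : ℝ × ℝ × ℝ => fk i p.1 p.2.1 p.2.2 η v) (Icc 0 τ ×ˢ univ ×ˢ univ)
  normal : ∀ i, ∀ t ∈ Icc 0 τ, ∀ x₁ x₂ : ℝ, ∀ v : Vel, v 2 ≠ 0 →
    ContinuousOn (fun η => fk i t x₁ x₂ η v) (Ici 0) ∧
      DifferentiableOn ℝ (fun η => fk i t x₁ x₂ η v) (Ioi 0)
  decay : ∀ i, ∃ ζ > (0 : ℝ), ∃ C : ℝ,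
    ∀ t ∈ Icc 0 τ, ∀ x₁ x₂ : ℝ, ∀ η ∈ Ici (0 : ℝ), ∀ v : Vel,
    |fk i t x₁ x₂ η v| + |Dt τ (slice (fk i) v) t x₁ x₂ η|
      + |D1 (slice (fk i) v) t x₁ x₂ η| + |D2 (slice (fk i) v) t x₁ x₂ η|
      ≤ C * Real.exp (-ζ * η) * ((1 + ‖v‖) ^ 3)⁻¹
  eqn : ∀ k : ℤ, ∀ t ∈ Icc 0 τ, ∀ x₁ x₂ : ℝ, ∀ η ∈ Ioi (0 : ℝ), ∀ v : Vel, v 2 ≠ 0 →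
    - s.sgn * (v 2 * D3 (Ici 0) (slice (fk (k + n)) v) t x₁ x₂ η)
        + linL (fk (k + n) t x₁ x₂ η) v =
      - Dt τ (slice (fk (k + 2 - n)) v) t x₁ x₂ η - tangTransport (fk k) t x₁ x₂ η v
      + ∑ i ∈ Finset.Icc 0 (k + 1), GamS (f i t x₁ x₂ s.pos) (fk (k + 2 - i) t x₁ x₂ η) v
      + ∑ i ∈ Finset.Icc 1 (k + 1),
          (GamS (fb i t x₁ x₂ 0) (fk (k + 2 - i) t x₁ x₂ η) v
            + (1 / 2) * GamS (fk i t x₁ x₂ η) (fk (k + 2 - i) t x₁ x₂ η) v)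
      + ∑ l ∈ Finset.Icc 1 𝔟, ∑ i ∈ Finset.Icc 0 (k + 1 - n * l),
          (-s.sgn * η) ^ l / l.factorial *
            GamS (Dnl (Icc 0 1) l (f i) t x₁ x₂ s.pos) (fk (k + 2 - n * l - i) t x₁ x₂ η) v
      + ∑ l ∈ Finset.Icc 1 𝔟, ∑ i ∈ Finset.Icc 1 (k + 1 - (n - 1) * l),
          η ^ l / l.factorial *
            GamS (Dnl (Ici 0) l (fb i) t x₁ x₂ 0)
              (fk (k + 2 - (n - 1) * l - i) t x₁ x₂ η) v

/-- `R v = (v₁, v₂, -v₃)`. -/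
def reflect (v : Vel) : Vel := !₂[v 0, v 1, -v 2]

/-- The specular reflection condition at order `k` on both walls:
`(f_k + f̄_k + f̂_k)(v) = (f_k + f̄_k + f̂_k)(R v)` off the grazing velocities. -/
def SpecularAt (τ : ℝ) (f : ℤ → Profile) (fb fk : Side → ℤ → Profile) (k : ℤ) : Prop :=
  ∀ s : Side, ∀ t ∈ Icc 0 τ, ∀ x₁ x₂ : ℝ, ∀ v : Vel, v 2 ≠ 0 →
    f k t x₁ x₂ s.pos v + fb s k t x₁ x₂ 0 v + fk s k t x₁ x₂ 0 v =
      f k t x₁ x₂ s.pos (reflect v) + fb s k t x₁ x₂ 0 (reflect v)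
        + fk s k t x₁ x₂ 0 (reflect v)

/-! ### The quantities in the formulas for the pressures -/

/-- `ρ` of a profile, as a field. -/
def rhoF (h : Profile) : Field := fun t x₁ x₂ z => rho (h t x₁ x₂ z)

/-- `u_i` of a profile, as a field. -/
def velF (i : Fin 3) (h : Profile) : Field := fun t x₁ x₂ z => vel i (h t x₁ x₂ z)

/-- `θ` of a profile, as a field. -/
def thetaF (h : Profile) : Field := fun t x₁ x₂ z => theta (h t x₁ x₂ z)

/-- `ρ_k + θ_k`. -/
def rhoTheta (f : ℤ → Profile) (k : ℤ) : Field :=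
  fun t x₁ x₂ z => rhoF (f k) t x₁ x₂ z + thetaF (f k) t x₁ x₂ z

/-- `u_0 · u_m`. -/
def dotU (f : ℤ → Profile) (m : ℤ) : Field :=
  fun t x₁ x₂ z => ∑ i, velF i (f 0) t x₁ x₂ z * velF i (f m) t x₁ x₂ z

/-- The pressures: `p_k = ρ_k + θ_k` for `k ≤ n-3`, `p_{n-2} = ρ_{n-2} + θ_{n-2} - |u_0|²/3`,
`p_{n-2+m} = ρ_{n-2+m} + θ_{n-2+m} - (2/3) u_0·u_m` for `m ≥ 1`. -/
def pressure (n : ℕ) (f : ℤ → Profile) (k : ℤ) : Field :=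
  fun t x₁ x₂ z =>
    if k ≤ n - 3 then rhoTheta f k t x₁ x₂ z
    else if k = n - 2 then rhoTheta f k t x₁ x₂ z - (1 / 3) * dotU f 0 t x₁ x₂ z
    else rhoTheta f k t x₁ x₂ z - (2 / 3) * dotU f (k - (n - 2)) t x₁ x₂ z

/-- `G_j`, i.e. with `m = j + 1`,
`G_{m-1} = L⁻¹{ (I-P)[-∂_t f_{m-n} - v·∇_x f_{m-2}] + ∑_{i+j=m; i,j≥1} ½[Γ(f_i,f_j) + Γ(f_j,f_i)]
  + Γ(f_0,(I-P)f_m) + Γ((I-P)f_m,f_0) }`. -/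
def Gfun (n : ℕ) (τ : ℝ) (f : ℤ → Profile) (j : ℤ) (t x₁ x₂ x₃ : ℝ) : Vel → ℝ :=
  LInv fun v =>
    microP (fun w => - Dt τ (slice (f (j + 1 - n)) w) t x₁ x₂ x₃
        - transport (f (j - 1)) t x₁ x₂ x₃ w) v
      + ∑ i ∈ Finset.Icc 1 j, (1 / 2) * GamS (f i t x₁ x₂ x₃) (f (j + 1 - i) t x₁ x₂ x₃) v
      + GamS (f 0 t x₁ x₂ x₃) (microP (f (j + 1) t x₁ x₂ x₃)) v

/-- `⟨ℬ_3, G_j⟩` at the wall `s`. -/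
def B3G (n : ℕ) (τ : ℝ) (f : ℤ → Profile) (j : ℤ) (s : Side) (t x₁ x₂ : ℝ) : ℝ :=
  ∫ v : Vel, burnettB 2 v * Gfun n τ f j t x₁ x₂ s.pos v

/-- `θ_0` at the wall `s`. -/
def theta0W (f : ℤ → Profile) (s : Side) (t x₁ x₂ : ℝ) : ℝ := thetaF (f 0) t x₁ x₂ s.pos

/-- `div_∥ u_∥` of a viscous layer profile. -/
def divPar (h : Profile) : Field :=
  fun t x₁ x₂ y => D1 (velF 0 h) t x₁ x₂ y + D2 (velF 1 h) t x₁ x₂ y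

/-- `∂_t f̂_{k+2-2n} + v_∥·∇_∥ f̂_{k-n}`, so that `Ŝ_{k,1} = -P` of it. -/
def knSource (n : ℕ) (τ : ℝ) (fk : ℤ → Profile) (k : ℤ) (t x₁ x₂ η : ℝ) (v : Vel) : ℝ :=
  Dt τ (slice (fk (k + 2 - 2 * n)) v) t x₁ x₂ η + tangTransport (fk (k - n)) t x₁ x₂ η v

/-- `â_k` in `Ŝ_{k,1} = {â_k + b̂_k·v + ĉ_k |v|²} √μ`. -/
def aHat (n : ℕ) (τ : ℝ) (fk : ℤ → Profile) (k : ℤ) (t x₁ x₂ η : ℝ) : ℝ :=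
  -(rho (knSource n τ fk k t x₁ x₂ η) - 3 / 2 * theta (knSource n τ fk k t x₁ x₂ η))

/-- `ĉ_k` in `Ŝ_{k,1} = {â_k + b̂_k·v + ĉ_k |v|²} √μ`. -/
def cHat (n : ℕ) (τ : ℝ) (fk : ℤ → Profile) (k : ℤ) (t x₁ x₂ η : ℝ) : ℝ :=
  -(1 / 2 * theta (knSource n τ fk k t x₁ x₂ η))

/-- `Â_k^±`: the decaying solution of `∓ ∂_η Â = 2 â + 3 ĉ`. -/
def AHat (n : ℕ) (τ : ℝ) (s : Side) (fk : ℤ → Profile) (k : ℤ) (t x₁ x₂ η : ℝ) : ℝ :=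
  s.sgn * ∫ r in Ioi η, (2 * aHat n τ fk k t x₁ x₂ r + 3 * cHat n τ fk k t x₁ x₂ r)

/-- `Ĉ_k^±`: the decaying solution of `∓ ∂_η Ĉ = - â / 5`.  With `Â` this is what makes
`∓ v₃ ∂_η f̂_{k,1} - Ŝ_{k,1}` orthogonal to `1` and `|v|²` for
`f̂_{k,1} = {Â v₃ + B̂₁ v₃v₁ + B̂₂ v₃v₂ + B̂₃ + Ĉ v₃|v|²} √μ`. -/
def CHat (n : ℕ) (τ : ℝ) (s : Side) (fk : ℤ → Profile) (k : ℤ) (t x₁ x₂ η : ℝ) : ℝ :=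
  -(s.sgn / 5) * ∫ r in Ioi η, aHat n τ fk k t x₁ x₂ r

/-- `(Â_k + 5 Ĉ_k)(t, x_∥, 0)`. -/
def kn0 (n : ℕ) (τ : ℝ) (s : Side) (fk : ℤ → Profile) (k : ℤ) (t x₁ x₂ : ℝ) : ℝ :=
  AHat n τ s fk k t x₁ x₂ 0 + 5 * CHat n τ s fk k t x₁ x₂ 0

/-- The boundary value prescribed for `u_{k,3}` by the layers:
`-ū_{k,3}(t, x_∥, 0) - (Â_k + 5 Ĉ_k)(t, x_∥, 0)`. -/
def bdryU3 (n : ℕ) (τ : ℝ) (s : Side) (fb fk : ℤ → Profile) (k : ℤ) (t x₁ x₂ : ℝ) : ℝ :=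
  - velF 2 (fb k) t x₁ x₂ 0 - kn0 n τ s fk k t x₁ x₂

/-- The compatibility condition of the problem `div_x u_k = -∂_t ρ_{k+2-n}` in `Ω`, with
`u_{k,3}` on the walls prescribed by the boundary layers:
`∫_Ω (-∂_t ρ_{k+2-n}) dx = ∫_{𝕋²} (u_{k,3}|_{x₃=1} - u_{k,3}|_{x₃=0}) dx_∥` on `[0, τ]`. -/
def Compatible (n : ℕ) (τ : ℝ) (f : ℤ → Profile) (fb fk : Side → ℤ → Profile) (k : ℤ) : Prop :=
  ∀ t ∈ Icc 0 τ,
    intO (fun x₁ x₂ x₃ => - Dt τ (rhoF (f (k + 2 - n))) t x₁ x₂ x₃) =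
      intT (fun x₁ x₂ =>
        bdryU3 n τ Side.upper (fb Side.upper) (fk Side.upper) k t x₁ x₂
          - bdryU3 n τ Side.lower (fb Side.lower) (fk Side.lower) k t x₁ x₂)

/-- The terms common to all the formulas:
`-(2/3) ∫_0^t ∫_{𝕋²} (⟨ℬ_3,G_{k-1}^+⟩ - ⟨ℬ_3,G_{k-1}^-⟩)
 -(5/3) ∫_{𝕋²} ∫_0^∞ [(ρ̄_{k-1}^+ + ρ̄_{k-1}^-)(t) - (ρ̄_{k-1}^+ + ρ̄_{k-1}^-)(0)]
 -(5/3) ∫_0^t ∫_{𝕋²} ∫_0^∞ [div_∥ ū_{k-1,∥}^+ θ_0^+ + div_∥ ū_{k-1,∥}^- θ_0^-]`. -/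
def mainTerms (n : ℕ) (τ : ℝ) (f : ℤ → Profile) (fb : Side → ℤ → Profile) (k : ℤ) (t : ℝ) : ℝ :=
  - (2 / 3) * (∫ r in (0 : ℝ)..t, intT fun x₁ x₂ =>
      B3G n τ f (k - 1) Side.upper r x₁ x₂ - B3G n τ f (k - 1) Side.lower r x₁ x₂)
  - (5 / 3) * (intT fun x₁ x₂ => ∫ y in Ioi (0 : ℝ),
      ((rhoF (fb Side.upper (k - 1)) t x₁ x₂ y + rhoF (fb Side.lower (k - 1)) t x₁ x₂ y)
        - (rhoF (fb Side.upper (k - 1)) 0 x₁ x₂ y + rhoF (fb Side.lower (k - 1)) 0 x₁ x₂ y)))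
  - (5 / 3) * (∫ r in (0 : ℝ)..t, intT fun x₁ x₂ => ∫ y in Ioi (0 : ℝ),
      (divPar (fb Side.upper (k - 1)) r x₁ x₂ y * theta0W f Side.upper r x₁ x₂
        + divPar (fb Side.lower (k - 1)) r x₁ x₂ y * theta0W f Side.lower r x₁ x₂))

/-- `𝔠_{n-2}(t)`. -/
def meanC0 (n : ℕ) (τ : ℝ) (f : ℤ → Profile) (fb : Side → ℤ → Profile) (t : ℝ) : ℝ :=
  intO (rhoTheta f (n - 2) 0) - (1 / 3) * intO (dotU f 0 t) + mainTerms n τ f fb (n - 2) t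

/-- `𝔠_{n-2+m}(t)` for `m ≥ 1`. -/
def meanC (n : ℕ) (τ : ℝ) (f : ℤ → Profile) (fb fk : Side → ℤ → Profile) (m : ℤ) (t : ℝ) : ℝ :=
  intO (rhoTheta f (n - 2 + m) 0) - (2 / 3) * intO (dotU f m t)
  + mainTerms n τ f fb (n - 2 + m) t
  - (5 / 3) * (∫ r in (0 : ℝ)..t, intT fun x₁ x₂ => ∫ y in Ioi (0 : ℝ),
      (Dt τ (rhoF (fb Side.upper (m - 1))) r x₁ x₂ y * theta0W f Side.upper r x₁ x₂
        + Dt τ (rhoF (fb Side.lower (m - 1))) r x₁ x₂ y * theta0W f Side.lower r x₁ x₂))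
  + (5 / 3) * (∫ r in (0 : ℝ)..t, intT fun x₁ x₂ =>
      (kn0 n τ Side.upper (fk Side.upper) (2 * n - 4 + m) r x₁ x₂
        - kn0 n τ Side.lower (fk Side.lower) (2 * n - 4 + m) r x₁ x₂))
  + (5 / 3) * (∫ r in (0 : ℝ)..t, intT fun x₁ x₂ =>
      (kn0 n τ Side.upper (fk Side.upper) (n - 2 + m) r x₁ x₂ * theta0W f Side.upper r x₁ x₂
        - kn0 n τ Side.lower (fk Side.lower) (n - 2 + m) r x₁ x₂ * theta0W f Side.lower r x₁ x₂))

/-- The mean condition `∫_Ω p_k(t,x) dx = c(t)` on `[0, τ]` holds. -/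
def HasMean (τ : ℝ) (p : Field) (c : ℝ → ℝ) : Prop := ∀ t ∈ Icc 0 τ, intO (p t) = c t

/-- Among the fields `q` of class `C¹` in `x` with `∇_x q = ∇_x p` on `[0, τ] × Ω̄`, the field `p` is
the only one whose spatial mean is `c(t)`. -/
def UniqueWithMean (τ : ℝ) (p : Field) (c : ℝ → ℝ) : Prop :=
  HasMean τ p c ∧ ∀ q : Field,
    (∀ t ∈ Icc 0 τ, ContDiffOn ℝ 1 (fun x : ℝ × ℝ × ℝ => q t x.1 x.2.1 x.2.2)
      (univ ×ˢ univ ×ˢ Icc 0 1)) →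
    (∀ t ∈ Icc 0 τ, ∀ x₁ x₂ : ℝ, ∀ x₃ ∈ Icc (0 : ℝ) 1,
      D1 q t x₁ x₂ x₃ = D1 p t x₁ x₂ x₃ ∧ D2 q t x₁ x₂ x₃ = D2 p t x₁ x₂ x₃ ∧
        D3 (Icc 0 1) q t x₁ x₂ x₃ = D3 (Icc 0 1) p t x₁ x₂ x₃) →
    HasMean τ q c →
    ∀ t ∈ Icc 0 τ, ∀ x₁ x₂ : ℝ, ∀ x₃ ∈ Icc (0 : ℝ) 1, q t x₁ x₂ x₃ = p t x₁ x₂ x₃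

end EulerLimit

end

noncomputable section

namespace EulerLimit

/-! ### The Maxwellian weight -/

/-! Everything rests on the conservation laws. Tested against a collision invariant 1, v_i or |v|²,
every collision term of the three expansions vanishes, because (v,u,ω) ↦ (v',u',ω) is a
measure-preserving involution that leaves |(v-u)·ω| and √μ(u)√μ(v) unchanged. Only balance laws for
moments remain.

Wall fluxes. The mass law of the viscous layer integrated over y, and that of the Knudsen layer
integrated over η, give the normal momentum of each layer at the wall; for the Knudsen layer it is
exactly K_k (`IsViscous.vel_wall`, `IsKnudsen.vel_wall`). A profile even in v₃ carries no normal
momentum, so the specular condition yields u_{k,3} = d_k on the walls (`SpecularAt.velF_eq_bdryU3`).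
Part 1 is then conservation of mass on the channel.

Low orders. For k ≤ n-3 all terms opposite L f_k carry negative indices, so L f_k = 0. The entropy
identity makes f_k/√μ a continuous collision invariant, hence a combination of 1, v and |v|²
(`eq_macroP_of_linL_eq_zero`). Its stress is isotropic and the momentum law reduces to ∇p_k = 0:
this is part 2.

Means. The energy law with weight |v|²/3 gives the rate of change of the mean of ρ_k+θ_k in terms of
wall moments of f_{k+n-2}, where (|v|²/3)v₃ = (2/3)(v₃/2)(|v|²-5) + (5/3)v₃. By the mass law the
last term amounts to 5/3 of the rate of the mean of ρ_k. The compatibility condition at order k+n-2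
is a formula for this very rate through the layers, since tangential divergences have no mean on the
torus. It is therefore equivalent to an energy balance integrated in time (`compatible_iff_energy`).

Heat flux. What is left is the ℬ₃ moment of f_{k+n-2} at the walls. For collision invariants,
Γ_s(φ√μ,ψ√μ) = L(φψ√μ); as f₀ = Pf₀, this inverts L explicitly on Γ_s(f₀,Pf_k). The remaining terms
are inverted to G_{k-1}, and the explicit part contributes (5/2)(u_{0,3}θ_k + θ_0u_{k,3})
(`integral_burnett_LInv`; for k = 0 see `mom_burnett_of_linL_eq`). On the walls u_{0,3} = 0, and
u_{k,3} = d_k is expressed by the layer fluxes (`heatJump_eq`). Which layer terms survive depends on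
which indices are ≤ 0, and that separates cases 3 to 6. Uniqueness of the pressure holds because a
field on the channel with zero gradient is constant, and its mean fixes the constant. -/

lemma maxwellian_pos (v : Vel) : 0 < maxwellian v := by
  unfold maxwellian; positivity

lemma sqrtM_pos (v : Vel) : 0 < sqrtM v := Real.sqrt_pos.2 (maxwellian_pos v)

lemma sqrtM_mul_self (v : Vel) : sqrtM v * sqrtM v = maxwellian v :=
  Real.mul_self_sqrt (maxwellian_pos v).le

lemma continuous_maxwellian : Continuous maxwellian := by
  unfold maxwellian; fun_prop

lemma continuous_sqrtM : Continuous sqrtM := continuous_maxwellian.sqrt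

/-- The product sees the two velocities only through |v|²+|w|², so conservation of energy will make
it invariant under collisions. -/
lemma sqrtM_mul_sqrtM (v w : Vel) :
    sqrtM v * sqrtM w
      = (2 * Real.pi) ^ (-(3 / 2 : ℝ)) * Real.exp (-(‖v‖ ^ 2 + ‖w‖ ^ 2) / 4) := by
  unfold sqrtM
  rw [← Real.sqrt_mul (maxwellian_pos v).le]
  rw [Real.sqrt_eq_iff_mul_self_eq (by have := maxwellian_pos v; have := maxwellian_pos w; positivity)
    (by positivity)]
  unfold maxwellian
  have : Real.exp (-‖v‖ ^ 2 / 2) * Real.exp (-‖w‖ ^ 2 / 2)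
      = Real.exp (-(‖v‖ ^ 2 + ‖w‖ ^ 2) / 4) * Real.exp (-(‖v‖ ^ 2 + ‖w‖ ^ 2) / 4) := by
    rw [← Real.exp_add, ← Real.exp_add]; congr 1; ring
  linear_combination ((2 * Real.pi) ^ (-(3 / 2 : ℝ))) ^ 2 * this

lemma sqrtM_eq (v : Vel) :
    sqrtM v = Real.sqrt ((2 * Real.pi) ^ (-(3 / 2 : ℝ))) * Real.exp (-(‖v‖ ^ 2) / 4) := by
  unfold sqrtM
  rw [Real.sqrt_eq_iff_mul_self_eq (maxwellian_pos v).le (by positivity)]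
  unfold maxwellian
  have h1 := Real.mul_self_sqrt (show 0 ≤ (2 * Real.pi) ^ (-(3 / 2 : ℝ)) by positivity)
  have h2 : Real.exp (-(‖v‖ ^ 2) / 4) * Real.exp (-(‖v‖ ^ 2) / 4) = Real.exp (-(‖v‖ ^ 2) / 2) := by
    rw [← Real.exp_add]; congr 1; ring
  linear_combination -Real.exp (-(‖v‖ ^ 2) / 4) * Real.exp (-(‖v‖ ^ 2) / 4) * h1
    - (2 * Real.pi) ^ (-(3 / 2 : ℝ)) * h2

/-- `√μ` decays faster than any power. -/
lemma exists_pow_mul_sqrtM_le (N : ℕ) : ∃ C : ℝ, 0 ≤ C ∧ ∀ v, (1 + ‖v‖) ^ N * sqrtM v ≤ C := by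
  -- The power costs N! e^{1+r} with r = |v|, and 1 + r - r²/4 ≤ 2 with equality at r = 2; this is
  -- the factor e².
  refine ⟨N.factorial * Real.exp 2 * Real.sqrt ((2 * Real.pi) ^ (-(3 / 2 : ℝ))), by positivity,
    fun v => ?_⟩
  rw [sqrtM_eq]
  have h1 : (1 + ‖v‖) ^ N ≤ N.factorial * Real.exp (1 + ‖v‖) := by
    have := Real.pow_div_factorial_le_exp (1 + ‖v‖) (by positivity) N
    rwa [div_le_iff₀ (by positivity), mul_comm] at this
  have h2 : Real.exp (1 + ‖v‖) * Real.exp (-(‖v‖ ^ 2) / 4) ≤ Real.exp 2 := by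
    rw [← Real.exp_add]
    apply Real.exp_le_exp.2
    nlinarith [sq_nonneg (‖v‖ - 2)]
  calc (1 + ‖v‖) ^ N * (Real.sqrt ((2 * Real.pi) ^ (-(3 / 2 : ℝ))) * Real.exp (-(‖v‖ ^ 2) / 4))
      ≤ (N.factorial * Real.exp (1 + ‖v‖)) *
        (Real.sqrt ((2 * Real.pi) ^ (-(3 / 2 : ℝ))) * Real.exp (-(‖v‖ ^ 2) / 4)) := by gcongr
    _ = N.factorial * (Real.exp (1 + ‖v‖) * Real.exp (-(‖v‖ ^ 2) / 4)) *
        Real.sqrt ((2 * Real.pi) ^ (-(3 / 2 : ℝ))) := by ring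
    _ ≤ _ := by gcongr

lemma integrable_inv_pow_four : Integrable fun v : Vel => ((1 + ‖v‖) ^ 4)⁻¹ := by
  have := integrable_one_add_norm (E := Vel) (μ := volume) (r := 4) (by simp; norm_num)
  refine this.congr (.of_forall fun v => ?_)
  simp only
  rw [Real.rpow_neg (by positivity)]
  norm_cast

lemma integrable_pow_mul_sqrtM (N : ℕ) : Integrable fun v : Vel => (1 + ‖v‖) ^ N * sqrtM v := by
  obtain ⟨C, hC, h⟩ := exists_pow_mul_sqrtM_le (N + 4)
  refine (integrable_inv_pow_four.const_mul C).mono'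
    (by have := continuous_sqrtM; fun_prop) (.of_forall fun v => ?_)
  have hs := sqrtM_pos v
  rw [Real.norm_of_nonneg (by positivity), ← div_eq_mul_inv, le_div_iff₀ (by positivity)]
  calc (1 + ‖v‖) ^ N * sqrtM v * (1 + ‖v‖) ^ 4 = (1 + ‖v‖) ^ (N + 4) * sqrtM v := by ring
    _ ≤ C := h v

/-! ### Growth classes of functions of the velocity -/

/-- Measurable functions of polynomial growth. -/
def PolyB (ψ : Vel → ℝ) : Prop :=
  Measurable ψ ∧ ∃ (C : ℝ) (N : ℕ), 0 ≤ C ∧ ∀ v, |ψ v| ≤ C * (1 + ‖v‖) ^ N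

/-- Bounded measurable functions. -/
def BddM (g : Vel → ℝ) : Prop := Measurable g ∧ ∃ C : ℝ, 0 ≤ C ∧ ∀ v, |g v| ≤ C

/-- Measurable functions bounded by `C (1+|v|)^{-3}`. -/
def Wtd (g : Vel → ℝ) : Prop :=
  Measurable g ∧ ∃ C : ℝ, 0 ≤ C ∧ ∀ v, |g v| ≤ C * ((1 + ‖v‖) ^ 3)⁻¹

lemma inv_pow_le_one (v : Vel) (N : ℕ) : ((1 + ‖v‖) ^ N)⁻¹ ≤ 1 :=
  inv_le_one_of_one_le₀ (one_le_pow₀ (by linarith [norm_nonneg v]))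

lemma Wtd.bddM {g : Vel → ℝ} (h : Wtd g) : BddM g := by
  obtain ⟨hm, C, hC, hb⟩ := h
  exact ⟨hm, C, hC, fun v => (hb v).trans (mul_le_of_le_one_right hC (inv_pow_le_one v 3))⟩

lemma BddM.polyB {g : Vel → ℝ} (h : BddM g) : PolyB g := by
  obtain ⟨hm, C, hC, hb⟩ := h
  exact ⟨hm, C, 0, hC, fun v => by simpa using hb v⟩

lemma PolyB.mul {a b : Vel → ℝ} (ha : PolyB a) (hb : PolyB b) : PolyB fun v => a v * b v := by
  obtain ⟨ha, C, N, hC, hA⟩ := ha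
  obtain ⟨hb, D, M, hD, hB⟩ := hb
  refine ⟨ha.mul hb, C * D, N + M, by positivity, fun v => ?_⟩
  rw [abs_mul]
  calc |a v| * |b v| ≤ (C * (1 + ‖v‖) ^ N) * (D * (1 + ‖v‖) ^ M) :=
        mul_le_mul (hA v) (hB v) (abs_nonneg _) (by positivity)
    _ = _ := by ring

lemma PolyB.add {a b : Vel → ℝ} (ha : PolyB a) (hb : PolyB b) : PolyB fun v => a v + b v := by
  obtain ⟨ha, C, N, hC, hA⟩ := ha
  obtain ⟨hb, D, M, hD, hB⟩ := hb
  refine ⟨ha.add hb, C + D, N + M, by positivity, fun v => ?_⟩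
  have h1 : (1 : ℝ) ≤ 1 + ‖v‖ := by linarith [norm_nonneg v]
  calc |a v + b v| ≤ |a v| + |b v| := abs_add_le _ _
    _ ≤ C * (1 + ‖v‖) ^ N + D * (1 + ‖v‖) ^ M := add_le_add (hA v) (hB v)
    _ ≤ C * (1 + ‖v‖) ^ (N + M) + D * (1 + ‖v‖) ^ (N + M) := by
        gcongr <;> first | exact h1 | omega
    _ = _ := by ring

lemma polyB_const (c : ℝ) : PolyB fun _ => c :=
  ⟨measurable_const, |c|, 0, abs_nonneg c, fun v => by simp⟩

lemma PolyB.const_mul {a : Vel → ℝ} (c : ℝ) (ha : PolyB a) : PolyB fun v => c * a v :=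
  (polyB_const c).mul ha

lemma PolyB.sub {a b : Vel → ℝ} (ha : PolyB a) (hb : PolyB b) : PolyB fun v => a v - b v := by
  simpa [sub_eq_add_neg] using ha.add (hb.const_mul (-1))

lemma PolyB.sum {ι : Type*} (s : Finset ι) {a : ι → Vel → ℝ} (ha : ∀ i ∈ s, PolyB (a i)) :
    PolyB fun v => ∑ i ∈ s, a i v := by
  classical
  induction s using Finset.induction_on with
  | empty => simpa using polyB_const 0
  | insert i s hi ih =>
    simp only [Finset.sum_insert hi]
    exact (ha i (by simp)).add (ih fun j hj => ha j (by simp [hj]))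

lemma abs_coord_le (v : Vel) (i : Fin 3) : |v i| ≤ ‖v‖ := PiLp.norm_apply_le v i

lemma polyB_coord (i : Fin 3) : PolyB fun v : Vel => v i := by
  refine ⟨by fun_prop, 1, 1, zero_le_one, fun v => ?_⟩
  have := abs_coord_le v i
  linarith

lemma polyB_norm_sq : PolyB fun v : Vel => ‖v‖ ^ 2 := by
  refine ⟨by fun_prop, 1, 2, zero_le_one, fun v => ?_⟩
  rw [abs_of_nonneg (by positivity)]
  nlinarith [norm_nonneg v]

lemma polyB_burnettB_factor (i : Fin 3) : PolyB fun v : Vel => v i / 2 * (‖v‖ ^ 2 - 5) := by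
  have := ((polyB_coord i).const_mul (1 / 2)).mul (polyB_norm_sq.sub (polyB_const 5))
  refine (funext fun v => ?_ : (fun v : Vel => v i / 2 * (‖v‖ ^ 2 - 5)) = _) ▸ this
  ring

/-- A polynomial times `√μ` is in the weighted class. -/
lemma PolyB.wtd_mul_sqrtM {ψ : Vel → ℝ} (h : PolyB ψ) : Wtd fun v => ψ v * sqrtM v := by
  obtain ⟨hm, C, N, hC, hb⟩ := h
  obtain ⟨D, hD, h⟩ := exists_pow_mul_sqrtM_le (N + 3)
  refine ⟨hm.mul continuous_sqrtM.measurable, C * D, by positivity, fun v => ?_⟩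
  have hs := sqrtM_pos v
  rw [← div_eq_mul_inv, le_div_iff₀ (by positivity), abs_mul, abs_of_pos hs]
  calc |ψ v| * sqrtM v * (1 + ‖v‖) ^ 3
      ≤ (C * (1 + ‖v‖) ^ N) * sqrtM v * (1 + ‖v‖) ^ 3 := by gcongr; exact hb v
    _ = C * ((1 + ‖v‖) ^ (N + 3) * sqrtM v) := by ring
    _ ≤ C * D := by gcongr; exact h v

lemma wtd_sqrtM : Wtd sqrtM := by simpa using (polyB_const 1).wtd_mul_sqrtM

lemma PolyB.integrable {ψ : Vel → ℝ} (h : PolyB ψ) : Integrable fun v => sqrtM v * ψ v := by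
  obtain ⟨hm, C, N, hC, hb⟩ := h
  refine ((integrable_pow_mul_sqrtM N).const_mul C).mono'
    ((continuous_sqrtM.measurable.mul hm).aestronglyMeasurable) (.of_forall fun v => ?_)
  have hs := sqrtM_pos v
  rw [norm_mul, Real.norm_of_nonneg hs.le, Real.norm_eq_abs]
  calc sqrtM v * |ψ v| ≤ sqrtM v * (C * (1 + ‖v‖) ^ N) := by gcongr; exact hb v
    _ = _ := by ring

lemma PolyB.integrable_mul {ψ g : Vel → ℝ} (h : PolyB ψ) (hg : PolyB g) :
    Integrable fun v => ψ v * (sqrtM v * g v) :=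
  (h.mul hg).integrable.congr (.of_forall fun v => by simp only; ring)

lemma Wtd.add {a b : Vel → ℝ} (ha : Wtd a) (hb : Wtd b) : Wtd fun v => a v + b v := by
  obtain ⟨ha, C, hC, hA⟩ := ha
  obtain ⟨hb, D, hD, hB⟩ := hb
  refine ⟨ha.add hb, C + D, by positivity, fun v => ?_⟩
  calc |a v + b v| ≤ |a v| + |b v| := abs_add_le _ _
    _ ≤ _ := by rw [add_mul]; exact add_le_add (hA v) (hB v)

lemma Wtd.const_mul {a : Vel → ℝ} (c : ℝ) (ha : Wtd a) : Wtd fun v => c * a v := by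
  obtain ⟨ha, C, hC, hA⟩ := ha
  refine ⟨ha.const_mul c, |c| * C, by positivity, fun v => ?_⟩
  rw [abs_mul, mul_assoc]
  gcongr; exact hA v

lemma Wtd.sub {a b : Vel → ℝ} (ha : Wtd a) (hb : Wtd b) : Wtd fun v => a v - b v := by
  simpa [sub_eq_add_neg] using ha.add (hb.const_mul (-1))

/-! ### The collision transformation -/

/-- The unit sphere of directions. -/
abbrev Dir : Type := Metric.sphere (0 : Vel) 1

/-- The surface measure. -/
abbrev surf : Measure Dir := (volume : Measure Vel).toSphere

lemma inner_dir_self (ω : Dir) : inner ℝ (ω : Vel) (ω : Vel) = 1 := by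
  rw [real_inner_self_eq_norm_sq]; simp

/-- A collision reverses the relative velocity along ω. Hence colliding twice with the same ω is the
identity, and the kernel |(v-u)·ω| is unchanged. -/
lemma inner_post (u v : Vel) (ω : Dir) :
    inner ℝ (postV u v ω - postU u v ω) (ω : Vel) = -inner ℝ (v - u) (ω : Vel) := by
  unfold postV postU
  simp only [inner_sub_left, inner_add_left, inner_smul_left, inner_dir_self, conj_trivial]
  ring

lemma postU_post (u v : Vel) (ω : Dir) : postU (postU u v ω) (postV u v ω) ω = u := by
  have := inner_post u v ω
  rw [postU, this, postU]; module

lemma postV_post (u v : Vel) (ω : Dir) : postV (postU u v ω) (postV u v ω) ω = v := by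
  have := inner_post u v ω
  rw [postV, this, postV]; module

lemma postU_swap (u v : Vel) (ω : Dir) : postU v u ω = postV u v ω := by
  unfold postU postV
  rw [← neg_sub v u, inner_neg_left]; module

lemma postV_swap (u v : Vel) (ω : Dir) : postV v u ω = postU u v ω := by
  rw [← postU_swap]

lemma post_momentum (u v : Vel) (ω : Dir) : postU u v ω + postV u v ω = u + v := by
  unfold postU postV; module

lemma post_energy (u v : Vel) (ω : Dir) :
    ‖postU u v ω‖ ^ 2 + ‖postV u v ω‖ ^ 2 = ‖u‖ ^ 2 + ‖v‖ ^ 2 := by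
  unfold postU postV
  rw [norm_add_sq_real, norm_sub_sq_real, norm_smul, inner_smul_right, inner_smul_right]
  have : ‖(ω : Vel)‖ = 1 := by simp
  rw [this, inner_sub_left]
  simp only [mul_one, Real.norm_eq_abs, sq_abs]
  ring

lemma sqrtM_post (u v : Vel) (ω : Dir) :
    sqrtM (postU u v ω) * sqrtM (postV u v ω) = sqrtM u * sqrtM v := by
  rw [sqrtM_mul_sqrtM, sqrtM_mul_sqrtM, post_energy]

lemma abs_inner_dir_le (w : Vel) (ω : Dir) : |inner ℝ w (ω : Vel)| ≤ ‖w‖ := by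
  have := abs_real_inner_le_norm w (ω : Vel)
  simpa using this

/-- The bound has product form so that polynomial growth in a post-collisional velocity becomes
polynomial growth in u and v separately, against which √μ(u)√μ(v) is integrable. -/
lemma norm_postV_le (u v : Vel) (ω : Dir) : 1 + ‖postV u v ω‖ ≤ 2 * ((1 + ‖u‖) * (1 + ‖v‖)) := by
  have h1 : ‖postV u v ω‖ ≤ ‖v‖ + ‖v - u‖ := by
    unfold postV
    refine (norm_sub_le _ _).trans ?_
    rw [norm_smul]
    have := abs_inner_dir_le (v - u) ω
    simpa using this
  have h2 := norm_sub_le v u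
  nlinarith [norm_nonneg u, norm_nonneg v, mul_nonneg (norm_nonneg u) (norm_nonneg v)]

lemma norm_postU_le (u v : Vel) (ω : Dir) : 1 + ‖postU u v ω‖ ≤ 2 * ((1 + ‖u‖) * (1 + ‖v‖)) := by
  rw [← postV_swap, mul_comm (1 + ‖u‖)]; exact norm_postV_le v u ω

/-- The space of collisions `(v, (u, ω))`. -/
abbrev Coll : Type := Vel × (Vel × Dir)

/-- The measure `dv du dω`. -/
abbrev collMeas : Measure Coll :=
  (volume : Measure Vel).prod ((volume : Measure Vel).prod surf)

/-- After moving ω to the front, the map is a skew product over the identity in ω; it suffices to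
preserve Lebesgue measure on each fibre ℝ³ × ℝ³. -/
lemma measurePreserving_of_fibres {T : Dir → Vel × Vel → Vel × Vel}
    (hT : Measurable (Function.uncurry T))
    (h : ∀ ω, Measure.map (T ω) (volume.prod volume) = (volume : Measure Vel).prod volume) :
    MeasurePreserving (fun p : Coll => ((T p.2.2 (p.1, p.2.1)).1, ((T p.2.2 (p.1, p.2.1)).2, p.2.2)))
      collMeas collMeas := by
  have h1 : MeasurePreserving (fun p : Coll => (p.2.2, (p.1, p.2.1))) collMeas
      (surf.prod ((volume : Measure Vel).prod volume)) :=
    Measure.measurePreserving_swap.comp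
      (measurePreserving_prodAssoc (volume : Measure Vel) (volume : Measure Vel) surf).symm
  have h2 : MeasurePreserving (fun p : Dir × (Vel × Vel) => (p.1, T p.1 p.2))
      (surf.prod ((volume : Measure Vel).prod volume))
      (surf.prod ((volume : Measure Vel).prod volume)) :=
    (MeasurePreserving.id surf).skew_product hT (.of_forall h)
  have h3 : MeasurePreserving (fun p : Dir × (Vel × Vel) => (p.2.1, (p.2.2, p.1)))
      (surf.prod ((volume : Measure Vel).prod volume)) collMeas :=
    (measurePreserving_prodAssoc (volume : Measure Vel) (volume : Measure Vel) surf).comp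
      Measure.measurePreserving_swap
  exact h3.comp (h2.comp h1)

/-- An involution has det² = 1, hence Jacobian 1; no explicit determinant is needed. -/
lemma map_eq_of_involutive (T : Vel × Vel →ₗ[ℝ] Vel × Vel) (h : T ∘ₗ T = LinearMap.id) :
    Measure.map T (volume.prod volume) = (volume : Measure Vel).prod volume := by
  have hd : LinearMap.det T * LinearMap.det T = 1 := by
    rw [← LinearMap.det_comp, h, LinearMap.det_id]
  have h0 : LinearMap.det T ≠ 0 := by rintro h0; simp [h0] at hd
  rw [Measure.map_linearMap_addHaar_eq_smul_addHaar _ h0]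
  have : |(LinearMap.det T)⁻¹| = 1 := by
    rw [abs_inv, inv_eq_one]
    have : |LinearMap.det T| * |LinearMap.det T| = 1 := by rw [← abs_mul, hd, abs_one]
    nlinarith [abs_nonneg (LinearMap.det T)]
  simp [this]

/-- The collision map `(v, u, ω) ↦ (v', u', ω)`. -/
def collide (p : Coll) : Coll := (postV p.2.1 p.1 p.2.2, (postU p.2.1 p.1 p.2.2, p.2.2))

/-- The exchange `(v, u, ω) ↦ (u, v, ω)`. -/
def exch (p : Coll) : Coll := (p.2.1, (p.1, p.2.2))

lemma measurePreserving_collide : MeasurePreserving collide collMeas collMeas := by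
  refine measurePreserving_of_fibres (T := fun ω q => (postV q.2 q.1 ω, postU q.2 q.1 ω)) ?_ ?_
  · apply Continuous.measurable
    unfold postU postV Function.uncurry
    fun_prop
  · intro ω
    -- For fixed ω the collision is linear in (v,u): the component of v-u along ω is taken from v
    -- and given to u.
    let P : Vel × Vel →ₗ[ℝ] Vel :=
      ((innerSL ℝ (ω : Vel)).toLinearMap ∘ₗ
        (LinearMap.fst ℝ Vel Vel - LinearMap.snd ℝ Vel Vel)).smulRight (ω : Vel)
    let T : Vel × Vel →ₗ[ℝ] Vel × Vel :=
      (LinearMap.fst ℝ Vel Vel - P).prod (LinearMap.snd ℝ Vel Vel + P)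
    have hT : ⇑T = fun q : Vel × Vel => (postV q.2 q.1 ω, postU q.2 q.1 ω) := by
      funext q
      simp [T, P, postV, postU, real_inner_comm, inner_sub_left]
    rw [← hT]
    refine map_eq_of_involutive T (LinearMap.ext fun q => ?_)
    rw [LinearMap.comp_apply, hT]
    simp [postV_post, postU_post]

lemma measurePreserving_exch : MeasurePreserving exch collMeas collMeas := by
  refine measurePreserving_of_fibres (T := fun _ q => (q.2, q.1)) ?_ ?_
  · unfold Function.uncurry; fun_prop
  · intro ω
    exact Measure.prod_swap

/-! ### The collision operator as a single integral -/

instance : SFinite ((volume : Measure Vel).prod surf) := by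
  have : SFinite surf := inferInstance
  exact Measure.prod.instSFinite


/-- The weight `|(v-u)·ω| √μ(u)`. -/
def collKer (v : Vel) (p : Vel × Dir) : ℝ := |inner ℝ (v - p.1) (p.2 : Vel)| * sqrtM p.1

/-- The bracket `g(u') h(v') - g(u) h(v)`. -/
def brk (g h : Vel → ℝ) (v : Vel) (p : Vel × Dir) : ℝ :=
  g (postU p.1 v p.2) * h (postV p.1 v p.2) - g p.1 * h v

lemma continuous_collKer : Continuous fun q : Vel × (Vel × Dir) => collKer q.1 q.2 := by
  unfold collKer
  have := continuous_sqrtM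
  fun_prop

lemma continuous_postU : Continuous fun q : Vel × (Vel × Dir) => postU q.2.1 q.1 q.2.2 := by
  unfold postU; fun_prop

lemma continuous_postV : Continuous fun q : Vel × (Vel × Dir) => postV q.2.1 q.1 q.2.2 := by
  unfold postV; fun_prop

lemma measurable_brk {g h : Vel → ℝ} (hg : Measurable g) (hh : Measurable h) :
    Measurable fun q : Vel × (Vel × Dir) => brk g h q.1 q.2 := by
  unfold brk
  have h1 := hg.comp continuous_postU.measurable
  have h2 := hh.comp continuous_postV.measurable
  exact (h1.mul h2).sub ((hg.comp (measurable_fst.comp measurable_snd)).mul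
    (hh.comp measurable_fst))

lemma collKer_nonneg (v : Vel) (p : Vel × Dir) : 0 ≤ collKer v p :=
  mul_nonneg (abs_nonneg _) (sqrtM_pos _).le

lemma collKer_le (v : Vel) (p : Vel × Dir) :
    collKer v p ≤ (1 + ‖v‖) * ((1 + ‖p.1‖) ^ 1 * sqrtM p.1) := by
  unfold collKer
  have h1 := abs_inner_dir_le (v - p.1) p.2
  have h2 := norm_sub_le v p.1
  have hs := (sqrtM_pos p.1).le
  rw [pow_one, ← mul_assoc]
  gcongr
  nlinarith [norm_nonneg v, norm_nonneg p.1, mul_nonneg (norm_nonneg v) (norm_nonneg p.1)]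

/-- The total mass of the dominating weight. -/
def kerMass : ℝ :=
  ∫ p : Vel × Dir, (1 + ‖p.1‖) ^ 1 * sqrtM p.1 ∂((volume : Measure Vel).prod surf)

lemma integrable_fst_pow (N : ℕ) :
    Integrable (fun p : Vel × Dir => (1 + ‖p.1‖) ^ N * sqrtM p.1)
      ((volume : Measure Vel).prod surf) :=
  (integrable_pow_mul_sqrtM N).comp_fst surf

lemma kerMass_nonneg : 0 ≤ kerMass :=
  integral_nonneg fun p => mul_nonneg (by positivity) (sqrtM_pos _).le

lemma integrable_collKer_mul {F : Vel × Dir → ℝ} (hF : Measurable F) {C : ℝ} {v : Vel}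
    (hb : ∀ p, |F p| ≤ C) :
    Integrable (fun p => collKer v p * F p) ((volume : Measure Vel).prod surf) := by
  refine ((integrable_fst_pow 1).const_mul ((1 + ‖v‖) * C)).mono' ?_ (.of_forall fun p => ?_)
  · exact ((continuous_collKer.comp (by fun_prop : Continuous fun p : Vel × Dir => (v, p))).measurable.mul
      hF).aestronglyMeasurable
  · rw [norm_mul, Real.norm_of_nonneg (collKer_nonneg v p), Real.norm_eq_abs]
    have := sqrtM_pos p.1
    calc collKer v p * |F p| ≤ ((1 + ‖v‖) * ((1 + ‖p.1‖) ^ 1 * sqrtM p.1)) * C :=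
          mul_le_mul (collKer_le v p) (hb p) (abs_nonneg _) (by positivity)
      _ = _ := by ring

lemma abs_integral_collKer_mul_le {F : Vel × Dir → ℝ} {C : ℝ} {v : Vel}
    (hb : ∀ p, |F p| ≤ C) :
    |∫ p, collKer v p * F p ∂((volume : Measure Vel).prod surf)| ≤ (1 + ‖v‖) * C * kerMass := by
  unfold kerMass
  rw [← integral_const_mul, ← Real.norm_eq_abs]
  refine norm_integral_le_of_norm_le ((integrable_fst_pow 1).const_mul _) (.of_forall fun p => ?_)
  rw [norm_mul, Real.norm_of_nonneg (collKer_nonneg v p), Real.norm_eq_abs]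
  have := sqrtM_pos p.1
  calc collKer v p * |F p| ≤ ((1 + ‖v‖) * ((1 + ‖p.1‖) ^ 1 * sqrtM p.1)) * C :=
        mul_le_mul (collKer_le v p) (hb p) (abs_nonneg _) (by positivity)
    _ = _ := by ring

lemma abs_brk_le {g h : Vel → ℝ} {A B : ℝ} (hA : 0 ≤ A) (hg : ∀ v, |g v| ≤ A)
    (hh : ∀ v, |h v| ≤ B) (v : Vel) (p : Vel × Dir) : |brk g h v p| ≤ 2 * (A * B) := by
  have key : ∀ x y, |g x * h y| ≤ A * B := fun x y => by
    rw [abs_mul]; exact mul_le_mul (hg x) (hh y) (abs_nonneg _) hA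
  unfold brk
  have := (abs_sub _ _).trans (add_le_add (key (postU p.1 v p.2) (postV p.1 v p.2)) (key p.1 v))
  linarith

lemma integrable_collKer_brk {g h : Vel → ℝ} (hg : BddM g) (hh : BddM h) (v : Vel) :
    Integrable (fun p => collKer v p * brk g h v p) ((volume : Measure Vel).prod surf) := by
  obtain ⟨hg, A, hA, hgA⟩ := hg
  obtain ⟨hh, B, hB, hhB⟩ := hh
  exact integrable_collKer_mul
    ((measurable_brk hg hh).comp (by fun_prop : Measurable fun p : Vel × Dir => (v, p)))
    (abs_brk_le hA hgA hhB v)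

/-- Since √μ(u')√μ(v') = √μ(u)√μ(v), the gain and loss terms both contain √μ(v), which cancels the
division. For bounded arguments each term is integrable on its own, so they combine into one
integral. -/
lemma Gam_eq {g h : Vel → ℝ} (hg : BddM g) (hh : BddM h) (v : Vel) :
    Gam g h v = ∫ p, collKer v p * brk g h v p ∂((volume : Measure Vel).prod surf) := by
  obtain ⟨hg, A, hA, hgA⟩ := hg
  obtain ⟨hh, B, hB, hhB⟩ := hh
  have hv := sqrtM_pos v
  have key : ∀ x y, |g x * h y| ≤ A * B := fun x y => by
    rw [abs_mul]; exact mul_le_mul (hgA x) (hhB y) (abs_nonneg _) hA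
  have hm : Measurable fun p : Vel × Dir => (v, p) := by fun_prop
  have h1 : Integrable (fun p : Vel × Dir => collKer v p * (g (postU p.1 v p.2) * h (postV p.1 v p.2)))
      ((volume : Measure Vel).prod surf) :=
    integrable_collKer_mul (((hg.comp continuous_postU.measurable).mul
      (hh.comp continuous_postV.measurable)).comp hm) fun p => key _ _
  have h2 : Integrable (fun p : Vel × Dir => collKer v p * (g p.1 * h v))
      ((volume : Measure Vel).prod surf) :=
    integrable_collKer_mul ((hg.comp measurable_fst).mul measurable_const) fun p => key _ _
  have e1 : (∫ u : Vel, ∫ ω : Dir, |inner ℝ (v - u) (ω : Vel)| *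
      (sqrtM (postU u v ω) * g (postU u v ω) * (sqrtM (postV u v ω) * h (postV u v ω))) ∂surf)
      = sqrtM v * ∫ p : Vel × Dir, collKer v p * (g (postU p.1 v p.2) * h (postV p.1 v p.2))
        ∂((volume : Measure Vel).prod surf) := by
    rw [integral_prod _ h1, ← integral_const_mul]
    congr 1; funext u
    rw [← integral_const_mul]
    congr 1; funext ω
    simp only [collKer]
    linear_combination |inner ℝ (v - u) (ω : Vel)| * g (postU u v ω) * h (postV u v ω)
      * sqrtM_post u v ω
  have e2 : (∫ u : Vel, ∫ ω : Dir, |inner ℝ (v - u) (ω : Vel)| *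
      (sqrtM u * g u * (sqrtM v * h v)) ∂surf)
      = sqrtM v * ∫ p : Vel × Dir, collKer v p * (g p.1 * h v)
        ∂((volume : Measure Vel).prod surf) := by
    rw [integral_prod _ h2, ← integral_const_mul]
    congr 1; funext u
    rw [← integral_const_mul]
    congr 1; funext ω
    simp only [collKer]
    ring
  unfold Gam collQ
  rw [e1, e2, ← mul_sub, mul_div_cancel_left₀ _ hv.ne', ← integral_sub h1 h2]
  congr 1; funext p
  unfold brk; ring

/-- The symmetric bracket. -/
def brkS (g h : Vel → ℝ) (v : Vel) (p : Vel × Dir) : ℝ := brk g h v p + brk h g v p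

lemma GamS_eq {g h : Vel → ℝ} (hg : BddM g) (hh : BddM h) (v : Vel) :
    GamS g h v = ∫ p, collKer v p * brkS g h v p ∂((volume : Measure Vel).prod surf) := by
  unfold GamS brkS
  rw [Gam_eq hg hh, Gam_eq hh hg, ← integral_add (integrable_collKer_brk hg hh v)
    (integrable_collKer_brk hh hg v)]
  simp only [mul_add]

lemma integrable_collKer_brkS {g h : Vel → ℝ} (hg : BddM g) (hh : BddM h) (v : Vel) :
    Integrable (fun p => collKer v p * brkS g h v p) ((volume : Measure Vel).prod surf) := by
  refine ((integrable_collKer_brk hg hh v).add (integrable_collKer_brk hh hg v)).congr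
    (.of_forall fun p => ?_)
  simp only [brkS, mul_add, Pi.add_apply]

/-- Pointwise bound for the quadratic collision operator. -/
lemma abs_GamS_le {g h : Vel → ℝ} (hg : Measurable g) (hh : Measurable h) {A B : ℝ} (hA : 0 ≤ A)
    (hB : 0 ≤ B) (hgA : ∀ v, |g v| ≤ A) (hhB : ∀ v, |h v| ≤ B) (v : Vel) :
    |GamS g h v| ≤ 4 * kerMass * (A * B) * (1 + ‖v‖) := by
  rw [GamS_eq ⟨hg, A, hA, hgA⟩ ⟨hh, B, hB, hhB⟩]
  refine (abs_integral_collKer_mul_le (C := 4 * (A * B)) fun p => ?_).trans (le_of_eq (by ring))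
  have h1 := abs_brk_le hA hgA hhB v p
  have h2 := abs_brk_le hB hhB hgA v p
  have := abs_add_le (brk g h v p) (brk h g v p)
  unfold brkS
  nlinarith

lemma measurable_GamS {g h : Vel → ℝ} (hg : BddM g) (hh : BddM h) : Measurable (GamS g h) := by
  have : GamS g h = fun v => ∫ p, collKer v p * brkS g h v p ∂((volume : Measure Vel).prod surf) :=
    funext (GamS_eq hg hh)
  rw [this]
  refine (StronglyMeasurable.integral_prod_right (f := fun v p => collKer v p * brkS g h v p) ?_).measurable
  apply Measurable.stronglyMeasurable
  exact continuous_collKer.measurable.mul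
    ((measurable_brk hg.1 hh.1).add (measurable_brk hh.1 hg.1))

lemma polyB_GamS {g h : Vel → ℝ} (hg : BddM g) (hh : BddM h) : PolyB (GamS g h) := by
  refine ⟨measurable_GamS hg hh, ?_⟩
  obtain ⟨hg, A, hA, hgA⟩ := hg
  obtain ⟨hh, B, hB, hhB⟩ := hh
  have := kerMass_nonneg
  exact ⟨4 * kerMass * (A * B), 1, by positivity,
    fun v => by simpa using abs_GamS_le hg hh hA hB hgA hhB v⟩

lemma GamS_comm (g h : Vel → ℝ) : GamS g h = GamS h g := by
  funext v; unfold GamS; ring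

lemma GamS_add_right {g h k : Vel → ℝ} (hg : BddM g) (hh : BddM h) (hk : BddM k)
    (hs : BddM fun v => h v + k v) (v : Vel) :
    GamS g (fun w => h w + k w) v = GamS g h v + GamS g k v := by
  rw [GamS_eq hg hs, GamS_eq hg hh, GamS_eq hg hk, ← integral_add (integrable_collKer_brkS hg hh v)
    (integrable_collKer_brkS hg hk v)]
  congr 1; funext p
  unfold brkS brk; ring

lemma GamS_smul_right (g h : Vel → ℝ) (hg : BddM g) (hh : BddM h) (c : ℝ) (hs : BddM fun v => c * h v)
    (v : Vel) : GamS g (fun w => c * h w) v = c * GamS g h v := by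
  rw [GamS_eq hg hs, GamS_eq hg hh, ← integral_const_mul]
  congr 1; funext p
  unfold brkS brk; ring

/-- Because μ = √μ·√μ, the linearized operator is a case of the symmetrized quadratic one; all facts
about L below are read off from `GamS`. -/
lemma linL_eq (g : Vel → ℝ) (v : Vel) : linL g v = -GamS sqrtM g v := by
  unfold linL GamS Gam
  simp only [sqrtM_mul_self]
  ring

lemma bddM_sqrtM : BddM sqrtM := wtd_sqrtM.bddM

lemma linL_sub {g h : Vel → ℝ} (hg : Wtd g) (hh : Wtd h) (v : Vel) :
    linL (fun w => g w - h w) v = linL g v - linL h v := by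
  have h1 : (fun w => g w - h w) = fun w => g w + (-1) * h w := by funext w; ring
  rw [h1, linL_eq, linL_eq, linL_eq, GamS_add_right bddM_sqrtM hg.bddM (hh.const_mul (-1)).bddM
    (hg.add (hh.const_mul (-1))).bddM, GamS_smul_right _ _ bddM_sqrtM hh.bddM _
      (hh.const_mul (-1)).bddM]
  ring

/-! ### The weak form and the collision invariants -/

/-- The symmetric weight `|(v-u)·ω| √μ(u) √μ(v)`. -/
def collW (p : Coll) : ℝ := |inner ℝ (p.1 - p.2.1) (p.2.2 : Vel)| * (sqrtM p.2.1 * sqrtM p.1)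

lemma collW_eq (p : Coll) : collW p = sqrtM p.1 * collKer p.1 p.2 := by
  unfold collW collKer; ring

lemma collW_collide (p : Coll) : collW (collide p) = collW p := by
  unfold collW collide
  rw [inner_post, abs_neg, sqrtM_post]

lemma collW_exch (p : Coll) : collW (exch p) = collW p := by
  unfold collW exch
  rw [← neg_sub p.1, inner_neg_left, abs_neg, mul_comm (sqrtM _)]

lemma continuous_collW : Continuous collW := by
  have := continuous_sqrtM
  unfold collW
  fun_prop

lemma continuous_collide : Continuous collide := by
  unfold collide
  exact continuous_postV.prodMk (continuous_postU.prodMk (by fun_prop))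

lemma continuous_exch : Continuous exch := by
  unfold exch; fun_prop

/-- Functions on the collision space of polynomial growth. -/
def CollPoly (F : Coll → ℝ) : Prop :=
  Measurable F ∧ ∃ (C : ℝ) (N : ℕ), 0 ≤ C ∧ ∀ p, |F p| ≤ C * ((1 + ‖p.1‖) * (1 + ‖p.2.1‖)) ^ N

lemma CollPoly.mul {a b : Coll → ℝ} (ha : CollPoly a) (hb : CollPoly b) :
    CollPoly fun p => a p * b p := by
  obtain ⟨ha, C, N, hC, hA⟩ := ha
  obtain ⟨hb, D, M, hD, hB⟩ := hb
  refine ⟨ha.mul hb, C * D, N + M, by positivity, fun v => ?_⟩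
  rw [abs_mul, pow_add]
  exact (mul_le_mul (hA v) (hB v) (abs_nonneg _) (by positivity)).trans (le_of_eq (by ring))

lemma CollPoly.integrable {F : Coll → ℝ} (hF : CollPoly F) :
    Integrable (fun p => collW p * F p) collMeas := by
  obtain ⟨hF, C, N, hC, hb⟩ := hF
  have h := ((integrable_pow_mul_sqrtM (N + 1)).mul_prod (integrable_fst_pow (N + 1))).const_mul C
  refine h.mono' (continuous_collW.measurable.mul hF).aestronglyMeasurable (.of_forall fun p => ?_)
  have h1 := sqrtM_pos p.1
  have h2 := sqrtM_pos p.2.1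
  rw [norm_mul, collW_eq, Real.norm_of_nonneg (mul_nonneg h1.le (collKer_nonneg _ _)),
    Real.norm_eq_abs]
  calc sqrtM p.1 * collKer p.1 p.2 * |F p|
      ≤ sqrtM p.1 * ((1 + ‖p.1‖) * ((1 + ‖p.2.1‖) ^ 1 * sqrtM p.2.1)) *
        (C * ((1 + ‖p.1‖) * (1 + ‖p.2.1‖)) ^ N) := by
          gcongr
          · exact collKer_le _ _
          · exact hb p
    _ = _ := by rw [mul_pow]; ring

lemma PolyB.collPoly_fst {ψ : Vel → ℝ} (h : PolyB ψ) : CollPoly fun p => ψ p.1 := by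
  obtain ⟨hm, C, N, hC, hb⟩ := h
  refine ⟨hm.comp measurable_fst, C, N, hC, fun p => (hb _).trans ?_⟩
  gcongr
  nlinarith [norm_nonneg p.1, norm_nonneg p.2.1, mul_nonneg (norm_nonneg p.1) (norm_nonneg p.2.1)]

lemma PolyB.collPoly_snd {ψ : Vel → ℝ} (h : PolyB ψ) : CollPoly fun p => ψ p.2.1 := by
  obtain ⟨hm, C, N, hC, hb⟩ := h
  refine ⟨hm.comp (by fun_prop), C, N, hC, fun p => (hb _).trans ?_⟩
  gcongr
  nlinarith [norm_nonneg p.1, norm_nonneg p.2.1, mul_nonneg (norm_nonneg p.1) (norm_nonneg p.2.1)]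

lemma PolyB.collPoly_postV {ψ : Vel → ℝ} (h : PolyB ψ) :
    CollPoly fun p => ψ (postV p.2.1 p.1 p.2.2) := by
  obtain ⟨hm, C, N, hC, hb⟩ := h
  refine ⟨hm.comp continuous_postV.measurable, C * 2 ^ N, N, by positivity,
    fun p => (hb _).trans ?_⟩
  rw [mul_assoc, ← mul_pow]
  gcongr
  exact (norm_postV_le p.2.1 p.1 p.2.2).trans (le_of_eq (by ring))

lemma PolyB.collPoly_postU {ψ : Vel → ℝ} (h : PolyB ψ) :
    CollPoly fun p => ψ (postU p.2.1 p.1 p.2.2) := by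
  obtain ⟨hm, C, N, hC, hb⟩ := h
  refine ⟨hm.comp continuous_postU.measurable, C * 2 ^ N, N, by positivity,
    fun p => (hb _).trans ?_⟩
  rw [mul_assoc, ← mul_pow]
  gcongr
  exact (norm_postU_le p.2.1 p.1 p.2.2).trans (le_of_eq (by ring))

lemma measurableEmbedding_of_involutive {α : Type*} [MeasurableSpace α] {T : α → α}
    (hT : Measurable T) (h : ∀ p, T (T p) = p) : MeasurableEmbedding T :=
  (MeasurableEquiv.ofInvolutive T h hT).measurableEmbedding

lemma collide_collide (p : Coll) : collide (collide p) = p := by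
  obtain ⟨v, u, ω⟩ := p
  simp [collide, postV_post, postU_post]

lemma exch_exch (p : Coll) : exch (exch p) = p := rfl

lemma integral_collide (F : Coll → ℝ) :
    ∫ p, F (collide p) ∂collMeas = ∫ p, F p ∂collMeas :=
  measurePreserving_collide.integral_comp
    (measurableEmbedding_of_involutive continuous_collide.measurable collide_collide) F

lemma integral_exch (F : Coll → ℝ) :
    ∫ p, F (exch p) ∂collMeas = ∫ p, F p ∂collMeas :=
  measurePreserving_exch.integral_comp
    (measurableEmbedding_of_involutive continuous_exch.measurable exch_exch) F

/-- The change of variables `collide` in the gain term moves the primes from g and h to the test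
function φ. -/
lemma integral_poly_Gam {φ g h : Vel → ℝ} (hφ : PolyB φ) (hg : BddM g) (hh : BddM h) :
    (∫ v, φ v * (sqrtM v * Gam g h v)) =
      ∫ p : Coll, collW p * ((φ (postV p.2.1 p.1 p.2.2) - φ p.1) * (g p.2.1 * h p.1)) ∂collMeas := by
  have hg' := hg.polyB
  have hh' := hh.polyB
  have i1 := ((hφ.collPoly_fst.mul (hg'.collPoly_postU.mul hh'.collPoly_postV))).integrable
  have i2 := ((hφ.collPoly_fst.mul (hg'.collPoly_snd.mul hh'.collPoly_fst))).integrable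
  have i3 := ((hφ.collPoly_postV.mul (hg'.collPoly_snd.mul hh'.collPoly_fst))).integrable
  have e : (∫ v, φ v * (sqrtM v * Gam g h v)) =
      ∫ p : Coll, (collW p * (φ p.1 * (g (postU p.2.1 p.1 p.2.2) * h (postV p.2.1 p.1 p.2.2)))
        - collW p * (φ p.1 * (g p.2.1 * h p.1))) ∂collMeas := by
    refine Eq.trans ?_ (integral_prod _ (i1.sub i2)).symm
    congr 1; funext v
    simp only [Pi.sub_apply]
    rw [Gam_eq hg hh, ← mul_assoc, ← integral_const_mul]
    congr 1; funext p
    rw [collW_eq, brk]; ring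
  rw [e, integral_sub i1 i2, ← integral_collide]
  have e2 : (fun p : Coll => collW (collide p) * (φ (collide p).1 *
      (g (postU (collide p).2.1 (collide p).1 (collide p).2.2) *
        h (postV (collide p).2.1 (collide p).1 (collide p).2.2)))) =
      fun p => collW p * (φ (postV p.2.1 p.1 p.2.2) * (g p.2.1 * h p.1)) := by
    funext p
    rw [collW_collide]
    simp only [collide, postU_post, postV_post]
  rw [e2, ← integral_sub i3 i2]
  congr 1; funext p; ring

/-- Weak form of the symmetrized operator. -/
lemma integral_poly_GamS {φ g h : Vel → ℝ} (hφ : PolyB φ) (hg : BddM g) (hh : BddM h) :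
    (∫ v, φ v * (sqrtM v * GamS g h v)) =
      ∫ p : Coll, collW p * ((φ (postU p.2.1 p.1 p.2.2) + φ (postV p.2.1 p.1 p.2.2)
        - φ p.2.1 - φ p.1) * (g p.2.1 * h p.1)) ∂collMeas := by
  have hg' := hg.polyB
  have hh' := hh.polyB
  have hgh := hg'.collPoly_snd.mul hh'.collPoly_fst
  have i1 := (hφ.collPoly_fst.mul hgh).integrable
  have i2 := (hφ.collPoly_postV.mul hgh).integrable
  have i3 := (hφ.collPoly_snd.mul hgh).integrable
  have i4 := (hφ.collPoly_postU.mul hgh).integrable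
  have hG : ∀ {a b : Vel → ℝ}, BddM a → BddM b →
      Integrable fun v => φ v * (sqrtM v * Gam a b v) := by
    intro a b ha hb
    have j1 := (hφ.collPoly_fst.mul (ha.polyB.collPoly_postU.mul hb.polyB.collPoly_postV)).integrable
    have j2 := (hφ.collPoly_fst.mul (ha.polyB.collPoly_snd.mul hb.polyB.collPoly_fst)).integrable
    refine (j1.sub j2).integral_prod_left.congr (.of_forall fun v => ?_)
    simp only [Pi.sub_apply]
    rw [Gam_eq ha hb, ← mul_assoc, ← integral_const_mul]
    congr 1; funext p
    rw [collW_eq, brk]; ring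
  have e1 : (∫ v, φ v * (sqrtM v * GamS g h v)) =
      (∫ v, φ v * (sqrtM v * Gam g h v)) + ∫ v, φ v * (sqrtM v * Gam h g v) := by
    rw [← integral_add (hG hg hh) (hG hh hg)]
    congr 1; funext v; unfold GamS; ring
  -- Exchanging u and v in the Γ(h,g) half brings it to the same factor g(u)h(v), so that the two
  -- halves add up to the four-term defect of φ.
  have e2 : (fun p : Coll => collW (exch p) *
      ((φ (postV (exch p).2.1 (exch p).1 (exch p).2.2) - φ (exch p).1) *
        (h (exch p).2.1 * g (exch p).1))) =
      fun p => collW p * ((φ (postU p.2.1 p.1 p.2.2) - φ p.2.1) * (g p.2.1 * h p.1)) := by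
    funext p
    rw [collW_exch]
    simp only [exch, postV_swap]
    ring
  have e3 := integral_exch fun p : Coll => collW p *
    ((φ (postV p.2.1 p.1 p.2.2) - φ p.1) * (h p.2.1 * g p.1))
  rw [e1, integral_poly_Gam hφ hg hh, integral_poly_Gam hφ hh hg, ← e3, e2, ← integral_add]
  · congr 1; funext p; ring
  · exact (i2.sub i1).congr (.of_forall fun p => by simp only [Pi.sub_apply]; ring)
  · exact (i4.sub i3).congr (.of_forall fun p => by simp only [Pi.sub_apply]; ring)

section

/-- Collision invariants. -/
def CollInv (φ : Vel → ℝ) : Prop :=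
  ∀ u v : Vel, ∀ ω : Dir, φ (postU u v ω) + φ (postV u v ω) = φ u + φ v

lemma collInv_const (c : ℝ) : CollInv fun _ => c := fun _ _ _ => rfl

lemma collInv_coord (i : Fin 3) : CollInv fun v : Vel => v i := fun u v ω => by
  have := congrArg (fun w : Vel => w i) (post_momentum u v ω)
  simpa using this

lemma collInv_norm_sq : CollInv fun v : Vel => ‖v‖ ^ 2 := post_energy

lemma CollInv.add {a b : Vel → ℝ} (ha : CollInv a) (hb : CollInv b) :
    CollInv fun v => a v + b v := fun u v ω => by
  linear_combination ha u v ω + hb u v ω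

lemma CollInv.const_mul {a : Vel → ℝ} (c : ℝ) (ha : CollInv a) :
    CollInv fun v => c * a v := fun u v ω => by
  linear_combination c * ha u v ω

/-- The collision operator is orthogonal to the collision invariants. -/
lemma integral_collInv_GamS {φ g h : Vel → ℝ} (hφ : PolyB φ) (hi : CollInv φ) (hg : BddM g)
    (hh : BddM h) : (∫ v, φ v * (sqrtM v * GamS g h v)) = 0 := by
  rw [integral_poly_GamS hφ hg hh]
  refine integral_eq_zero_of_ae (.of_forall fun p => ?_)
  have := hi p.2.1 p.1 p.2.2
  simp only [Pi.zero_apply]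
  rw [show φ (postU p.2.1 p.1 p.2.2) + φ (postV p.2.1 p.1 p.2.2) - φ p.2.1 - φ p.1 = 0 by linarith]
  simp

/-- For collision invariants `φ, ψ`: `Γ(φ√μ, ψ√μ) + Γ(ψ√μ, φ√μ) = L(φψ√μ)`. -/
lemma GamS_collInv {φ ψ : Vel → ℝ} (hφ : PolyB φ) (hψ : PolyB ψ) (iφ : CollInv φ) (iψ : CollInv ψ)
    (v : Vel) : GamS (fun w => φ w * sqrtM w) (fun w => ψ w * sqrtM w) v
      = linL (fun w => φ w * ψ w * sqrtM w) v := by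
  have h1 := hφ.wtd_mul_sqrtM.bddM
  have h2 := hψ.wtd_mul_sqrtM.bddM
  have h3 := (hφ.mul hψ).wtd_mul_sqrtM.bddM
  rw [linL_eq, GamS_eq h1 h2, GamS_eq bddM_sqrtM h3, ← integral_neg]
  congr 1; funext p
  have hs := sqrtM_post p.1 v p.2
  have e1 := iφ p.1 v p.2
  have e2 := iψ p.1 v p.2
  unfold brkS brk
  set u' := postU p.1 v p.2
  set v' := postV p.1 v p.2
  -- Both sides are products of conserved sums: (φ(u')+φ(v'))(ψ(u')+ψ(v')) = (φ(u)+φ(v))(ψ(u)+ψ(v)).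
  -- The mixed products belong to Γ_s and the diagonal ones to -L.
  have e3 : φ u' * ψ v' + ψ u' * φ v' + φ u' * ψ u' + φ v' * ψ v' =
      φ p.1 * ψ v + ψ p.1 * φ v + φ p.1 * ψ p.1 + φ v * ψ v := by
    linear_combination (ψ u' + ψ v') * e1 + (φ p.1 + φ v) * e2
  linear_combination collKer v p * sqrtM u' * sqrtM v' * e3
    + collKer v p * (φ p.1 * ψ v + ψ p.1 * φ v + φ p.1 * ψ p.1 + φ v * ψ v) * hs

/-- With the invariant 1 as the other factor, the product identity reads Γ_s(√μ,φ√μ) = L(φ√μ), while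
the left side is -L(φ√μ). -/
lemma linL_collInv {φ : Vel → ℝ} (hφ : PolyB φ) (iφ : CollInv φ) (v : Vel) :
    linL (fun w => φ w * sqrtM w) v = 0 := by
  have := GamS_collInv (polyB_const 1) hφ (collInv_const 1) iφ v
  simp only [one_mul] at this
  have h2 := linL_eq (fun w => φ w * sqrtM w) v
  linarith

/-! ### The kernel of the linearized operator -/

/-- The weight `|(v-u)·ω| μ(u) μ(v)`. -/
def collE (p : Coll) : ℝ := collW p * (sqrtM p.2.1 * sqrtM p.1)

lemma collE_nonneg (p : Coll) : 0 ≤ collE p := by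
  have := sqrtM_pos p.1
  have := sqrtM_pos p.2.1
  unfold collE collW; positivity

lemma collE_collide (p : Coll) : collE (collide p) = collE p := by
  unfold collE
  rw [collW_collide]
  simp only [collide]
  rw [sqrtM_post]

lemma collE_exch (p : Coll) : collE (exch p) = collE p := by
  unfold collE
  rw [collW_exch]
  simp only [exch]
  rw [mul_comm (sqrtM p.1)]

lemma continuous_collE : Continuous collE := by
  have := continuous_sqrtM
  have := continuous_collW
  unfold collE; fun_prop

/-- The defect `φ(u') + φ(v') - φ(u) - φ(v)`. -/
def defect (φ : Vel → ℝ) (p : Coll) : ℝ :=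
  φ (postU p.2.1 p.1 p.2.2) + φ (postV p.2.1 p.1 p.2.2) - φ p.2.1 - φ p.1

/-- The cubic weight gives (1+|v|)g² = O((1+|v|)^{-5}), more than dimension three requires. The
factor 1+|v| is the growth of the hard-sphere collision frequency. -/
lemma integrable_norm_mul_sq {g : Vel → ℝ} (hg : Wtd g) :
    Integrable fun v : Vel => (1 + ‖v‖) * (g v) ^ 2 := by
  obtain ⟨hm, C, hC, hb⟩ := hg
  refine (integrable_inv_pow_four.const_mul (C ^ 2)).mono'
    (by fun_prop) (.of_forall fun v => ?_)
  rw [Real.norm_of_nonneg (by positivity)]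
  have h1 : (g v) ^ 2 ≤ (C * ((1 + ‖v‖) ^ 3)⁻¹) ^ 2 := by
    rw [← sq_abs]; gcongr; exact hb v
  have h2 := inv_pow_le_one v 1
  have h0 : 0 < 1 + ‖v‖ := by positivity
  calc (1 + ‖v‖) * (g v) ^ 2 ≤ (1 + ‖v‖) * (C * ((1 + ‖v‖) ^ 3)⁻¹) ^ 2 := by gcongr
    _ = C ^ 2 * ((1 + ‖v‖) ^ 4)⁻¹ * ((1 + ‖v‖) ^ 1)⁻¹ := by field_simp
    _ ≤ C ^ 2 * ((1 + ‖v‖) ^ 4)⁻¹ := mul_le_of_le_one_right (by positivity) h2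

/-! ### The entropy identity -/

section Entropy

variable {g : Vel → ℝ}

lemma integrable_collE_fst_sq (hg : Wtd g) :
    Integrable (fun p : Coll => collE p * (g p.1 / sqrtM p.1) ^ 2) collMeas := by
  obtain ⟨C, hC, hs⟩ := exists_pow_mul_sqrtM_le 0
  have h := ((integrable_norm_mul_sq hg).mul_prod (integrable_fst_pow 1)).const_mul C
  have hm := hg.1
  refine h.mono' ?_ (.of_forall fun p => ?_)
  · exact (continuous_collE.measurable.mul (((hm.comp measurable_fst).div
      (continuous_sqrtM.measurable.comp measurable_fst)).pow_const 2)).aestronglyMeasurable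
  · rw [Real.norm_of_nonneg (mul_nonneg (collE_nonneg p) (sq_nonneg _))]
    have h1 := sqrtM_pos p.1
    have h2 := sqrtM_pos p.2.1
    have h3 := hs p.2.1
    rw [pow_zero, one_mul] at h3
    have h4 := collKer_le p.1 p.2
    have e : collE p * (g p.1 / sqrtM p.1) ^ 2 = sqrtM p.2.1 * (collKer p.1 p.2 * (g p.1) ^ 2) := by
      rw [collE, collW_eq]; field_simp
    rw [e]
    calc sqrtM p.2.1 * (collKer p.1 p.2 * (g p.1) ^ 2)
        ≤ C * (((1 + ‖p.1‖) * ((1 + ‖p.2.1‖) ^ 1 * sqrtM p.2.1)) * (g p.1) ^ 2) := by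
          gcongr
          exact mul_nonneg (collKer_nonneg _ _) (sq_nonneg _)
      _ = _ := by ring

lemma integrable_comp_collide {F : Coll → ℝ} (h : Integrable F collMeas) :
    Integrable (fun p => F (collide p)) collMeas :=
  measurePreserving_collide.integrable_comp_of_integrable h

lemma integrable_comp_exch {F : Coll → ℝ} (h : Integrable F collMeas) :
    Integrable (fun p => F (exch p)) collMeas :=
  measurePreserving_exch.integrable_comp_of_integrable h

/-- The entropy identity: `L g = 0` forces the defect of `g/√μ` to vanish in the mean square. -/
lemma integral_collE_defect_sq (hg : Wtd g) (hL : ∀ v, linL g v = 0) :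
    Integrable (fun p => collE p * (defect (fun v => g v / sqrtM v) p) ^ 2) collMeas ∧
    ∫ p, collE p * (defect (fun v => g v / sqrtM v) p) ^ 2 ∂collMeas = 0 := by
  set φ : Vel → ℝ := fun v => g v / sqrtM v with hφ
  have hφm : Measurable φ := hg.1.div continuous_sqrtM.measurable
  have i1 : Integrable (fun p : Coll => collE p * (φ p.1) ^ 2) collMeas := integrable_collE_fst_sq hg
  have i2 : Integrable (fun p : Coll => collE p * (φ p.2.1) ^ 2) collMeas :=
    (integrable_comp_exch i1).congr (.of_forall fun p => by
      simp only [collE_exch]; rfl)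
  have i3 : Integrable (fun p : Coll => collE p * (φ (postV p.2.1 p.1 p.2.2)) ^ 2) collMeas :=
    (integrable_comp_collide i1).congr (.of_forall fun p => by
      simp only [collE_collide]; rfl)
  have i4 : Integrable (fun p : Coll => collE p * (φ (postU p.2.1 p.1 p.2.2)) ^ 2) collMeas :=
    (integrable_comp_collide i2).congr (.of_forall fun p => by
      simp only [collE_collide]; rfl)
  have hdm : Measurable (defect φ) := by
    unfold defect
    exact (((hφm.comp continuous_postU.measurable).add (hφm.comp continuous_postV.measurable)).sub
      (hφm.comp (by fun_prop))).sub (hφm.comp measurable_fst)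
  have hdom := (((i1.add i2).add i3).add i4).const_mul 4
  have hd : ∀ p, (defect φ p) ^ 2 ≤ 4 * ((φ p.1) ^ 2 + (φ p.2.1) ^ 2
      + (φ (postV p.2.1 p.1 p.2.2)) ^ 2 + (φ (postU p.2.1 p.1 p.2.2)) ^ 2) := by
    intro p
    unfold defect
    generalize φ p.1 = a
    generalize φ p.2.1 = b
    generalize φ (postV p.2.1 p.1 p.2.2) = c
    generalize φ (postU p.2.1 p.1 p.2.2) = d
    nlinarith [sq_nonneg (a - b), sq_nonneg (c - d), sq_nonneg (a + c), sq_nonneg (a + d),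
      sq_nonneg (b + c), sq_nonneg (b + d)]
  have iD : Integrable (fun p => collE p * (defect φ p) ^ 2) collMeas := by
    refine hdom.mono' (continuous_collE.measurable.mul (hdm.pow_const 2)).aestronglyMeasurable
      (.of_forall fun p => ?_)
    have := collE_nonneg p
    rw [Real.norm_of_nonneg (by positivity)]
    simp only [Pi.add_apply]
    calc _ ≤ collE p * (4 * _) := mul_le_mul_of_nonneg_left (hd p) this
      _ = _ := by ring
  have iX : ∀ x : Coll → ℝ, Measurable x → Integrable (fun p => collE p * (x p) ^ 2) collMeas →
      Integrable (fun p => collE p * (x p * defect φ p)) collMeas := by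
    intro x hx ix
    refine (ix.add iD).mono' (continuous_collE.measurable.mul (hx.mul hdm)).aestronglyMeasurable
      (.of_forall fun p => ?_)
    have := collE_nonneg p
    rw [norm_mul, Real.norm_of_nonneg this, Real.norm_eq_abs]
    simp only [Pi.add_apply]
    rw [← mul_add]
    refine mul_le_mul_of_nonneg_left ?_ this
    rw [abs_mul]
    nlinarith [sq_nonneg (|x p| - |defect φ p|), sq_abs (x p), sq_abs (defect φ p),
      sq_nonneg (x p), sq_nonneg (defect φ p)]
  have j1 := iX (fun p => φ p.1) (hφm.comp measurable_fst) i1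
  have j2 := iX (fun p => φ p.2.1) (hφm.comp (by fun_prop)) i2
  have j3 := iX (fun p => φ (postV p.2.1 p.1 p.2.2)) (hφm.comp continuous_postV.measurable) i3
  have j4 := iX (fun p => φ (postU p.2.1 p.1 p.2.2)) (hφm.comp continuous_postU.measurable) i4
  -- The defect is even under exchange and odd under collision, so the pairings of the defect with φ
  -- at v, u, v', u' agree up to sign; one vanishing pairing suffices.
  have dE : ∀ p, defect φ (exch p) = defect φ p := by
    intro p
    unfold defect exch
    dsimp only
    rw [postU_swap p.2.1 p.1, postV_swap p.2.1 p.1]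
    ring
  have dC : ∀ p, defect φ (collide p) = -defect φ p := by
    intro p
    unfold defect collide
    simp only [postU_post, postV_post]
    ring
  -- Integrating first over (u,ω) leaves -g(v) L g(v), which is zero.
  have z1 : ∫ p, collE p * (φ p.1 * defect φ p) ∂collMeas = 0 := by
    rw [integral_prod _ j1]
    have : ∀ v, ∫ p, collE (v, p) * (φ v * defect φ (v, p)) ∂((volume : Measure Vel).prod surf)
        = g v * -linL g v := by
      intro v
      rw [linL_eq, neg_neg, GamS_eq bddM_sqrtM hg.bddM, ← integral_const_mul]
      congr 1; funext p
      have s1 := sqrtM_pos v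
      have s2 := sqrtM_pos p.1
      have e := sqrtM_post p.1 v p.2
      have e1 : ∀ w, g w = φ w * sqrtM w := fun w => by
        have := (sqrtM_pos w).ne'
        simp only [hφ]; field_simp
      rw [collE, collW_eq, brkS, brk, brk, defect]
      simp only [e1]
      linear_combination -φ v * sqrtM v * collKer v p *
        (φ (postU p.1 v p.2) + φ (postV p.1 v p.2)) * e
    simp [this, hL]
  have z2 : ∫ p, collE p * (φ p.2.1 * defect φ p) ∂collMeas = 0 := by
    rw [← z1, ← integral_exch]
    congr 1; funext p
    rw [collE_exch, dE]; rfl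
  have z3 : ∫ p, collE p * (φ (postV p.2.1 p.1 p.2.2) * defect φ p) ∂collMeas = 0 := by
    rw [← neg_eq_zero, ← integral_neg, ← z1, ← integral_collide (fun p => collE p * (φ p.1 * defect φ p))]
    congr 1; funext p
    rw [collE_collide, dC]; simp only [collide]; ring
  have z4 : ∫ p, collE p * (φ (postU p.2.1 p.1 p.2.2) * defect φ p) ∂collMeas = 0 := by
    rw [← neg_eq_zero, ← integral_neg, ← z2, ← integral_collide (fun p => collE p * (φ p.2.1 * defect φ p))]
    congr 1; funext p
    rw [collE_collide, dC]; simp only [collide]; ring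
  refine ⟨iD, ?_⟩
  have e : (fun p => collE p * (defect φ p) ^ 2) = fun p =>
      (collE p * (φ (postU p.2.1 p.1 p.2.2) * defect φ p)
        + collE p * (φ (postV p.2.1 p.1 p.2.2) * defect φ p))
      - (collE p * (φ p.2.1 * defect φ p) + collE p * (φ p.1 * defect φ p)) := by
    funext p
    conv_lhs => rw [sq]; enter [2, 1]; rw [defect]
    ring
  have e' := integral_sub (j4.add j3) (j2.add j1)
  simp only [Pi.add_apply] at e'
  rw [e, e', integral_add j4 j3, integral_add j2 j1, z1, z2, z3, z4]
  simp

/-- The weighted square of the defect has zero integral, so it vanishes almost everywhere, and by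
continuity everywhere. The weight vanishes only when (v-u)·ω = 0, and then the collision changes
nothing. -/
lemma collInv_of_linL_eq_zero (hc : Continuous g) (hg : Wtd g) (hL : ∀ v, linL g v = 0) :
    CollInv fun v => g v / sqrtM v := by
  obtain ⟨hi, h0⟩ := integral_collE_defect_sq hg hL
  have hφ : Continuous fun v => g v / sqrtM v :=
    hc.div continuous_sqrtM fun v => (sqrtM_pos v).ne'
  have hdc : Continuous (defect fun v => g v / sqrtM v) := by
    unfold defect
    exact (((hφ.comp continuous_postU).add (hφ.comp continuous_postV)).sub
      (hφ.comp (by fun_prop))).sub (hφ.comp continuous_fst)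
  rw [integral_eq_zero_iff_of_nonneg (fun p => mul_nonneg (collE_nonneg p) (sq_nonneg _)) hi] at h0
  have h1 := (Continuous.ae_eq_iff_eq collMeas (continuous_collE.mul (hdc.pow 2))
    continuous_const).1 h0
  intro u v ω
  by_cases hz : inner ℝ (v - u) (ω : Vel) = 0
  · simp [postU, postV, hz]
  · have h2 : collE (v, (u, ω)) * (defect (fun v => g v / sqrtM v) (v, (u, ω))) ^ 2 = 0 :=
      congrFun h1 (v, (u, ω))
    rw [mul_eq_zero, sq_eq_zero_iff] at h2
    have s1 := sqrtM_pos v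
    have s2 := sqrtM_pos u
    rcases h2 with h2 | h2
    · exfalso
      have : 0 < collE (v, (u, ω)) := by
        unfold collE collW
        have := abs_pos.2 hz
        positivity
      exact this.ne' h2
    · unfold defect at h2
      linarith

end Entropy

end

/-! ### Continuous collision invariants -/

/-- Cauchy's equation on a half line: x ↦ f(x⁺) - f(x⁻) is an additive continuous extension to ℝ,
hence linear. -/
lemma eq_mul_of_additive_on_nonneg {f : ℝ → ℝ} (hf : Continuous f)
    (h : ∀ a b, 0 ≤ a → 0 ≤ b → f (a + b) = f a + f b) {a : ℝ} (ha : 0 ≤ a) : f a = a * f 1 := by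
  have h0 : f 0 = 0 := by have := h 0 0 le_rfl le_rfl; simp at this; exact this
  let F : ℝ → ℝ := fun x => f (max x 0) - f (max (-x) 0)
  have hF : ∀ x y, F (x + y) = F x + F y := by
    intro x y
    have e : max (x + y) 0 + (max (-x) 0 + max (-y) 0)
        = max (-(x + y)) 0 + (max x 0 + max y 0) := by
      have h3 : ∀ z : ℝ, max z 0 = max (-z) 0 + z := fun z => by
        rcases le_total z 0 with hz | hz
        · rw [max_eq_right hz, max_eq_left (by linarith)]; ring
        · rw [max_eq_left hz, max_eq_right (by linarith)]; ring
      rw [h3 (x + y), h3 x, h3 y]; ring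
    have p : ∀ z : ℝ, 0 ≤ max z 0 := fun z => le_max_right _ _
    have := congrArg f e
    rw [h _ _ (p _) (add_nonneg (p _) (p _)), h _ _ (p _) (p _), h _ _ (p _) (add_nonneg (p _) (p _)),
      h _ _ (p _) (p _)] at this
    simp only [F]
    linarith
  let G : ℝ →+ ℝ := AddMonoidHom.mk' F hF
  have hG : Continuous G := by
    change Continuous F
    fun_prop
  have := map_real_smul G hG a 1
  have e1 : G 1 = f 1 := by simp [G, F, h0]
  have e2 : G a = f a := by simp [G, F, h0, ha]
  rw [smul_eq_mul, mul_one, e1, e2, smul_eq_mul] at this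
  exact this

/-- Functions additive on orthogonal pairs. -/
def OrthAdd (ψ : Vel → ℝ) : Prop := ∀ x y : Vel, inner ℝ x y = 0 → ψ (x + y) = ψ x + ψ y

/-- The standard basis vectors. -/
def eb (i : Fin 3) : Vel := EuclideanSpace.single i (1 : ℝ)

lemma inner_eb_eb (i j : Fin 3) : inner ℝ (eb i) (eb j) = if i = j then (1 : ℝ) else 0 := by
  unfold eb
  rw [EuclideanSpace.inner_single_left]
  simp

lemma eq_sum_eb (v : Vel) : v = v 0 • eb 0 + (v 1 • eb 1 + v 2 • eb 2) := by
  ext i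
  fin_cases i <;> simp [eb]

/-- An even orthogonally additive function is a multiple of `|v|²`. -/
lemma OrthAdd.eq_of_even {E : Vel → ℝ} (hE : OrthAdd E) (hc : Continuous E)
    (he : ∀ v, E (-v) = E v) (v : Vel) : E v = ‖v‖ ^ 2 * E (eb 0) := by
  have hn : ∀ x y : Vel, ‖x‖ = ‖y‖ → E x = E y := by
    intro x y hxy
    -- For |x| = |y| the half sum and half difference are orthogonal, and x, y are their sum and
    -- difference. An even function cannot see the sign of the second summand, so E depends on |v|
    -- only.
    have ho : inner ℝ ((1 / 2 : ℝ) • (x + y)) ((1 / 2 : ℝ) • (x - y)) = 0 := by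
      rw [inner_smul_left, inner_smul_right, (real_inner_add_sub_eq_zero_iff x y).2 hxy]; simp
    have ho' : inner ℝ ((1 / 2 : ℝ) • (x + y)) (-((1 / 2 : ℝ) • (x - y))) = 0 := by
      rw [inner_neg_right, ho, neg_zero]
    have h1 := hE _ _ ho
    have h2 := hE _ _ ho'
    rw [he] at h2
    rw [show x = (1 / 2 : ℝ) • (x + y) + (1 / 2 : ℝ) • (x - y) by module, h1, ← h2]
    congr 1; module
  have heb : ∀ i, ‖eb i‖ = 1 := fun i => by simp [eb]
  -- As a function of the squared length, E is additive by Pythagoras applied to two orthogonal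
  -- axes.
  have hH := eq_mul_of_additive_on_nonneg (f := fun a => E (Real.sqrt a • eb 0)) (by fun_prop) (by
    intro a b ha hb
    have h1 : E (Real.sqrt (a + b) • eb 0) = E (Real.sqrt a • eb 0 + Real.sqrt b • eb 1) := by
      apply hn
      have h2 : ‖Real.sqrt a • eb 0 + Real.sqrt b • eb 1‖ ^ 2 = a + b := by
        rw [norm_add_sq_real, norm_smul, norm_smul, heb, heb, inner_smul_left, inner_smul_right,
          inner_eb_eb]
        simp [Real.sq_sqrt ha, Real.sq_sqrt hb]
      rw [norm_smul, heb, mul_one, Real.norm_of_nonneg (Real.sqrt_nonneg _), ← h2,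
        Real.sqrt_sq (norm_nonneg _)]
    have h3 : E (Real.sqrt b • eb 1) = E (Real.sqrt b • eb 0) :=
      hn _ _ (by rw [norm_smul, norm_smul, heb, heb])
    rw [h1, hE _ _ (by rw [inner_smul_left, inner_smul_right, inner_eb_eb]; simp), h3])
    (sq_nonneg ‖v‖)
  simp only [Real.sqrt_one, one_smul, Real.sqrt_sq (norm_nonneg v)] at hH
  rw [← hH]
  exact hn _ _ (by rw [norm_smul, heb, norm_norm, mul_one])

/-- An odd orthogonally additive function is linear. -/
lemma OrthAdd.eq_of_odd {O : Vel → ℝ} (hO : OrthAdd O) (hc : Continuous O)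
    (ho : ∀ v, O (-v) = -O v) (v : Vel) : O v = ∑ i, O (eb i) * v i := by
  have hline : ∀ (i : Fin 3) (s : ℝ), O (s • eb i) = O (eb i) * s := by
    intro i s
    have hne : i ≠ i + 1 := by fin_cases i <;> decide
    have hpos : ∀ a : ℝ, 0 ≤ a → O (a • eb i) = a * O ((1 : ℝ) • eb i) := fun a ha =>
      eq_mul_of_additive_on_nonneg (f := fun a => O (a • eb i)) (by fun_prop) (by
        intro a b ha hb
        -- The choice r² = ab makes a e_i + r e_{i+1} and b e_i - r e_{i+1} orthogonal; by oddness
        -- the ±r terms cancel and additivity along the axis remains.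
        set r := Real.sqrt (a * b)
        have hr : r * r = a * b := Real.mul_self_sqrt (mul_nonneg ha hb)
        have h1 := hO (a • eb i + r • eb (i + 1)) (b • eb i + (-r) • eb (i + 1)) (by
          simp only [inner_add_left, inner_add_right, inner_smul_left, inner_smul_right, inner_eb_eb,
            if_true, if_neg hne, if_neg hne.symm, conj_trivial]
          linarith)
        have h2 := hO (a • eb i) (r • eb (i + 1)) (by
          rw [inner_smul_left, inner_smul_right, inner_eb_eb, if_neg hne]; simp)
        have h3 := hO (b • eb i) ((-r) • eb (i + 1)) (by
          rw [inner_smul_left, inner_smul_right, inner_eb_eb, if_neg hne]; simp)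
        have h4 := ho (r • eb (i + 1))
        rw [← neg_smul] at h4
        rw [show (a + b) • eb i = a • eb i + r • eb (i + 1) + (b • eb i + (-r) • eb (i + 1)) by
          module, h1, h2, h3, h4]
        ring) ha
    rw [one_smul] at hpos
    rcases le_total 0 s with hs | hs
    · rw [hpos s hs]; ring
    · have := hpos (-s) (by linarith)
      rw [neg_smul, ho] at this
      linarith
  rw [Fin.sum_univ_three]
  conv_lhs => rw [eq_sum_eb v]
  rw [hO _ _ (by
      simp only [inner_add_right, inner_smul_left, inner_smul_right, inner_eb_eb]; simp),
    hO _ _ (by simp only [inner_smul_left, inner_smul_right, inner_eb_eb]; simp),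
    hline, hline, hline]
  ring

/-- With u = 0, v = x+y and ω = x/|x|, where x ⟂ y, the outgoing velocities are x and y, so φ - φ(0)
is additive on orthogonal pairs. Its odd part is linear and its even part is a multiple of |v|². -/
lemma CollInv.exists_eq {φ : Vel → ℝ} (h : CollInv φ) (hc : Continuous φ) :
    ∃ (a : ℝ) (b : Fin 3 → ℝ) (c : ℝ), ∀ v, φ v = a + ∑ i, b i * v i + c * ‖v‖ ^ 2 := by
  have hψ : OrthAdd fun v => φ v - φ 0 := by
    intro x y hxy
    by_cases hx : x = 0
    · simp [hx]
    have hx' : ‖x‖ ≠ 0 := norm_ne_zero_iff.2 hx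
    let ω : Dir := ⟨‖x‖⁻¹ • x, by simp [norm_smul, hx']⟩
    have hin : inner ℝ (x + y - 0) (ω : Vel) = ‖x‖ := by
      simp only [ω, sub_zero, inner_smul_right, inner_add_left, real_inner_self_eq_norm_sq,
        real_inner_comm x y, hxy]
      field_simp
      ring
    have hω : ‖x‖ • (ω : Vel) = x := by
      simp only [ω, smul_smul, mul_inv_cancel₀ hx', one_smul]
    have h1 := h 0 (x + y) ω
    rw [postU, postV, hin, hω, zero_add, add_sub_cancel_left] at h1
    simp only
    linarith
  have ho : OrthAdd fun v => φ v - φ (-v) := by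
    intro x y hxy
    have h1 := hψ x y hxy
    have h2 := hψ (-x) (-y) (by simpa using hxy)
    simp only at h1 h2 ⊢
    rw [neg_add]
    linarith
  have he : OrthAdd fun v => (φ v - φ 0) + (φ (-v) - φ 0) := by
    intro x y hxy
    have h1 := hψ x y hxy
    have h2 := hψ (-x) (-y) (by simpa using hxy)
    simp only at h1 h2 ⊢
    rw [neg_add]
    linarith
  refine ⟨φ 0, fun i => (φ (eb i) - φ (-eb i)) / 2,
    ((φ (eb 0) - φ 0) + (φ (-eb 0) - φ 0)) / 2, fun v => ?_⟩
  have h1 := ho.eq_of_odd (by fun_prop) (fun v => by simp) v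
  have h2 := he.eq_of_even (by fun_prop) (fun v => by simp only [neg_neg]; ring) v
  simp only at h1 h2
  rw [Fin.sum_univ_three] at h1 ⊢
  linear_combination (1 / 2) * h1 + (1 / 2) * h2

section

/-! ### Gaussian moments -/

/-- The one-dimensional standard Gaussian density. -/
def gauss1 (x : ℝ) : ℝ := (Real.sqrt (2 * Real.pi))⁻¹ * Real.exp (-(1 / 2) * x ^ 2)

lemma maxwellian_eq_prod (v : Vel) : maxwellian v = gauss1 (v 0) * gauss1 (v 1) * gauss1 (v 2) := by
  unfold maxwellian gauss1
  have h1 : (2 * Real.pi : ℝ) ^ (-(3 / 2 : ℝ)) = (Real.sqrt (2 * Real.pi))⁻¹ ^ 3 := by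
    rw [Real.sqrt_eq_rpow, ← Real.rpow_neg (by positivity), ← Real.rpow_natCast,
      ← Real.rpow_mul (by positivity)]
    norm_num
  rw [h1, EuclideanSpace.real_norm_sq_eq, Fin.sum_univ_three,
    show -(v 0 ^ 2 + v 1 ^ 2 + v 2 ^ 2) / 2
      = -(1 / 2) * v 0 ^ 2 + -(1 / 2) * v 1 ^ 2 + -(1 / 2) * v 2 ^ 2 by ring, Real.exp_add, Real.exp_add]
  ring

lemma integrable_pow_mul_gauss1 (k : ℕ) : Integrable fun x : ℝ => x ^ k * gauss1 x := by
  have := (integrable_rpow_mul_exp_neg_mul_sq (b := 1 / 2) (by norm_num) (s := k)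
    (by have : (0 : ℝ) ≤ k := Nat.cast_nonneg k
        linarith)).const_mul (Real.sqrt (2 * Real.pi))⁻¹
  refine this.congr (.of_forall fun x => ?_)
  simp only [gauss1, Real.rpow_natCast]; ring

/-- Moments of the standard Gaussian. -/
def gmom : ℕ → ℝ
  | 0 => 1
  | 1 => 0
  | n + 2 => (n + 1) * gmom n

/-- Integration by parts, since the Gaussian density γ satisfies γ' = -xγ. For k = 0 the truncated
exponent k-1 is harmless because of the factor k. -/
lemma integral_pow_succ_mul_gauss1 (k : ℕ) :
    ∫ x, x ^ (k + 1) * gauss1 x = ∫ x, (k * x ^ (k - 1)) * gauss1 x := by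
  have hd : ∀ x, HasDerivAt gauss1 (-x * gauss1 x) x := by
    intro x
    have h1 : HasDerivAt (fun x : ℝ => -(1 / 2) * x ^ 2) (-x) x := by
      have := (hasDerivAt_pow 2 x).const_mul (-(1 / 2) : ℝ)
      exact this.congr_deriv (by norm_num; ring)
    have := (h1.exp).const_mul (Real.sqrt (2 * Real.pi))⁻¹
    exact this.congr_deriv (by unfold gauss1; ring)
  have hi1 : Integrable (fun x : ℝ => x ^ k * (-x * gauss1 x)) :=
    (integrable_pow_mul_gauss1 (k + 1)).neg.congr (.of_forall fun x => by
      simp only [Pi.neg_apply]; ring)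
  have hi2 : Integrable (fun x : ℝ => (k * x ^ (k - 1)) * gauss1 x) :=
    ((integrable_pow_mul_gauss1 (k - 1)).const_mul (k : ℝ)).congr (.of_forall fun x => by
      simp only; ring)
  have := integral_mul_deriv_eq_deriv_mul_of_integrable (u := fun x : ℝ => x ^ k)
    (v := gauss1) (fun x _ => hasDerivAt_pow k x) (fun x _ => hd x) hi1 hi2
    (integrable_pow_mul_gauss1 k)
  have e : ∫ x, x ^ (k + 1) * gauss1 x = -∫ x, x ^ k * (-x * gauss1 x) := by
    rw [← integral_neg]
    congr 1; funext x; ring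
  rw [e, this, neg_neg]

lemma integral_pow_mul_gauss1 (k : ℕ) : ∫ x, x ^ k * gauss1 x = gmom k := by
  induction k using Nat.strong_induction_on with
  | _ k ih =>
    match k with
    | 0 =>
      have h := integral_gaussian (1 / 2)
      simp only [pow_zero, one_mul, gmom, gauss1]
      rw [integral_const_mul, h, show Real.pi / (1 / 2) = 2 * Real.pi by ring]
      exact inv_mul_cancel₀ (Real.sqrt_ne_zero'.2 (by positivity))
    | 1 =>
      have := integral_pow_succ_mul_gauss1 0
      simpa [gmom] using this
    | n + 2 =>
      rw [integral_pow_succ_mul_gauss1 (n + 1), gmom, ← ih n (by omega), ← integral_const_mul]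
      congr 1; funext x
      push_cast; ring

lemma integral_monomial (a b c : ℕ) :
    (∫ v : Vel, (v 0 ^ a * v 1 ^ b * v 2 ^ c) * maxwellian v) = gmom a * gmom b * gmom c := by
  rw [← (PiLp.volume_preserving_toLp (Fin 3)).integral_comp
    (MeasurableEquiv.toLp 2 (Fin 3 → ℝ)).measurableEmbedding]
  have h := integral_fintype_prod_volume_eq_prod (𝕜 := ℝ) (ι := Fin 3) (E := fun _ => ℝ)
    (fun i x => x ^ (![a, b, c] i) * gauss1 x)
  simp only [Fin.prod_univ_three, integral_pow_mul_gauss1] at h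
  simp only [Matrix.cons_val] at h
  rw [← h]
  congr 1; funext x
  rw [maxwellian_eq_prod]
  simp only
  ring

/-! ### Gaussian means of polynomials by computation on coefficients -/

/-- Polynomials in `v` as lists of monomials `(coefficient, exponents)`. -/
abbrev PolyList : Type := List (ℝ × ℕ × ℕ × ℕ)

/-- The value of a polynomial. -/
def PolyList.ev (L : PolyList) (v : Vel) : ℝ :=
  (L.map fun t => t.1 * (v 0 ^ t.2.1 * v 1 ^ t.2.2.1 * v 2 ^ t.2.2.2)).sum

/-- The Gaussian mean of a polynomial. -/
def PolyList.mean (L : PolyList) : ℝ :=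
  (L.map fun t => t.1 * (gmom t.2.1 * gmom t.2.2.1 * gmom t.2.2.2)).sum

/-- The product of polynomials. -/
def PolyList.mul (L M : PolyList) : PolyList :=
  L.flatMap fun s => M.map fun t =>
    (s.1 * t.1, s.2.1 + t.2.1, s.2.2.1 + t.2.2.1, s.2.2.2 + t.2.2.2)

lemma PolyList.ev_mul (L M : PolyList) (v : Vel) : (L.mul M).ev v = L.ev v * M.ev v := by
  induction L with
  | nil => simp [mul, ev]
  | cons s L ih =>
    have h1 : ∀ N : PolyList, PolyList.ev (N.map fun t : ℝ × ℕ × ℕ × ℕ =>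
        (s.1 * t.1, s.2.1 + t.2.1, s.2.2.1 + t.2.2.1, s.2.2.2 + t.2.2.2)) v
        = s.1 * (v 0 ^ s.2.1 * v 1 ^ s.2.2.1 * v 2 ^ s.2.2.2) * N.ev v := by
      intro N
      induction N with
      | nil => simp [ev]
      | cons t N ihN =>
        simp only [ev, List.map_cons, List.sum_cons] at ihN ⊢
        rw [ihN]; ring
    have h2 : (PolyList.mul (s :: L) M).ev v = PolyList.ev (M.map fun t : ℝ × ℕ × ℕ × ℕ =>
        (s.1 * t.1, s.2.1 + t.2.1, s.2.2.1 + t.2.2.1, s.2.2.2 + t.2.2.2)) v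
        + (PolyList.mul L M).ev v := by
      simp [mul, ev, List.flatMap_cons]
    rw [h2, h1, ih]
    simp only [ev, List.map_cons, List.sum_cons]; ring

lemma polyB_pow {a : Vel → ℝ} (h : PolyB a) (k : ℕ) : PolyB fun v => a v ^ k := by
  induction k with
  | zero => simpa using polyB_const 1
  | succ k ih => simpa only [pow_succ] using ih.mul h

lemma polyB_monomial (a b c : ℕ) : PolyB fun v : Vel => v 0 ^ a * v 1 ^ b * v 2 ^ c :=
  ((polyB_pow (polyB_coord 0) a).mul (polyB_pow (polyB_coord 1) b)).mul
    (polyB_pow (polyB_coord 2) c)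

lemma PolyB.integrable_maxwellian {ψ : Vel → ℝ} (h : PolyB ψ) :
    Integrable fun v => ψ v * maxwellian v :=
  (h.integrable_mul bddM_sqrtM.polyB).congr (.of_forall fun v => by
    simp only [sqrtM_mul_self])

lemma PolyList.integral (L : PolyList) :
    Integrable (fun v => L.ev v * maxwellian v) ∧ ∫ v, L.ev v * maxwellian v = L.mean := by
  induction L with
  | nil => simp [ev, mean]
  | cons t L ih =>
    have hi := (((polyB_monomial t.2.1 t.2.2.1 t.2.2.2).const_mul t.1)).integrable_maxwellian
    have e : (fun v => PolyList.ev (t :: L) v * maxwellian v) = fun v =>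
        (t.1 * (v 0 ^ t.2.1 * v 1 ^ t.2.2.1 * v 2 ^ t.2.2.2)) * maxwellian v
          + PolyList.ev L v * maxwellian v := by
      funext v; simp only [ev, List.map_cons, List.sum_cons]; ring
    rw [e]
    refine ⟨hi.add ih.1, ?_⟩
    rw [integral_add hi ih.1, ih.2]
    simp only [mul_assoc, integral_const_mul]
    have := integral_monomial t.2.1 t.2.2.1 t.2.2.2
    simp only [mul_assoc] at this
    rw [this]
    simp only [mean, List.map_cons, List.sum_cons, mul_assoc]

/-! ### Moments of hydrodynamic profiles -/

/-- The polynomial `ρ + u·v + (θ/2)(|v|² - 3)`. -/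
def hydro (r : ℝ) (u : Fin 3 → ℝ) (θ : ℝ) (v : Vel) : ℝ :=
  r + ∑ i, u i * v i + θ / 2 * (‖v‖ ^ 2 - 3)

/-- `hydro` as a list of monomials. -/
def hydroL (r : ℝ) (u : Fin 3 → ℝ) (θ : ℝ) : PolyList :=
  [(r - 3 / 2 * θ, 0, 0, 0), (u 0, 1, 0, 0), (u 1, 0, 1, 0), (u 2, 0, 0, 1),
    (θ / 2, 2, 0, 0), (θ / 2, 0, 2, 0), (θ / 2, 0, 0, 2)]

lemma hydroL_ev (r : ℝ) (u : Fin 3 → ℝ) (θ : ℝ) (v : Vel) :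
    (hydroL r u θ).ev v = hydro r u θ v := by
  simp only [hydroL, PolyList.ev, hydro, EuclideanSpace.real_norm_sq_eq, Fin.sum_univ_three,
    List.map_cons, List.map_nil, List.sum_cons, List.sum_nil]
  ring

lemma polyB_hydro (r : ℝ) (u : Fin 3 → ℝ) (θ : ℝ) : PolyB (hydro r u θ) :=
  ((polyB_const r).add (PolyB.sum _ fun i _ => (polyB_coord i).const_mul (u i))).add
    ((polyB_norm_sq.sub (polyB_const 3)).const_mul (θ / 2))

lemma collInv_hydro (r : ℝ) (u : Fin 3 → ℝ) (θ : ℝ) : CollInv (hydro r u θ) := by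
  intro a b ω
  simp only [hydro, Fin.sum_univ_three]
  linear_combination u 0 * collInv_coord 0 a b ω + u 1 * collInv_coord 1 a b ω
    + u 2 * collInv_coord 2 a b ω + θ / 2 * collInv_norm_sq a b ω

/-- Evaluation of a Gaussian integral from a list representation. -/
lemma integral_of_ev {F : Vel → ℝ} (L : PolyList) (h : ∀ v, F v = L.ev v * maxwellian v) :
    ∫ v, F v = L.mean := by
  rw [← L.integral.2]
  congr 1; funext v; exact h v

section HydroMoments

variable (r : ℝ) (u : Fin 3 → ℝ) (θ : ℝ)

lemma rho_hydro : rho (fun v => hydro r u θ v * sqrtM v) = r := by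
  unfold rho
  rw [integral_of_ev (hydroL r u θ) fun v => by rw [hydroL_ev, ← sqrtM_mul_self]; ring]
  simp [hydroL, PolyList.mean, gmom]
  ring

/-- The monomial `v_i`. -/
def coordL (i : Fin 3) : PolyList :=
  [(1, if i = 0 then 1 else 0, if i = 1 then 1 else 0, if i = 2 then 1 else 0)]

lemma coordL_ev (i : Fin 3) (v : Vel) : (coordL i).ev v = v i := by
  fin_cases i <;> simp [coordL, PolyList.ev]

/-- The polynomial `c (|v|² - a)`. -/
def normL (c a : ℝ) : PolyList :=
  [(c, 2, 0, 0), (c, 0, 2, 0), (c, 0, 0, 2), (-(c * a), 0, 0, 0)]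

lemma normL_ev (c a : ℝ) (v : Vel) : (normL c a).ev v = c * (‖v‖ ^ 2 - a) := by
  simp only [normL, PolyList.ev, EuclideanSpace.real_norm_sq_eq, Fin.sum_univ_three,
    List.map_cons, List.map_nil, List.sum_cons, List.sum_nil]
  ring

lemma vel_hydro (i : Fin 3) : vel i (fun v => hydro r u θ v * sqrtM v) = u i := by
  unfold vel
  rw [integral_of_ev ((coordL i).mul (hydroL r u θ)) fun v => by
    rw [PolyList.ev_mul, coordL_ev, hydroL_ev, ← sqrtM_mul_self]; ring]
  fin_cases i <;> simp [hydroL, coordL, PolyList.mul, PolyList.mean, gmom]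

lemma theta_hydro : theta (fun v => hydro r u θ v * sqrtM v) = θ := by
  unfold theta
  rw [integral_of_ev ((normL 1 3).mul (hydroL r u θ)) fun v => by
    rw [PolyList.ev_mul, normL_ev, hydroL_ev, ← sqrtM_mul_self]; ring]
  simp [hydroL, normL, PolyList.mul, PolyList.mean, gmom]
  ring

/-- Isotropy of this stress is what turns the momentum law into a statement about the pressure
gradient alone. -/
lemma stress_hydro (i j : Fin 3) :
    (∫ v : Vel, v i * v j * (sqrtM v * (hydro r u θ v * sqrtM v)))
      = if i = j then r + θ else 0 := by
  rw [integral_of_ev (((coordL i).mul (coordL j)).mul (hydroL r u θ)) fun v => by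
    rw [PolyList.ev_mul, PolyList.ev_mul, coordL_ev, coordL_ev, hydroL_ev, ← sqrtM_mul_self]; ring]
  fin_cases i <;> fin_cases j <;>
    simp [hydroL, coordL, PolyList.mul, PolyList.mean, gmom] <;> ring

/-- The constant 5 is the one that makes ℬ₃ orthogonal to v₃√μ: the Gaussian mean of v₃²|v|² is
3+1+1. Parity settles the other collision invariants. -/
lemma burnett_hydro :
    (∫ v : Vel, v 2 / 2 * (‖v‖ ^ 2 - 5) * (sqrtM v * (hydro r u θ v * sqrtM v))) = 0 := by
  rw [integral_of_ev (((coordL 2).mul (normL (1 / 2) 5)).mul (hydroL r u θ)) fun v => by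
    rw [PolyList.ev_mul, PolyList.ev_mul, coordL_ev, normL_ev, hydroL_ev, ← sqrtM_mul_self]; ring]
  simp [hydroL, coordL, normL, PolyList.mul, PolyList.mean, gmom]
  ring

set_option maxRecDepth 10000 in
-- Only products of v₃ with |v|²-3 survive parity and orthogonality, so the heat flux of a product
-- of hydrodynamic profiles pairs normal velocity with temperature. This is the source of the factor
-- 5/2 in the convective terms.
lemma burnett_hydro_mul (r' : ℝ) (u' : Fin 3 → ℝ) (θ' : ℝ) :
    (∫ v : Vel, v 2 / 2 * (‖v‖ ^ 2 - 5) * (sqrtM v * (hydro r u θ v * hydro r' u' θ' v * sqrtM v)))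
      = 5 / 2 * (u 2 * θ' + θ * u' 2) := by
  rw [integral_of_ev (((coordL 2).mul (normL (1 / 2) 5)).mul
    ((hydroL r u θ).mul (hydroL r' u' θ'))) fun v => by
    rw [PolyList.ev_mul, PolyList.ev_mul, PolyList.ev_mul, coordL_ev, normL_ev, hydroL_ev,
      hydroL_ev, ← sqrtM_mul_self]; ring]
  simp [hydroL, coordL, normL, PolyList.mul, PolyList.mean, gmom]
  ring

end HydroMoments

lemma macroP_eq (g : Vel → ℝ) : macroP g = fun v => hydro (rho g) (fun i => vel i g) (theta g) v * sqrtM v :=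
  rfl

lemma wtd_macroP (g : Vel → ℝ) : Wtd (macroP g) := (polyB_hydro _ _ _).wtd_mul_sqrtM

lemma continuous_macroP (g : Vel → ℝ) : Continuous (macroP g) := by
  have := continuous_sqrtM
  unfold macroP; fun_prop

/-- The kernel of the linearized operator. -/
lemma eq_macroP_of_linL_eq_zero {g : Vel → ℝ} (hc : Continuous g) (hg : Wtd g)
    (hL : ∀ v, linL g v = 0) : g = macroP g := by
  have hφ : Continuous fun v => g v / sqrtM v :=
    hc.div continuous_sqrtM fun v => (sqrtM_pos v).ne'
  obtain ⟨a, b, c, h⟩ := (collInv_of_linL_eq_zero hc hg hL).exists_eq hφ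
  have e : g = fun v => hydro (a + 3 * c) b (2 * c) v * sqrtM v := by
    funext v
    have := h v
    rw [div_eq_iff (sqrtM_pos v).ne'] at this
    rw [this, hydro]; ring
  rw [macroP_eq]
  conv_rhs => rw [e]
  simp only [rho_hydro, vel_hydro, theta_hydro]
  exact e

lemma linL_macroP (g : Vel → ℝ) (v : Vel) : linL (macroP g) v = 0 :=
  linL_collInv (polyB_hydro _ _ _) (collInv_hydro _ _ _) v

end

/-! ### Moments and the macro-micro decomposition -/

/-- The moment `∫ ψ √μ g dv`. -/
def mom (ψ g : Vel → ℝ) : ℝ := ∫ v, ψ v * (sqrtM v * g v)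

lemma mom_add {ψ g h : Vel → ℝ} (hψ : PolyB ψ) (hg : PolyB g) (hh : PolyB h) :
    mom ψ (fun v => g v + h v) = mom ψ g + mom ψ h := by
  unfold mom
  rw [← integral_add (hψ.integrable_mul hg) (hψ.integrable_mul hh)]
  congr 1; funext v; ring

lemma mom_const_mul (ψ g : Vel → ℝ) (c : ℝ) : mom ψ (fun v => c * g v) = c * mom ψ g := by
  unfold mom
  rw [← integral_const_mul]
  congr 1; funext v; ring

lemma mom_sub {ψ g h : Vel → ℝ} (hψ : PolyB ψ) (hg : PolyB g) (hh : PolyB h) :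
    mom ψ (fun v => g v - h v) = mom ψ g - mom ψ h := by
  unfold mom
  rw [← integral_sub (hψ.integrable_mul hg) (hψ.integrable_mul hh)]
  congr 1; funext v; ring

lemma mom_left_add {ψ φ g : Vel → ℝ} (hψ : PolyB ψ) (hφ : PolyB φ) (hg : PolyB g) :
    mom (fun v => ψ v + φ v) g = mom ψ g + mom φ g := by
  unfold mom
  rw [← integral_add (hψ.integrable_mul hg) (hφ.integrable_mul hg)]
  congr 1; funext v; ring

lemma mom_left_const_mul (ψ g : Vel → ℝ) (c : ℝ) : mom (fun v => c * ψ v) g = c * mom ψ g := by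
  unfold mom
  rw [← integral_const_mul]
  congr 1; funext v; ring

lemma mom_left_mul (ψ φ g : Vel → ℝ) : mom (fun v => ψ v * φ v) g = mom ψ (fun v => φ v * g v) := by
  unfold mom
  congr 1; funext v; ring

lemma rho_eq_mom (g : Vel → ℝ) : rho g = mom (fun _ => 1) g := by simp [rho, mom]

lemma vel_eq_mom (i : Fin 3) (g : Vel → ℝ) : vel i g = mom (fun v => v i) g := rfl

lemma theta_eq_mom (g : Vel → ℝ) : theta g = 1 / 3 * mom (fun v => ‖v‖ ^ 2 - 3) g := rfl

lemma polyB_energy : PolyB fun v : Vel => ‖v‖ ^ 2 - 3 := polyB_norm_sq.sub (polyB_const 3)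

lemma mom_norm_sq {g : Vel → ℝ} (hg : PolyB g) :
    mom (fun v => ‖v‖ ^ 2) g = 3 * theta g + 3 * rho g := by
  have := mom_left_add polyB_energy (polyB_const 3) hg
  rw [show (fun v : Vel => ‖v‖ ^ 2 - 3 + 3) = fun v => ‖v‖ ^ 2 by funext v; ring] at this
  rw [this, theta_eq_mom, rho_eq_mom,
    show mom (fun _ => (3 : ℝ)) g = mom (fun _ => 3 * 1) g by norm_num, mom_left_const_mul]
  ring

/-! ### Sources invisible to the conservation laws -/

/-- A source of polynomial growth without hydrodynamic moments. -/
def Null (h : Vel → ℝ) : Prop :=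
  PolyB h ∧ ∀ φ, PolyB φ → CollInv φ → mom φ h = 0

lemma Null.add {a b : Vel → ℝ} (ha : Null a) (hb : Null b) : Null fun v => a v + b v :=
  ⟨ha.1.add hb.1, fun φ h i => by rw [mom_add h ha.1 hb.1, ha.2 φ h i, hb.2 φ h i, add_zero]⟩

lemma Null.const_mul {a : Vel → ℝ} (c : ℝ) (ha : Null a) : Null fun v => c * a v :=
  ⟨ha.1.const_mul c, fun φ h i => by rw [mom_const_mul, ha.2 φ h i, mul_zero]⟩

lemma Null.sub {a b : Vel → ℝ} (ha : Null a) (hb : Null b) : Null fun v => a v - b v := by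
  simpa [sub_eq_add_neg] using ha.add (hb.const_mul (-1))

lemma null_zero : Null fun _ => 0 := ⟨polyB_const 0, fun φ _ _ => by simp [mom]⟩

lemma Null.sum {ι : Type*} (s : Finset ι) {a : ι → Vel → ℝ} (ha : ∀ i ∈ s, Null (a i)) :
    Null fun v => ∑ i ∈ s, a i v := by
  classical
  induction s using Finset.induction_on with
  | empty => simpa using null_zero
  | insert i s hi ih =>
    simp only [Finset.sum_insert hi]
    exact (ha i (by simp)).add (ih fun j hj => ha j (by simp [hj]))

lemma null_GamS {g h : Vel → ℝ} (hg : BddM g) (hh : BddM h) : Null (GamS g h) :=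
  ⟨polyB_GamS hg hh, fun _ hφ iφ => integral_collInv_GamS hφ iφ hg hh⟩

lemma null_linL {g : Vel → ℝ} (hg : BddM g) : Null (linL g) := by
  have := (null_GamS bddM_sqrtM hg).const_mul (-1)
  rw [show linL g = fun v => -1 * GamS sqrtM g v by funext v; rw [linL_eq]; ring]
  exact this

lemma collInv_energy : CollInv fun v : Vel => ‖v‖ ^ 2 - 3 := by
  simpa only [sub_eq_add_neg] using collInv_norm_sq.add (collInv_const (-3))

lemma Null.macroP {h : Vel → ℝ} (hh : Null h) : macroP h = fun _ => 0 := by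
  funext v
  unfold EulerLimit.macroP
  rw [rho_eq_mom, theta_eq_mom, hh.2 _ (polyB_const 1) (collInv_const 1),
    hh.2 _ polyB_energy collInv_energy]
  simp only [vel_eq_mom, hh.2 _ (polyB_coord _) (collInv_coord _)]
  simp

lemma mom_macroP (g : Vel → ℝ) :
    rho (macroP g) = rho g ∧ (∀ i, vel i (macroP g) = vel i g) ∧ theta (macroP g) = theta g := by
  rw [macroP_eq]
  exact ⟨rho_hydro _ _ _, fun i => vel_hydro _ _ _ i, theta_hydro _ _ _⟩

lemma wtd_microP {g : Vel → ℝ} (hg : Wtd g) : Wtd (microP g) := hg.sub (wtd_macroP g)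

lemma continuous_microP {g : Vel → ℝ} (hg : Continuous g) : Continuous (microP g) :=
  hg.sub (continuous_macroP g)

lemma Wtd.polyB {g : Vel → ℝ} (hg : Wtd g) : PolyB g := hg.bddM.polyB

lemma mom_microP {g : Vel → ℝ} (hg : Wtd g) :
    rho (microP g) = 0 ∧ (∀ i, vel i (microP g) = 0) ∧ theta (microP g) = 0 := by
  obtain ⟨h1, h2, h3⟩ := mom_macroP g
  have hs : ∀ ψ, PolyB ψ → mom ψ (microP g) = mom ψ g - mom ψ (macroP g) := fun ψ h =>
    mom_sub h hg.polyB (wtd_macroP g).polyB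
  refine ⟨?_, fun i => ?_, ?_⟩
  · rw [rho_eq_mom, hs _ (polyB_const 1), ← rho_eq_mom, ← rho_eq_mom, h1, sub_self]
  · rw [vel_eq_mom, hs _ (polyB_coord i), ← vel_eq_mom, ← vel_eq_mom, h2, sub_self]
  · rw [theta_eq_mom, hs _ polyB_energy, mul_sub, ← theta_eq_mom, ← theta_eq_mom, h3, sub_self]

lemma linL_microP {g : Vel → ℝ} (hg : Wtd g) (v : Vel) : linL (microP g) v = linL g v := by
  have := linL_sub hg (wtd_macroP g) v
  rw [linL_macroP, sub_zero] at this
  exact this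

/-! ### Heat flux and the inverse of the linearized operator -/

/-- Weight of the Burnett function. -/
def burnettW (v : Vel) : ℝ := v 2 / 2 * (‖v‖ ^ 2 - 5)

lemma polyB_burnettW : PolyB burnettW := polyB_burnettB_factor 2

lemma integral_burnettB (g : Vel → ℝ) : (∫ v, burnettB 2 v * g v) = mom burnettW g := by
  unfold mom burnettB burnettW
  congr 1; funext v; ring

lemma mom_burnett_microP {g : Vel → ℝ} (hg : Wtd g) : mom burnettW (microP g) = mom burnettW g := by
  have h0 : mom burnettW (macroP g) = 0 := burnett_hydro _ _ _
  have := mom_sub polyB_burnettW hg.polyB (wtd_macroP g).polyB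
  rw [h0, sub_zero] at this
  exact this

lemma Wtd.of_bound {g : Vel → ℝ} (hg : Measurable g) {C : ℝ}
    (h : ∀ v, |g v| ≤ C * ((1 + ‖v‖) ^ 3)⁻¹) : Wtd g :=
  ⟨hg, |C|, abs_nonneg C, fun v => (h v).trans (by gcongr; exact le_abs_self C)⟩

lemma IsLInv.wtd {h g : Vel → ℝ} (H : IsLInv h g) : Wtd g :=
  Wtd.of_bound H.1.measurable H.2.1.choose_spec

/-- The difference lies in ker L, hence equals its hydrodynamic part, which is zero by
orthogonality. The choice in `LInv` therefore returns any preimage one can exhibit. -/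
lemma IsLInv.unique {h g g' : Vel → ℝ} (H : IsLInv h g) (H' : IsLInv h g') : g = g' := by
  have w := H.wtd
  have w' := H'.wtd
  obtain ⟨c, -, r, u, t, l⟩ := H
  obtain ⟨c', -, r', u', t', l'⟩ := H'
  have hd : ∀ ψ, PolyB ψ → mom ψ (fun v => g v - g' v) = mom ψ g - mom ψ g' := fun ψ hψ =>
    mom_sub hψ w.polyB w'.polyB
  have hk := eq_macroP_of_linL_eq_zero (g := fun v => g v - g' v) (c.sub c') (w.sub w') fun v => by
    rw [linL_sub w w', l, l', sub_self]
  have h0 : macroP (fun v => g v - g' v) = fun _ => 0 := by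
    funext v
    unfold macroP
    have e1 : rho (fun v => g v - g' v) = 0 := by
      rw [rho_eq_mom, hd _ (polyB_const 1), ← rho_eq_mom, ← rho_eq_mom, r, r', sub_self]
    have e2 : ∀ i, vel i (fun v => g v - g' v) = 0 := fun i => by
      rw [vel_eq_mom, hd _ (polyB_coord i), ← vel_eq_mom, ← vel_eq_mom, u, u', sub_self]
    have e3 : theta (fun v => g v - g' v) = 0 := by
      rw [theta_eq_mom, hd _ polyB_energy, mul_sub, ← theta_eq_mom, ← theta_eq_mom, t, t', sub_self]
    simp [e1, e2, e3]
  rw [h0] at hk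
  funext v
  have := congrFun hk v
  linarith

lemma LInv_eq {h g : Vel → ℝ} (H : IsLInv h g) : LInv h = g := by
  have hex : ∃ g, IsLInv h g := ⟨g, H⟩
  unfold LInv
  rw [dif_pos hex]
  exact (Classical.choose_spec hex).unique H

/-- If `f₀` is hydrodynamic and `L F = T + N + Γ_s(f₀, f)` with `N` free of hydrodynamic moments,
then the heat flux of `F` is that of `L⁻¹{(I-P)T + N + Γ_s(f₀,(I-P)f)}` plus the convective part. -/
lemma integral_burnett_LInv {f₀ f F T N : Vel → ℝ} (h₀ : f₀ = macroP f₀) (hf : Wtd f)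
    (hF : Wtd F) (cF : Continuous F) (hN : Null N)
    (hL : ∀ v, linL F v = T v + N v + GamS f₀ f v) :
    (∫ v, burnettB 2 v * LInv (fun v => microP T v + N v + GamS f₀ (microP f) v) v)
      = mom burnettW F - 5 / 2 * (vel 2 f₀ * theta f + theta f₀ * vel 2 f) := by
  have w₀ : Wtd f₀ := h₀ ▸ wtd_macroP f₀
  have hT : T = fun v => linL F v - N v - GamS f₀ f v := by funext v; rw [hL]; ring
  -- T is a combination of terms without hydrodynamic moments, so the projection I-P in front of it
  -- does nothing.
  have nT : Null T := hT ▸ ((null_linL hF.bddM).sub hN).sub (null_GamS w₀.bddM hf.bddM)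
  have eT : ∀ v, microP T v = T v := fun v => by
    unfold microP; rw [nT.macroP]; simp
  let φ : Vel → ℝ := hydro (rho f₀) (fun i => vel i f₀) (theta f₀)
  let ψ : Vel → ℝ := hydro (rho f) (fun i => vel i f) (theta f)
  have hφ : PolyB φ := polyB_hydro _ _ _
  have hψ : PolyB ψ := polyB_hydro _ _ _
  -- L W = Γ_s(f₀,Pf), so W is an explicit preimage of the hydrodynamic part of Γ_s(f₀,f).
  let W : Vel → ℝ := fun v => φ v * ψ v * sqrtM v
  have hW : Wtd W := (hφ.mul hψ).wtd_mul_sqrtM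
  have cW : Continuous W := by
    have := continuous_sqrtM
    simp only [W, φ, ψ, hydro]
    fun_prop
  have e₀ : f₀ = fun v => φ v * sqrtM v := h₀
  have eG : ∀ v, GamS f₀ (macroP f) v = linL W v := fun v => by
    have := GamS_collInv hφ hψ (collInv_hydro _ _ _) (collInv_hydro _ _ _) v
    rw [← e₀] at this
    exact this
  have hsplit : ∀ v, GamS f₀ f v = GamS f₀ (macroP f) v + GamS f₀ (microP f) v := fun v => by
    have hs : f = fun v => macroP f v + microP f v := by funext v; unfold microP; ring
    have := GamS_add_right w₀.bddM (wtd_macroP f).bddM (wtd_microP hf).bddM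
      (hs ▸ hf.bddM) v
    rw [← hs] at this
    exact this
  have wG : Wtd fun v => microP F v - microP W v := (wtd_microP hF).sub (wtd_microP hW)
  -- Subtracting W from F removes Γ_s(f₀,Pf) from the right side; projecting both with I-P gives the
  -- orthogonal preimage without changing L or the ℬ₃ moment.
  have H : IsLInv (fun v => microP T v + N v + GamS f₀ (microP f) v)
      (fun v => microP F v - microP W v) := by
    obtain ⟨r, u, t⟩ := mom_microP hF
    obtain ⟨r', u', t'⟩ := mom_microP hW
    have hd : ∀ ψ, PolyB ψ → mom ψ (fun v => microP F v - microP W v)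
        = mom ψ (microP F) - mom ψ (microP W) := fun ψ hψ =>
      mom_sub hψ (wtd_microP hF).polyB (wtd_microP hW).polyB
    refine ⟨(continuous_microP cF).sub (continuous_microP cW), ⟨wG.2.choose, wG.2.choose_spec.2⟩,
      ?_, fun i => ?_, ?_, fun v => ?_⟩
    · rw [rho_eq_mom, hd _ (polyB_const 1), ← rho_eq_mom, ← rho_eq_mom, r, r', sub_self]
    · rw [vel_eq_mom, hd _ (polyB_coord i), ← vel_eq_mom, ← vel_eq_mom, u, u', sub_self]
    · rw [theta_eq_mom, hd _ polyB_energy, mul_sub, ← theta_eq_mom, ← theta_eq_mom, t, t', sub_self]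
    · rw [linL_sub (wtd_microP hF) (wtd_microP hW), linL_microP hF, linL_microP hW, hL, hsplit,
        eG]
      simp only [eT]
      ring
  have hm := mom_sub polyB_burnettW (wtd_microP hF).polyB (wtd_microP hW).polyB
  rw [LInv_eq H, integral_burnettB, hm, mom_burnett_microP hF, mom_burnett_microP hW]
  congr 1
  exact burnett_hydro_mul _ _ _ _ _ _

/-- If `f₀` is hydrodynamic and `L F = Γ(f₀, f₀)` then the heat flux of `F` is convective. -/
lemma mom_burnett_of_linL_eq {f₀ F : Vel → ℝ} (h₀ : f₀ = macroP f₀) (hF : Wtd F)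
    (cF : Continuous F) (hL : ∀ v, linL F v = 1 / 2 * GamS f₀ f₀ v) :
    mom burnettW F = 5 / 2 * (vel 2 f₀ * theta f₀) := by
  let φ : Vel → ℝ := hydro (rho f₀) (fun i => vel i f₀) (theta f₀)
  have hφ : PolyB φ := polyB_hydro _ _ _
  let W : Vel → ℝ := fun v => φ v * φ v * sqrtM v
  have hW : Wtd W := (hφ.mul hφ).wtd_mul_sqrtM
  have cW : Continuous W := by
    have := continuous_sqrtM
    simp only [W, φ, hydro]
    fun_prop
  have e₀ : f₀ = fun v => φ v * sqrtM v := h₀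
  have eG : ∀ v, GamS f₀ f₀ v = linL W v := fun v => by
    have := GamS_collInv hφ hφ (collInv_hydro _ _ _) (collInv_hydro _ _ _) v
    rw [← e₀] at this
    exact this
  have wH := hW.const_mul (1 / 2)
  have hz : ∀ v, linL (fun w => F w - 1 / 2 * W w) v = 0 := fun v => by
    rw [linL_sub hF wH, hL, eG, linL_eq, linL_eq, GamS_smul_right _ _ bddM_sqrtM hW.bddM _ wH.bddM]
    ring
  -- F differs from φ²√μ/2 by an element of ker L, to which the ℬ₃ moment is blind.
  have hk := eq_macroP_of_linL_eq_zero (g := fun w => F w - 1 / 2 * W w)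
    (cF.sub (cW.const_mul (1 / 2))) (hF.sub wH) hz
  have h1 := mom_sub polyB_burnettW hF.polyB wH.polyB
  have h2 : mom burnettW (fun w => F w - 1 / 2 * W w) = 0 := by
    rw [hk]; exact burnett_hydro _ _ _
  have h3 : mom burnettW W = 5 / 2 * (vel 2 f₀ * theta f₀ + theta f₀ * vel 2 f₀) :=
    burnett_hydro_mul _ _ _ _ _ _
  rw [h2, mom_const_mul, h3] at h1
  linarith

section

/-! ### Smooth profiles and their moments -/

/-- The space-time domain with normal variable in `I`. -/
abbrev Dom (τ : ℝ) (I : Set ℝ) : Set (ℝ × ℝ × ℝ × ℝ) := Icc 0 τ ×ˢ univ ×ˢ univ ×ˢ I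

/-- A field as a function of one variable. -/
def Field.unc (q : Field) (p : ℝ × ℝ × ℝ × ℝ) : ℝ := q p.1 p.2.1 p.2.2.1 p.2.2.2

/-- Fields of class `C¹` up to the boundary. -/
def C1Field (τ : ℝ) (I : Set ℝ) (q : Field) : Prop := ContDiffOn ℝ 1 q.unc (Dom τ I)

/-- The partial derivatives in `t, x₁, x₂` and the normal variable. -/
def Dd (τ : ℝ) (I : Set ℝ) (d : Fin 4) : Field → Field := ![Dt τ, D1, D2, D3 I] d

/-- The coordinate directions. -/
def dir (d : Fin 4) : ℝ × ℝ × ℝ × ℝ :=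
  ![(1, 0, 0, 0), (0, 1, 0, 0), (0, 0, 1, 0), (0, 0, 0, 1)] d

lemma uniqueDiffOn_dom {τ : ℝ} (hτ : 0 < τ) {I : Set ℝ} (hI : UniqueDiffOn ℝ I) :
    UniqueDiffOn ℝ (Dom τ I) :=
  (uniqueDiffOn_Icc hτ).prod (uniqueDiffOn_univ.prod (uniqueDiffOn_univ.prod hI))

section Partials

variable {E : Type*} [NormedAddCommGroup E] [NormedSpace ℝ E] {τ : ℝ} {I : Set ℝ}
  {g : ℝ × ℝ × ℝ × ℝ → E} {t x₁ x₂ z : ℝ}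

lemma hasDerivWithinAt_dt (hg : DifferentiableOn ℝ g (Dom τ I)) (ht : t ∈ Icc 0 τ) (hz : z ∈ I) :
    HasDerivWithinAt (fun s => g (s, x₁, x₂, z)) (fderivWithin ℝ g (Dom τ I) (t, x₁, x₂, z) (dir 0))
      (Icc 0 τ) t := by
  have h1 := (hg (t, x₁, x₂, z) ⟨ht, trivial, trivial, hz⟩).hasFDerivWithinAt
  have h2 : HasDerivWithinAt (fun s : ℝ => (s, x₁, x₂, z)) (dir 0) (Icc 0 τ) t :=
    (hasDerivWithinAt_id t _).prodMk (hasDerivWithinAt_const _ _ _)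
  exact h1.comp_hasDerivWithinAt t h2 (show MapsTo _ _ (Dom τ I) from fun s hs => ⟨hs, trivial, trivial, hz⟩)

lemma hasDerivAt_d1 (hg : DifferentiableOn ℝ g (Dom τ I)) (ht : t ∈ Icc 0 τ) (hz : z ∈ I) :
    HasDerivAt (fun s => g (t, s, x₂, z)) (fderivWithin ℝ g (Dom τ I) (t, x₁, x₂, z) (dir 1)) x₁ := by
  rw [← hasDerivWithinAt_univ]
  have h1 := (hg (t, x₁, x₂, z) ⟨ht, trivial, trivial, hz⟩).hasFDerivWithinAt
  have h2 : HasDerivWithinAt (fun s : ℝ => (t, s, x₂, z)) (dir 1) univ x₁ :=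
    (hasDerivWithinAt_const _ _ _).prodMk
      ((hasDerivWithinAt_id _ _).prodMk (hasDerivWithinAt_const _ _ _))
  exact h1.comp_hasDerivWithinAt x₁ h2 (show MapsTo _ _ (Dom τ I) from fun s _ => ⟨ht, trivial, trivial, hz⟩)

lemma hasDerivAt_d2 (hg : DifferentiableOn ℝ g (Dom τ I)) (ht : t ∈ Icc 0 τ) (hz : z ∈ I) :
    HasDerivAt (fun s => g (t, x₁, s, z)) (fderivWithin ℝ g (Dom τ I) (t, x₁, x₂, z) (dir 2)) x₂ := by
  rw [← hasDerivWithinAt_univ]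
  have h1 := (hg (t, x₁, x₂, z) ⟨ht, trivial, trivial, hz⟩).hasFDerivWithinAt
  have h2 : HasDerivWithinAt (fun s : ℝ => (t, x₁, s, z)) (dir 2) univ x₂ :=
    (hasDerivWithinAt_const _ _ _).prodMk ((hasDerivWithinAt_const _ _ _).prodMk
      ((hasDerivWithinAt_id _ _).prodMk (hasDerivWithinAt_const _ _ _)))
  exact h1.comp_hasDerivWithinAt x₂ h2 (show MapsTo _ _ (Dom τ I) from fun s _ => ⟨ht, trivial, trivial, hz⟩)

lemma hasDerivWithinAt_d3 (hg : DifferentiableOn ℝ g (Dom τ I)) (ht : t ∈ Icc 0 τ) (hz : z ∈ I) :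
    HasDerivWithinAt (fun s => g (t, x₁, x₂, s)) (fderivWithin ℝ g (Dom τ I) (t, x₁, x₂, z) (dir 3))
      I z := by
  have h1 := (hg (t, x₁, x₂, z) ⟨ht, trivial, trivial, hz⟩).hasFDerivWithinAt
  have h2 : HasDerivWithinAt (fun s : ℝ => (t, x₁, x₂, s)) (dir 3) I z :=
    (hasDerivWithinAt_const _ _ _).prodMk ((hasDerivWithinAt_const _ _ _).prodMk
      ((hasDerivWithinAt_const _ _ _).prodMk (hasDerivWithinAt_id _ _)))
  exact h1.comp_hasDerivWithinAt z h2 (show MapsTo _ _ (Dom τ I) from fun s hs => ⟨ht, trivial, trivial, hs⟩)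

/-- Partial derivatives of `ℓ ∘ g`. -/
lemma Dd_eq (hτ : 0 < τ) (hI : UniqueDiffOn ℝ I) (hg : DifferentiableOn ℝ g (Dom τ I))
    (ℓ : E →L[ℝ] ℝ) {q : Field} (hq : ∀ p ∈ Dom τ I, q.unc p = ℓ (g p)) (d : Fin 4)
    {p : ℝ × ℝ × ℝ × ℝ} (hp : p ∈ Dom τ I) :
    (Dd τ I d q).unc p = ℓ (fderivWithin ℝ g (Dom τ I) p (dir d)) := by
  obtain ⟨t, x₁, x₂, z⟩ := p
  obtain ⟨ht, -, -, hz⟩ := hp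
  fin_cases d
  · have h := (ℓ.hasFDerivAt.comp_hasDerivWithinAt t (hasDerivWithinAt_dt (x₁ := x₁) (x₂ := x₂) hg ht hz))
    refine (derivWithin_congr (fun s hs => hq (s, x₁, x₂, z) ⟨hs, trivial, trivial, hz⟩)
      (hq (t, x₁, x₂, z) ⟨ht, trivial, trivial, hz⟩)).trans
      (h.derivWithin (uniqueDiffOn_Icc hτ t ht))
  · have h := (ℓ.hasFDerivAt.comp_hasDerivAt x₁ (hasDerivAt_d1 (x₁ := x₁) (x₂ := x₂) hg ht hz))
    have e : (fun s => q t s x₂ z) = fun s => ℓ (g (t, s, x₂, z)) :=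
      funext fun s => hq (t, s, x₂, z) ⟨ht, trivial, trivial, hz⟩
    change deriv (fun s => q t s x₂ z) x₁ = _
    rw [e]; exact h.deriv
  · have h := (ℓ.hasFDerivAt.comp_hasDerivAt x₂ (hasDerivAt_d2 (x₁ := x₁) (x₂ := x₂) hg ht hz))
    have e : (fun s => q t x₁ s z) = fun s => ℓ (g (t, x₁, s, z)) :=
      funext fun s => hq (t, x₁, s, z) ⟨ht, trivial, trivial, hz⟩
    change deriv (fun s => q t x₁ s z) x₂ = _
    rw [e]; exact h.deriv
  · have h := (ℓ.hasFDerivAt.comp_hasDerivWithinAt z (hasDerivWithinAt_d3 (x₁ := x₁) (x₂ := x₂) hg ht hz))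
    refine (derivWithin_congr (fun s hs => hq (t, x₁, x₂, s) ⟨ht, trivial, trivial, hs⟩)
      (hq (t, x₁, x₂, z) ⟨ht, trivial, trivial, hz⟩)).trans
      (h.derivWithin (hI z hz))

end Partials

section C1

variable {τ : ℝ} {I : Set ℝ} {q : Field}

lemma C1Field.continuousOn (h : C1Field τ I q) : ContinuousOn q.unc (Dom τ I) :=
  ContDiffOn.continuousOn h

lemma C1Field.differentiableOn (h : C1Field τ I q) : DifferentiableOn ℝ q.unc (Dom τ I) :=
  ContDiffOn.differentiableOn h one_ne_zero

lemma C1Field.Dd_eq (hτ : 0 < τ) (hI : UniqueDiffOn ℝ I) (h : C1Field τ I q) (d : Fin 4)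
    {p : ℝ × ℝ × ℝ × ℝ} (hp : p ∈ Dom τ I) :
    (Dd τ I d q).unc p = fderivWithin ℝ q.unc (Dom τ I) p (dir d) :=
  EulerLimit.Dd_eq hτ hI h.differentiableOn (ContinuousLinearMap.id ℝ ℝ) (fun _ _ => rfl) d hp

lemma C1Field.continuousOn_Dd (hτ : 0 < τ) (hI : UniqueDiffOn ℝ I) (h : C1Field τ I q)
    (d : Fin 4) : ContinuousOn (Dd τ I d q).unc (Dom τ I) := by
  have h1 := ContDiffOn.continuousOn_fderivWithin h (uniqueDiffOn_dom hτ hI) le_rfl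
  exact (h1.clm_apply continuousOn_const).congr fun p hp => h.Dd_eq hτ hI d hp

end C1

/-- The moment as a continuous linear functional of the weighted profile. -/
def momCLM (ψ : Vel → ℝ) (hψ : PolyB ψ) : (Vel →ᵇ ℝ) →L[ℝ] ℝ :=
  LinearMap.mkContinuous
    { toFun := fun g => mom ψ fun v => ((1 + ‖v‖) ^ 3)⁻¹ * g v
      map_add' := fun g h => by
        have hw : ∀ g : Vel →ᵇ ℝ, PolyB fun v => ((1 + ‖v‖) ^ 3)⁻¹ * g v := fun g =>
          (Wtd.of_bound (by fun_prop) (C := ‖g‖) fun v => by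
            rw [abs_mul, abs_of_pos (by positivity), mul_comm]
            gcongr; exact g.norm_coe_le_norm v).polyB
        rw [← mom_add hψ (hw g) (hw h)]
        congr 1; funext v; simp [mul_add]
      map_smul' := fun c g => by
        simp only [RingHom.id_apply, smul_eq_mul]
        rw [← mom_const_mul]
        congr 1; funext v; simp; ring }
    (∫ v, |ψ v| * sqrtM v) fun g => by
      change |mom ψ fun v => ((1 + ‖v‖) ^ 3)⁻¹ * g v| ≤ _
      have hi : Integrable fun v => |ψ v| * sqrtM v := by
        refine (hψ.integrable_mul (polyB_const 1)).abs.congr (.of_forall fun v => ?_)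
        simp only [mul_one, abs_mul, abs_of_pos (sqrtM_pos v)]
      rw [mul_comm, ← integral_const_mul, mom, ← Real.norm_eq_abs]
      refine norm_integral_le_of_norm_le (hi.const_mul _) (.of_forall fun v => ?_)
      have h1 := inv_pow_le_one v 3
      have h2 : |g v| ≤ ‖g‖ := g.norm_coe_le_norm v
      have h3 := sqrtM_pos v
      rw [Real.norm_eq_abs, abs_mul, abs_mul, abs_mul, abs_of_pos h3,
        abs_of_pos (show 0 < ((1 + ‖v‖) ^ 3)⁻¹ by positivity)]
      calc |ψ v| * (sqrtM v * (((1 + ‖v‖) ^ 3)⁻¹ * |g v|))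
          ≤ |ψ v| * (sqrtM v * (1 * ‖g‖)) := by gcongr
        _ = ‖g‖ * (|ψ v| * sqrtM v) := by ring

lemma momCLM_apply (ψ : Vel → ℝ) (hψ : PolyB ψ) (g : Vel →ᵇ ℝ) :
    momCLM ψ hψ g = mom ψ fun v => ((1 + ‖v‖) ^ 3)⁻¹ * g v := rfl

/-- Moments of a profile. -/
def momF (ψ : Vel → ℝ) (h : Profile) : Field := fun t x₁ x₂ z => mom ψ (h t x₁ x₂ z)

lemma wtd_bcf (g : Vel →ᵇ ℝ) : Wtd fun v => ((1 + ‖v‖) ^ 3)⁻¹ * g v :=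
  Wtd.of_bound (by fun_prop) (C := ‖g‖) fun v => by
    rw [abs_mul, abs_of_pos (by positivity), mul_comm]
    gcongr; exact g.norm_coe_le_norm v

lemma continuous_bcf (g : Vel →ᵇ ℝ) : Continuous fun v => ((1 + ‖v‖) ^ 3)⁻¹ * g v :=
  (Continuous.inv₀ (by fun_prop) fun v => by positivity).mul g.continuous

section Smooth

variable {τ : ℝ} {I : Set ℝ} {h : Profile} {r : ℕ}

lemma SmoothOn.wtd (hs : SmoothOn r (Dom τ I) h) {t x₁ x₂ z : ℝ} (ht : t ∈ Icc 0 τ) (hz : z ∈ I) :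
    Wtd (h t x₁ x₂ z) ∧ Continuous (h t x₁ x₂ z) := by
  obtain ⟨g, -, hgh⟩ := hs
  have e : h t x₁ x₂ z = fun v => ((1 + ‖v‖) ^ 3)⁻¹ * g (t, x₁, x₂, z) v :=
    funext (hgh (t, x₁, x₂, z) ⟨ht, trivial, trivial, hz⟩)
  rw [e]
  exact ⟨wtd_bcf _, continuous_bcf _⟩

lemma SmoothOn.c1Field (hs : SmoothOn (r + 1) (Dom τ I) h) {ψ : Vel → ℝ} (hψ : PolyB ψ) :
    C1Field τ I (momF ψ h) := by
  obtain ⟨g, hg, hgh⟩ := hs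
  have h1 : ContDiffOn ℝ 1 g (Dom τ I) := hg.of_le (by norm_cast; omega)
  refine ((momCLM ψ hψ).contDiff.comp_contDiffOn h1).congr fun p hp => ?_
  change mom ψ (h p.1 p.2.1 p.2.2.1 p.2.2.2) = _
  rw [Function.comp_apply, momCLM_apply]
  congr 1
  exact funext (hgh p hp)

/-- Evaluation at v and the moment against ψ are both continuous linear functionals of one map with
values in bounded continuous functions. Each commutes with its derivative, so moments may be
differentiated under the integral in v. -/
lemma SmoothOn.Dd_slice (hτ : 0 < τ) (hI : UniqueDiffOn ℝ I) (hs : SmoothOn (r + 1) (Dom τ I) h)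
    (d : Fin 4) {t x₁ x₂ z : ℝ} (ht : t ∈ Icc 0 τ) (hz : z ∈ I) :
    Wtd (fun v => Dd τ I d (slice h v) t x₁ x₂ z) ∧
    Continuous (fun v => Dd τ I d (slice h v) t x₁ x₂ z) ∧
    ∀ ψ, PolyB ψ → Dd τ I d (momF ψ h) t x₁ x₂ z = mom ψ fun v => Dd τ I d (slice h v) t x₁ x₂ z := by
  obtain ⟨g, hg, hgh⟩ := hs
  have h1 : DifferentiableOn ℝ g (Dom τ I) := hg.differentiableOn (by norm_cast)
  have hp : (t, x₁, x₂, z) ∈ Dom τ I := ⟨ht, trivial, trivial, hz⟩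
  have e : (fun v => Dd τ I d (slice h v) t x₁ x₂ z) = fun v => ((1 + ‖v‖) ^ 3)⁻¹ *
      (fderivWithin ℝ g (Dom τ I) (t, x₁, x₂, z) (dir d)) v := by
    funext v
    exact Dd_eq (q := slice h v) hτ hI h1 (((1 + ‖v‖) ^ 3)⁻¹ • BoundedContinuousFunction.evalCLM ℝ v)
      (fun p hp => (hgh p hp v).trans (by simp)) d hp
  rw [e]
  refine ⟨wtd_bcf _, continuous_bcf _, fun ψ hψ => ?_⟩
  exact Dd_eq hτ hI h1 (momCLM ψ hψ) (fun p hp => by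
    rw [momCLM_apply]
    change mom ψ (h p.1 p.2.1 p.2.2.1 p.2.2.2) = _
    congr 1
    exact funext (hgh p hp)) d hp

lemma SmoothOn.wtd_Dnl (hI : UniqueDiffOn ℝ I) (hs : SmoothOn r (Dom τ I) h) {l : ℕ}
    (hl : l ≤ r) {t x₁ x₂ z : ℝ} (ht : t ∈ Icc 0 τ) (hz : z ∈ I) : Wtd (Dnl I l h t x₁ x₂ z) := by
  obtain ⟨g, hg, hgh⟩ := hs
  have h1 : ContDiffOn ℝ l (fun s => g (t, x₁, x₂, s)) I := by
    refine (hg.of_le (by exact_mod_cast hl)).comp (t := Dom τ I) (f := fun s : ℝ => (t, x₁, x₂, s))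
      (by fun_prop) fun s hs => ⟨ht, trivial, trivial, hs⟩
  have e : Dnl I l h t x₁ x₂ z = fun v => ((1 + ‖v‖) ^ 3)⁻¹ *
      (iteratedDerivWithin l (fun s => g (t, x₁, x₂, s)) I z) v := by
    funext v
    unfold Dnl
    let ℓ : (Vel →ᵇ ℝ) →L[ℝ] ℝ := ((1 + ‖v‖) ^ 3)⁻¹ • BoundedContinuousFunction.evalCLM ℝ v
    rw [iteratedDerivWithin_congr (g := ℓ ∘ fun s => g (t, x₁, x₂, s))
      (fun s hs => hgh (t, x₁, x₂, s) ⟨ht, trivial, trivial, hs⟩ v) hz]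
    rw [iteratedDerivWithin_eq_iteratedFDerivWithin,
      ℓ.iteratedFDerivWithin_comp_left (h1 z hz) hI hz le_rfl,
      iteratedDerivWithin_eq_iteratedFDerivWithin]
    rfl
  rw [e]
  exact wtd_bcf _

end Smooth

end

section

/-! ### Balance laws -/

lemma uniqueDiffOn_unit : UniqueDiffOn ℝ (Icc (0 : ℝ) 1) := uniqueDiffOn_Icc zero_lt_one

lemma uniqueDiffOn_half : UniqueDiffOn ℝ (Ici (0 : ℝ)) := uniqueDiffOn_Ici 0

lemma Dt_slice_zero (τ : ℝ) (v : Vel) (t x₁ x₂ z : ℝ) : Dt τ (slice 0 v) t x₁ x₂ z = 0 := by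
  simp [Dt, slice]

lemma tangTransport_zero (t x₁ x₂ z : ℝ) (v : Vel) : tangTransport 0 t x₁ x₂ z v = 0 := by
  simp [tangTransport, D1, D2, slice]

lemma transport_zero (t x₁ x₂ z : ℝ) (v : Vel) : transport 0 t x₁ x₂ z v = 0 := by
  simp [transport, tangTransport_zero, D3, slice]

lemma momF_zero (ψ : Vel → ℝ) : momF ψ 0 = 0 := by
  funext t x₁ x₂ z; simp [momF, mom]

lemma Side.pos_mem (s : Side) : s.pos ∈ Icc (0 : ℝ) 1 := by
  cases s <;> simp [Side.pos]

lemma Side.sgn_mul_self (s : Side) : s.sgn * s.sgn = 1 := by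
  cases s <;> norm_num [Side.sgn]

section Smooth

variable {τ : ℝ} {I : Set ℝ} {h : Profile} {r : ℕ}

lemma SmoothOn.mom_tangTransport (hτ : 0 < τ) (hI : UniqueDiffOn ℝ I)
    (hs : SmoothOn (r + 1) (Dom τ I) h) {φ : Vel → ℝ} (hφ : PolyB φ) {t x₁ x₂ z : ℝ}
    (ht : t ∈ Icc 0 τ) (hz : z ∈ I) :
    PolyB (tangTransport h t x₁ x₂ z) ∧ mom φ (tangTransport h t x₁ x₂ z)
      = D1 (momF (fun v => φ v * v 0) h) t x₁ x₂ z + D2 (momF (fun v => φ v * v 1) h) t x₁ x₂ z := by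
  obtain ⟨w1, -, m1⟩ := hs.Dd_slice hτ hI 1 (x₁ := x₁) (x₂ := x₂) ht hz
  obtain ⟨w2, -, m2⟩ := hs.Dd_slice hτ hI 2 (x₁ := x₁) (x₂ := x₂) ht hz
  have p1 := (polyB_coord 0).mul w1.polyB
  have p2 := (polyB_coord 1).mul w2.polyB
  refine ⟨p1.add p2, (mom_add hφ p1 p2).trans ?_⟩
  rw [← mom_left_mul, ← mom_left_mul]
  exact congrArg₂ _ (m1 _ (hφ.mul (polyB_coord 0))).symm (m2 _ (hφ.mul (polyB_coord 1))).symm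

lemma SmoothOn.mom_normal (hτ : 0 < τ) (hI : UniqueDiffOn ℝ I)
    (hs : SmoothOn (r + 1) (Dom τ I) h) {φ : Vel → ℝ} (hφ : PolyB φ) {t x₁ x₂ z : ℝ}
    (ht : t ∈ Icc 0 τ) (hz : z ∈ I) :
    PolyB (fun v => v 2 * D3 I (slice h v) t x₁ x₂ z) ∧
      mom φ (fun v => v 2 * D3 I (slice h v) t x₁ x₂ z)
        = D3 I (momF (fun v => φ v * v 2) h) t x₁ x₂ z := by
  obtain ⟨w, -, m⟩ := hs.Dd_slice hτ hI 3 (x₁ := x₁) (x₂ := x₂) ht hz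
  refine ⟨(polyB_coord 2).mul w.polyB, ?_⟩
  rw [← mom_left_mul]
  exact (m _ (hφ.mul (polyB_coord 2))).symm

lemma SmoothOn.mom_time (hτ : 0 < τ) (hI : UniqueDiffOn ℝ I)
    (hs : SmoothOn (r + 1) (Dom τ I) h) {φ : Vel → ℝ} (hφ : PolyB φ) {t x₁ x₂ z : ℝ}
    (ht : t ∈ Icc 0 τ) (hz : z ∈ I) :
    PolyB (fun v => Dt τ (slice h v) t x₁ x₂ z) ∧
      mom φ (fun v => Dt τ (slice h v) t x₁ x₂ z) = Dt τ (momF φ h) t x₁ x₂ z := by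
  obtain ⟨w, -, m⟩ := hs.Dd_slice hτ hI 0 (x₁ := x₁) (x₂ := x₂) ht hz
  exact ⟨w.polyB, (m _ hφ).symm⟩

end Smooth

/-! ### Conservation laws in the interior and the low-order pressures -/

section Interior

variable {n 𝔟 : ℕ} {τ : ℝ} {f : ℤ → Profile} {t x₁ x₂ z : ℝ}

lemma IsInterior.wtd (hf : IsInterior n 𝔟 τ f) (k : ℤ) (ht : t ∈ Icc 0 τ) (hz : z ∈ Icc (0 : ℝ) 1) :
    Wtd (f k t x₁ x₂ z) := ((hf.smooth k).wtd ht hz).1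

lemma IsInterior.continuous (hf : IsInterior n 𝔟 τ f) (k : ℤ) (ht : t ∈ Icc 0 τ)
    (hz : z ∈ Icc (0 : ℝ) 1) : Continuous (f k t x₁ x₂ z) := ((hf.smooth k).wtd ht hz).2

lemma IsInterior.c1 (hf : IsInterior n 𝔟 τ f) (k : ℤ) {ψ : Vel → ℝ} (hψ : PolyB ψ) :
    C1Field τ (Icc 0 1) (momF ψ (f k)) := (hf.smooth k).c1Field hψ

/-- The local conservation laws in the interior. -/
lemma IsInterior.balance (hτ : 0 < τ) (hf : IsInterior n 𝔟 τ f) {φ : Vel → ℝ} (hφ : PolyB φ)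
    (iφ : CollInv φ) (k : ℤ) (ht : t ∈ Icc 0 τ) (hz : z ∈ Icc (0 : ℝ) 1) :
    Dt τ (momF φ (f (k + 2 - n))) t x₁ x₂ z + D1 (momF (fun v => φ v * v 0) (f k)) t x₁ x₂ z
      + D2 (momF (fun v => φ v * v 1) (f k)) t x₁ x₂ z
      + D3 (Icc 0 1) (momF (fun v => φ v * v 2) (f k)) t x₁ x₂ z = 0 := by
  obtain ⟨p0, m0⟩ := (hf.smooth (k + 2 - n)).mom_time hτ uniqueDiffOn_unit hφ (x₁ := x₁) (x₂ := x₂) ht hz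
  obtain ⟨p1, m1⟩ := (hf.smooth k).mom_tangTransport hτ uniqueDiffOn_unit hφ (x₁ := x₁) (x₂ := x₂) ht hz
  obtain ⟨p3, m3⟩ := (hf.smooth k).mom_normal hτ uniqueDiffOn_unit hφ (x₁ := x₁) (x₂ := x₂) ht hz
  have hN : Null fun v => Dt τ (slice (f (k + 2 - n)) v) t x₁ x₂ z
      + (tangTransport (f k) t x₁ x₂ z v + v 2 * D3 (Icc 0 1) (slice (f k) v) t x₁ x₂ z) := by
    have e : (fun v => Dt τ (slice (f (k + 2 - n)) v) t x₁ x₂ z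
      + (tangTransport (f k) t x₁ x₂ z v + v 2 * D3 (Icc 0 1) (slice (f k) v) t x₁ x₂ z)) =
      fun v => -1 * linL (f (k + n) t x₁ x₂ z) v + ∑ i ∈ Finset.Icc 0 (k + 2),
        (1 / 2) * GamS (f i t x₁ x₂ z) (f (k + 2 - i) t x₁ x₂ z) v :=
      funext fun v => (hf.eqn k t ht x₁ x₂ z hz v).trans (by ring)
    rw [e]
    exact ((null_linL (hf.wtd _ ht hz).bddM).const_mul _).add (Null.sum _ fun i _ =>
      (null_GamS (hf.wtd _ ht hz).bddM (hf.wtd _ ht hz).bddM).const_mul _)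
  have := hN.2 φ hφ iφ
  rw [mom_add hφ p0 (p1.add p3), mom_add hφ p1 p3, m0, m1, m3] at this
  linarith

/-- The collision term of order `k` in terms of the lower orders. -/
lemma IsInterior.linL_eq (hf : IsInterior n 𝔟 τ f) (k : ℤ) (ht : t ∈ Icc 0 τ)
    (hz : z ∈ Icc (0 : ℝ) 1) (v : Vel) :
    linL (f k t x₁ x₂ z) v = -Dt τ (slice (f (k - n + 2 - n)) v) t x₁ x₂ z
      - transport (f (k - n)) t x₁ x₂ z v + ∑ i ∈ Finset.Icc 0 (k - n + 2),
        (1 / 2) * GamS (f i t x₁ x₂ z) (f (k - n + 2 - i) t x₁ x₂ z) v := by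
  have := hf.eqn (k - n) t ht x₁ x₂ z hz v
  rw [sub_add_cancel] at this
  linarith

/-- For k ≤ n-3 both k-n and k+2-2n are negative and the sum runs up to k-n+2 ≤ -1, so L f_k = 0. -/
lemma IsInterior.eq_macroP (hf : IsInterior n 𝔟 τ f) {k : ℤ} (hk : k ≤ n - 3) (ht : t ∈ Icc 0 τ)
    (hz : z ∈ Icc (0 : ℝ) 1) : f k t x₁ x₂ z = macroP (f k t x₁ x₂ z) := by
  refine eq_macroP_of_linL_eq_zero (hf.continuous k ht hz) (hf.wtd k ht hz) fun v => ?_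
  rw [hf.linL_eq k ht hz, hf.neg (k - n + 2 - n) (by omega), hf.neg (k - n) (by omega),
    Dt_slice_zero, transport_zero, Finset.Icc_eq_empty (by omega)]
  simp

lemma stress_of_eq_macroP {g : Vel → ℝ} (h : g = macroP g) (i j : Fin 3) :
    mom (fun v => v i * v j) g = if i = j then rho g + theta g else 0 := by
  have := stress_hydro (rho g) (fun i => vel i g) (theta g) i j
  conv_lhs => rw [h]
  exact this

lemma rhoF_eq (h : Profile) : rhoF h = momF (fun _ => 1) h := by
  funext t x₁ x₂ z; exact rho_eq_mom _

lemma velF_eq (i : Fin 3) (h : Profile) : velF i h = momF (fun v => v i) h := rfl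

lemma thetaF_eq (h : Profile) : thetaF h = momF (fun v => 1 / 3 * (‖v‖ ^ 2 - 3)) h := by
  funext t x₁ x₂ z
  exact (mom_left_const_mul _ _ _).symm

/-- In this form ρ+θ is the moment of a single collision invariant, so it has a conservation law of
its own. -/
lemma IsInterior.rhoTheta_eq (hf : IsInterior n 𝔟 τ f) (k : ℤ) (ht : t ∈ Icc 0 τ)
    (hz : z ∈ Icc (0 : ℝ) 1) :
    rhoTheta f k t x₁ x₂ z = momF (fun v => 1 / 3 * ‖v‖ ^ 2) (f k) t x₁ x₂ z := by
  unfold momF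
  rw [mom_left_const_mul, mom_norm_sq (hf.wtd k ht hz).polyB]
  simp only [rhoTheta, rhoF, thetaF]
  ring

/-- The stress of the low orders is isotropic. -/
lemma IsInterior.momF_stress (hf : IsInterior n 𝔟 τ f) {k : ℤ} (hk : k ≤ n - 3) (ht : t ∈ Icc 0 τ)
    (hz : z ∈ Icc (0 : ℝ) 1) (i j : Fin 3) :
    momF (fun v => v i * v j) (f k) t x₁ x₂ z = if i = j then rhoTheta f k t x₁ x₂ z else 0 :=
  stress_of_eq_macroP (hf.eq_macroP hk ht hz) i j

lemma Dd_congr {I : Set ℝ} {q q' : Field} (h : ∀ p ∈ Dom τ I, q.unc p = q'.unc p) (d : Fin 4)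
    (ht : t ∈ Icc 0 τ) (hz : z ∈ I) : Dd τ I d q t x₁ x₂ z = Dd τ I d q' t x₁ x₂ z := by
  fin_cases d
  · exact derivWithin_congr (fun s hs => h (s, x₁, x₂, z) ⟨hs, trivial, trivial, hz⟩)
      (h (t, x₁, x₂, z) ⟨ht, trivial, trivial, hz⟩)
  · exact congrArg (fun F => deriv F x₁)
      (funext fun s => h (t, s, x₂, z) ⟨ht, trivial, trivial, hz⟩)
  · exact congrArg (fun F => deriv F x₂)
      (funext fun s => h (t, x₁, s, z) ⟨ht, trivial, trivial, hz⟩)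
  · exact derivWithin_congr (fun s hs => h (t, x₁, x₂, s) ⟨ht, trivial, trivial, hs⟩)
      (h (t, x₁, x₂, z) ⟨ht, trivial, trivial, hz⟩)

lemma Dd_zero_field (τ : ℝ) (I : Set ℝ) (d : Fin 4) (t x₁ x₂ z : ℝ) :
    Dd τ I d 0 t x₁ x₂ z = 0 := by
  fin_cases d
  · exact congrFun (derivWithin_fun_const _ _) _
  · exact deriv_const _ _
  · exact deriv_const _ _
  · exact congrFun (derivWithin_fun_const _ _) _

lemma C1Field.congr {I : Set ℝ} {q q' : Field} (h : C1Field τ I q)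
    (e : ∀ p ∈ Dom τ I, q'.unc p = q.unc p) : C1Field τ I q' := ContDiffOn.congr h e

lemma IsInterior.c1_rhoTheta (hf : IsInterior n 𝔟 τ f) (k : ℤ) :
    C1Field τ (Icc 0 1) (rhoTheta f k) :=
  (hf.c1 k (polyB_norm_sq.const_mul (1 / 3))).congr fun _ hp =>
    hf.rhoTheta_eq k hp.1 hp.2.2.2

/-- The gradient of the low-order pressures vanishes. -/
lemma IsInterior.grad_rhoTheta (hτ : 0 < τ) (hf : IsInterior n 𝔟 τ f) {k : ℤ} (hk : k ≤ n - 3)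
    (ht : t ∈ Icc 0 τ) (hz : z ∈ Icc (0 : ℝ) 1) :
    D1 (rhoTheta f k) t x₁ x₂ z = 0 ∧ D2 (rhoTheta f k) t x₁ x₂ z = 0 ∧
      D3 (Icc 0 1) (rhoTheta f k) t x₁ x₂ z = 0 := by
  have hb := fun i : Fin 3 => hf.balance hτ (polyB_coord i) (collInv_coord i) k (x₁ := x₁) (x₂ := x₂) ht hz
  have hD : ∀ (i j : Fin 3) (d : Fin 4), Dd τ (Icc 0 1) d (momF (fun v => v i * v j) (f k)) t x₁ x₂ z
      = if i = j then Dd τ (Icc 0 1) d (rhoTheta f k) t x₁ x₂ z else 0 := by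
    intro i j d
    rw [Dd_congr (q' := if i = j then rhoTheta f k else 0) (fun _ hp => by
      refine (hf.momF_stress hk hp.1 hp.2.2.2 i j).trans ?_
      split_ifs <;> rfl) d ht hz]
    split_ifs
    · rfl
    · exact Dd_zero_field _ _ _ _ _ _ _
  -- The momentum law loses its time derivative because k+2-n < 0.
  have ht0 : ∀ ψ, Dt τ (momF ψ (f (k + 2 - n))) t x₁ x₂ z = 0 := fun ψ => by
    rw [hf.neg _ (by omega), momF_zero]
    exact Dd_zero_field τ (Icc 0 1) 0 _ _ _ _
  have e : ∀ i : Fin 3, (if i = 0 then D1 (rhoTheta f k) t x₁ x₂ z else 0)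
      + (if i = 1 then D2 (rhoTheta f k) t x₁ x₂ z else 0)
      + (if i = 2 then D3 (Icc 0 1) (rhoTheta f k) t x₁ x₂ z else 0) = 0 := by
    intro i
    have h := hb i
    rw [ht0, zero_add] at h
    exact (congrArg₂ (· + ·) (congrArg₂ (· + ·) (hD i 0 1) (hD i 1 2)) (hD i 2 3)).symm.trans h
  exact ⟨by simpa using e 0, by simpa using e 1, by simpa using e 2⟩

/-- A `C¹` field on the channel with vanishing spatial gradient does not depend on `x`. -/
lemma eq_of_grad_eq_zero {q : ℝ → ℝ → ℝ → ℝ}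
    (h1 : ∀ x₁ x₂, ∀ z ∈ Icc (0 : ℝ) 1, HasDerivAt (fun s => q s x₂ z) 0 x₁)
    (h2 : ∀ x₁ x₂, ∀ z ∈ Icc (0 : ℝ) 1, HasDerivAt (fun s => q x₁ s z) 0 x₂)
    (h3 : ∀ x₁ x₂, ∀ z ∈ Icc (0 : ℝ) 1, HasDerivWithinAt (fun s => q x₁ x₂ s) 0 (Icc 0 1) z)
    (x₁ x₂ y₁ y₂ : ℝ) {z w : ℝ} (hz : z ∈ Icc (0 : ℝ) 1) (hw : w ∈ Icc (0 : ℝ) 1) :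
    q x₁ x₂ z = q y₁ y₂ w := by
  have e1 : q x₁ x₂ z = q y₁ x₂ z :=
    is_const_of_deriv_eq_zero (fun s => (h1 s x₂ z hz).differentiableAt)
      (fun s => (h1 s x₂ z hz).deriv) x₁ y₁
  have e2 : q y₁ x₂ z = q y₁ y₂ z :=
    is_const_of_deriv_eq_zero (fun s => (h2 y₁ s z hz).differentiableAt)
      (fun s => (h2 y₁ s z hz).deriv) x₂ y₂
  have e3 : q y₁ y₂ z = q y₁ y₂ w := by
    have h := (convex_Icc (0 : ℝ) 1).is_const_of_fderivWithin_eq_zero (𝕜 := ℝ)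
      (f := fun s => q y₁ y₂ s) (x := z) (y := w) (fun s hs => (h3 y₁ y₂ s hs).differentiableWithinAt) (fun s hs => by
        have := (h3 y₁ y₂ s hs).hasFDerivWithinAt.fderivWithin (uniqueDiffOn_unit s hs)
        rw [this]; ext; simp)
    exact h hz hw
  rw [e1, e2, e3]

section HasDeriv

variable {I : Set ℝ} {q : Field}

lemma C1Field.hasDerivWithinAt_Dt (hτ : 0 < τ) (hI : UniqueDiffOn ℝ I) (h : C1Field τ I q)
    (ht : t ∈ Icc 0 τ) (hz : z ∈ I) :
    HasDerivWithinAt (fun s => q s x₁ x₂ z) (Dt τ q t x₁ x₂ z) (Icc 0 τ) t := by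
  have := hasDerivWithinAt_dt (x₁ := x₁) (x₂ := x₂) h.differentiableOn ht hz
  rwa [← h.Dd_eq hτ hI 0 ⟨ht, trivial, trivial, hz⟩] at this

lemma C1Field.hasDerivAt_D1 (hτ : 0 < τ) (hI : UniqueDiffOn ℝ I) (h : C1Field τ I q)
    (ht : t ∈ Icc 0 τ) (hz : z ∈ I) : HasDerivAt (fun s => q t s x₂ z) (D1 q t x₁ x₂ z) x₁ := by
  have := hasDerivAt_d1 (x₁ := x₁) (x₂ := x₂) h.differentiableOn ht hz
  rwa [← h.Dd_eq hτ hI 1 ⟨ht, trivial, trivial, hz⟩] at this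

lemma C1Field.hasDerivAt_D2 (hτ : 0 < τ) (hI : UniqueDiffOn ℝ I) (h : C1Field τ I q)
    (ht : t ∈ Icc 0 τ) (hz : z ∈ I) : HasDerivAt (fun s => q t x₁ s z) (D2 q t x₁ x₂ z) x₂ := by
  have := hasDerivAt_d2 (x₁ := x₁) (x₂ := x₂) h.differentiableOn ht hz
  rwa [← h.Dd_eq hτ hI 2 ⟨ht, trivial, trivial, hz⟩] at this

lemma C1Field.hasDerivWithinAt_D3 (hτ : 0 < τ) (hI : UniqueDiffOn ℝ I) (h : C1Field τ I q)
    (ht : t ∈ Icc 0 τ) (hz : z ∈ I) :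
    HasDerivWithinAt (fun s => q t x₁ x₂ s) (D3 I q t x₁ x₂ z) I z := by
  have := hasDerivWithinAt_d3 (x₁ := x₁) (x₂ := x₂) h.differentiableOn ht hz
  rwa [← h.Dd_eq hτ hI 3 ⟨ht, trivial, trivial, hz⟩] at this

end HasDeriv

lemma IsInterior.rhoTheta_const (hτ : 0 < τ) (hf : IsInterior n 𝔟 τ f) {k : ℤ} (hk : k ≤ n - 3)
    (ht : t ∈ Icc 0 τ) (x₁ x₂ y₁ y₂ : ℝ) {z w : ℝ} (hz : z ∈ Icc (0 : ℝ) 1)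
    (hw : w ∈ Icc (0 : ℝ) 1) : rhoTheta f k t x₁ x₂ z = rhoTheta f k t y₁ y₂ w := by
  have hc := hf.c1_rhoTheta k
  refine eq_of_grad_eq_zero (q := rhoTheta f k t) (fun a b c h => ?_) (fun a b c h => ?_)
    (fun a b c h => ?_) x₁ x₂ y₁ y₂ hz hw
  · rw [← (hf.grad_rhoTheta hτ hk ht h).1]
    exact hc.hasDerivAt_D1 hτ uniqueDiffOn_unit ht h
  · rw [← (hf.grad_rhoTheta hτ hk ht h).2.1]
    exact hc.hasDerivAt_D2 hτ uniqueDiffOn_unit ht h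
  · have := hc.hasDerivWithinAt_D3 hτ uniqueDiffOn_unit (x₁ := a) (x₂ := b) ht h
    rwa [(hf.grad_rhoTheta hτ hk ht h).2.2] at this

end Interior

/-! ### Conservation laws in the viscous layer -/

section Viscous

variable {n 𝔟 : ℕ} {τ : ℝ} {f : ℤ → Profile} {s : Side} {fb : ℤ → Profile} {t x₁ x₂ y : ℝ}

lemma IsViscous.wtd (hb : IsViscous n 𝔟 τ f s fb) (k : ℤ) (ht : t ∈ Icc 0 τ)
    (hy : y ∈ Ici (0 : ℝ)) : Wtd (fb k t x₁ x₂ y) := ((hb.smooth k).wtd ht hy).1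

lemma IsViscous.c1 (hb : IsViscous n 𝔟 τ f s fb) (k : ℤ) {ψ : Vel → ℝ} (hψ : PolyB ψ) :
    C1Field τ (Ici 0) (momF ψ (fb k)) := (hb.smooth k).c1Field hψ

/-- The local conservation laws in the viscous layer. -/
lemma IsViscous.balance (hτ : 0 < τ) (hf : IsInterior n 𝔟 τ f) (hb : IsViscous n 𝔟 τ f s fb)
    {φ : Vel → ℝ} (hφ : PolyB φ) (iφ : CollInv φ) (k : ℤ) (ht : t ∈ Icc 0 τ)
    (hy : y ∈ Ici (0 : ℝ)) :
    Dt τ (momF φ (fb (k + 2 - n))) t x₁ x₂ y + D1 (momF (fun v => φ v * v 0) (fb k)) t x₁ x₂ y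
      + D2 (momF (fun v => φ v * v 1) (fb k)) t x₁ x₂ y
      - s.sgn * D3 (Ici 0) (momF (fun v => φ v * v 2) (fb (k + 1))) t x₁ x₂ y = 0 := by
  obtain ⟨p0, m0⟩ := (hb.smooth (k + 2 - n)).mom_time hτ uniqueDiffOn_half hφ (x₁ := x₁) (x₂ := x₂) ht hy
  obtain ⟨p1, m1⟩ := (hb.smooth k).mom_tangTransport hτ uniqueDiffOn_half hφ (x₁ := x₁) (x₂ := x₂) ht hy
  obtain ⟨p3, m3⟩ := (hb.smooth (k + 1)).mom_normal hτ uniqueDiffOn_half hφ (x₁ := x₁) (x₂ := x₂) ht hy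
  have p3' := p3.const_mul s.sgn
  have wf := fun i => (hf.wtd i ht s.pos_mem (x₁ := x₁) (x₂ := x₂)).bddM
  have wb := fun i => (hb.wtd i ht hy (x₁ := x₁) (x₂ := x₂)).bddM
  have hN : Null fun v => Dt τ (slice (fb (k + 2 - n)) v) t x₁ x₂ y
      + tangTransport (fb k) t x₁ x₂ y v
      - s.sgn * (v 2 * D3 (Ici 0) (slice (fb (k + 1)) v) t x₁ x₂ y) := by
    have e := funext fun v => hb.eqn k t ht x₁ x₂ y hy v
    rw [e]
    have e2 : (fun v => -linL (fb (k + n) t x₁ x₂ y) v) = fun v => -1 * linL (fb (k + n) t x₁ x₂ y) v := by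
      funext v; ring
    have hl : Null fun v => -linL (fb (k + n) t x₁ x₂ y) v := e2 ▸ (null_linL (wb _)).const_mul _
    refine ((hl.add (Null.sum _ fun i _ => null_GamS (wf _) (wb _))).add
      (Null.sum _ fun l hl => Null.sum _ fun i _ => (null_GamS ?_ (wb _)).const_mul _)).add
      (Null.sum _ fun i _ => (null_GamS (wb _) (wb _)).const_mul _)
    have hl' := (Finset.mem_Icc.1 hl).2
    exact ((hf.smooth i).wtd_Dnl uniqueDiffOn_unit (by omega) ht s.pos_mem).bddM
  have := hN.2 φ hφ iφ
  rw [mom_sub hφ (p0.add p1) p3', mom_add hφ p0 p1, mom_const_mul, m0, m1, m3] at this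
  linarith

end Viscous

end

section

/-! ### Integrals over the torus, the channel and time -/

/-- Lebesgue measure on the unit interval. -/
abbrev nu1 : Measure ℝ := volume.restrict (Ioc 0 1)

/-- Lebesgue measure on the torus. -/
abbrev nu2 : Measure (ℝ × ℝ) := nu1.prod nu1

/-- Lebesgue measure on the channel. -/
abbrev nu3 : Measure (ℝ × ℝ × ℝ) := nu1.prod (nu1.prod nu1)

/-- The closed channel. -/
abbrev Chan : Set (ℝ × ℝ × ℝ) := univ ×ˢ univ ×ˢ Icc 0 1

lemma integral_unit (g : ℝ → ℝ) : ∫ x in (0 : ℝ)..1, g x = ∫ x, g x ∂nu1 :=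
  intervalIntegral.integral_of_le zero_le_one

lemma integrable_nu2 {g : ℝ × ℝ → ℝ} (hg : Continuous g) : Integrable g nu2 := by
  have h : IntegrableOn g (Icc 0 1 ×ˢ Icc 0 1) volume :=
    hg.continuousOn.integrableOn_compact (isCompact_Icc.prod isCompact_Icc)
  have := h.mono_set (prod_mono (Ioc_subset_Icc_self (a := (0 : ℝ)) (b := 1))
    (Ioc_subset_Icc_self (a := (0 : ℝ)) (b := 1)))
  rwa [IntegrableOn, Measure.volume_eq_prod, ← Measure.prod_restrict] at this

lemma integrable_nu3 {g : ℝ × ℝ × ℝ → ℝ} (hg : ContinuousOn g Chan) : Integrable g nu3 := by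
  have h : IntegrableOn g (Icc 0 1 ×ˢ Icc 0 1 ×ˢ Icc 0 1) volume :=
    (hg.mono (prod_mono (subset_univ _) (prod_mono (subset_univ _) le_rfl))).integrableOn_compact
      (isCompact_Icc.prod (isCompact_Icc.prod isCompact_Icc))
  have := h.mono_set (prod_mono (Ioc_subset_Icc_self (a := (0 : ℝ)) (b := 1))
    (prod_mono (Ioc_subset_Icc_self (a := (0 : ℝ)) (b := 1))
      (Ioc_subset_Icc_self (a := (0 : ℝ)) (b := 1))))
  rwa [IntegrableOn, Measure.volume_eq_prod, Measure.volume_eq_prod, ← Measure.prod_restrict,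
    ← Measure.prod_restrict] at this

lemma intT_eq {g : ℝ → ℝ → ℝ} (hg : Integrable (fun x : ℝ × ℝ => g x.1 x.2) nu2) :
    intT g = ∫ x, g x.1 x.2 ∂nu2 := by
  rw [integral_prod _ hg]
  simp only [intT, integral_unit]

lemma intO_eq {g : ℝ → ℝ → ℝ → ℝ} (hg : Integrable (fun x : ℝ × ℝ × ℝ => g x.1 x.2.1 x.2.2) nu3) :
    intO g = ∫ x, g x.1 x.2.1 x.2.2 ∂nu3 := by
  rw [integral_prod _ hg]
  simp only [intO, integral_unit]
  refine integral_congr_ae ?_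
  filter_upwards [hg.prod_right_ae] with x hx
  exact (integral_prod _ hx).symm

lemma intT_congr {g h : ℝ → ℝ → ℝ} (e : ∀ x₁ x₂, g x₁ x₂ = h x₁ x₂) : intT g = intT h := by
  have : g = h := funext fun x₁ => funext fun x₂ => e x₁ x₂
  rw [this]

lemma intO_congr {g h : ℝ → ℝ → ℝ → ℝ} (e : ∀ x₁ x₂, ∀ x₃ ∈ Icc (0 : ℝ) 1, g x₁ x₂ x₃ = h x₁ x₂ x₃) :
    intO g = intO h := by
  unfold intO
  refine intervalIntegral.integral_congr fun x₁ _ => intervalIntegral.integral_congr fun x₂ _ =>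
    intervalIntegral.integral_congr fun x₃ h3 => e x₁ x₂ x₃ ?_
  rwa [uIcc_of_le zero_le_one] at h3

lemma ae_nu3 : ∀ᵐ x ∂nu3, x.2.2 ∈ Icc (0 : ℝ) 1 := by
  have h : ∀ᵐ z ∂nu1, z ∈ Icc (0 : ℝ) 1 :=
    (ae_restrict_mem measurableSet_Ioc).mono fun z hz => Ioc_subset_Icc_self hz
  exact (Measure.quasiMeasurePreserving_snd.comp Measure.quasiMeasurePreserving_snd).ae h

/-- The integral of an `x₁`-derivative over the torus vanishes. -/
lemma integral_nu2_d1 {g g' : ℝ → ℝ → ℝ} (hp : ∀ x₁ x₂, g (x₁ + 1) x₂ = g x₁ x₂)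
    (hd : ∀ x₁ x₂, HasDerivAt (fun s => g s x₂) (g' x₁ x₂) x₁)
    (hc : Continuous fun x : ℝ × ℝ => g' x.1 x.2) : ∫ x, g' x.1 x.2 ∂nu2 = 0 := by
  rw [integral_prod_symm _ (integrable_nu2 hc)]
  refine integral_eq_zero_of_ae (.of_forall fun x₂ => ?_)
  simp only [Pi.zero_apply]
  rw [← integral_unit, intervalIntegral.integral_eq_sub_of_hasDerivAt (fun x _ => hd x x₂)
    ((by fun_prop : Continuous fun x => g' x x₂).intervalIntegrable _ _)]
  have := hp 0 x₂
  rw [zero_add] at this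
  rw [this, sub_self]

/-- The integral of an `x₂`-derivative over the torus vanishes. -/
lemma integral_nu2_d2 {g g' : ℝ → ℝ → ℝ} (hp : ∀ x₁ x₂, g x₁ (x₂ + 1) = g x₁ x₂)
    (hd : ∀ x₁ x₂, HasDerivAt (fun s => g x₁ s) (g' x₁ x₂) x₂)
    (hc : Continuous fun x : ℝ × ℝ => g' x.1 x.2) : ∫ x, g' x.1 x.2 ∂nu2 = 0 := by
  rw [integral_prod _ (integrable_nu2 hc)]
  refine integral_eq_zero_of_ae (.of_forall fun x₁ => ?_)
  simp only [Pi.zero_apply]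
  rw [← integral_unit, intervalIntegral.integral_eq_sub_of_hasDerivAt (fun x _ => hd x₁ x)
    ((by fun_prop : Continuous fun x => g' x₁ x).intervalIntegrable _ _)]
  have := hp x₁ 0
  rw [zero_add] at this
  rw [this, sub_self]

/-- Periodicity of a field in the tangential variables. -/
def PerF (q : Field) : Prop :=
  ∀ t x₁ x₂ z, q t (x₁ + 1) x₂ z = q t x₁ x₂ z ∧ q t x₁ (x₂ + 1) z = q t x₁ x₂ z

lemma IsPeriodic.momF {h : Profile} (hp : IsPeriodic h) (ψ : Vel → ℝ) : PerF (momF ψ h) := by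
  intro t x₁ x₂ z
  unfold EulerLimit.momF
  constructor <;> congr 1 <;> funext v
  · exact (hp t x₁ x₂ z v).1
  · exact (hp t x₁ x₂ z v).2

/-! ### Divergence theorem and time integration on the channel -/

section Fields

variable {τ : ℝ} {I : Set ℝ} {q : Field} {t : ℝ}

lemma continuous_slice_of_continuousOn {F : ℝ × ℝ × ℝ × ℝ → ℝ} (h : ContinuousOn F (Dom τ I))
    (ht : t ∈ Icc 0 τ) {z : ℝ} (hz : z ∈ I) : Continuous fun x : ℝ × ℝ => F (t, x.1, x.2, z) :=
  h.comp_continuous (f := fun x : ℝ × ℝ => (t, x.1, x.2, z)) (by fun_prop)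
    fun x => ⟨ht, trivial, trivial, hz⟩

lemma continuousOn_chan_of_continuousOn {F : ℝ × ℝ × ℝ × ℝ → ℝ}
    (h : ContinuousOn F (Dom τ (Icc 0 1))) (ht : t ∈ Icc 0 τ) :
    ContinuousOn (fun x : ℝ × ℝ × ℝ => F (t, x.1, x.2.1, x.2.2)) Chan :=
  h.comp (f := fun x : ℝ × ℝ × ℝ => (t, x.1, x.2.1, x.2.2)) (by fun_prop)
    fun x hx => ⟨ht, trivial, trivial, hx.2.2⟩

lemma integral_nu2_D1 (hτ : 0 < τ) (hI : UniqueDiffOn ℝ I) (h : C1Field τ I q) (hp : PerF q)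
    (ht : t ∈ Icc 0 τ) {z : ℝ} (hz : z ∈ I) : ∫ x, D1 q t x.1 x.2 z ∂nu2 = 0 :=
  integral_nu2_d1 (g := fun x₁ x₂ => q t x₁ x₂ z) (g' := fun x₁ x₂ => D1 q t x₁ x₂ z)
    (fun x₁ x₂ => (hp t x₁ x₂ z).1) (fun _ _ => h.hasDerivAt_D1 hτ hI ht hz)
    (continuous_slice_of_continuousOn (h.continuousOn_Dd hτ hI 1) ht hz)

lemma integral_nu2_D2 (hτ : 0 < τ) (hI : UniqueDiffOn ℝ I) (h : C1Field τ I q) (hp : PerF q)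
    (ht : t ∈ Icc 0 τ) {z : ℝ} (hz : z ∈ I) : ∫ x, D2 q t x.1 x.2 z ∂nu2 = 0 :=
  integral_nu2_d2 (g := fun x₁ x₂ => q t x₁ x₂ z) (g' := fun x₁ x₂ => D2 q t x₁ x₂ z)
    (fun x₁ x₂ => (hp t x₁ x₂ z).2) (fun _ _ => h.hasDerivAt_D2 hτ hI ht hz)
    (continuous_slice_of_continuousOn (h.continuousOn_Dd hτ hI 2) ht hz)

/-- With the torus integral innermost, periodicity kills tangential derivatives on each layer x₃ =
z. -/
lemma integral_nu3_eq_layers {F : ℝ × ℝ × ℝ → ℝ} (hF : Integrable F nu3) :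
    ∫ x, F x ∂nu3 = ∫ z, ∫ x : ℝ × ℝ, F (x.1, x.2, z) ∂nu2 ∂nu1 := by
  have e := (measurePreserving_prodAssoc nu1 nu1 nu1)
  rw [← e.integral_comp (MeasurableEquiv.prodAssoc).measurableEmbedding]
  exact integral_prod_symm _ (e.integrable_comp_of_integrable hF)

/-- Integrals over the channel of smooth fields. -/
lemma C1Field.intO_eq (h : C1Field τ (Icc 0 1) q) (ht : t ∈ Icc 0 τ) :
    Integrable (fun x : ℝ × ℝ × ℝ => q t x.1 x.2.1 x.2.2) nu3 ∧
      intO (q t) = ∫ x, q t x.1 x.2.1 x.2.2 ∂nu3 := by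
  have hi : Integrable (fun x : ℝ × ℝ × ℝ => q t x.1 x.2.1 x.2.2) nu3 :=
    integrable_nu3 (continuousOn_chan_of_continuousOn h.continuousOn ht)
  exact ⟨hi, EulerLimit.intO_eq hi⟩

lemma C1Field.intO_Dd_eq (hτ : 0 < τ) (h : C1Field τ (Icc 0 1) q) (d : Fin 4) (ht : t ∈ Icc 0 τ) :
    Integrable (fun x : ℝ × ℝ × ℝ => Dd τ (Icc 0 1) d q t x.1 x.2.1 x.2.2) nu3 ∧
      intO (Dd τ (Icc 0 1) d q t) = ∫ x, Dd τ (Icc 0 1) d q t x.1 x.2.1 x.2.2 ∂nu3 := by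
  have hi : Integrable (fun x : ℝ × ℝ × ℝ => Dd τ (Icc 0 1) d q t x.1 x.2.1 x.2.2) nu3 :=
    integrable_nu3 (continuousOn_chan_of_continuousOn (h.continuousOn_Dd hτ uniqueDiffOn_unit d) ht)
  exact ⟨hi, EulerLimit.intO_eq hi⟩

lemma integral_nu1_eq_zero {F : ℝ → ℝ} (h : ∀ z ∈ Icc (0 : ℝ) 1, F z = 0) : ∫ z, F z ∂nu1 = 0 :=
  integral_eq_zero_of_ae ((ae_restrict_mem measurableSet_Ioc).mono fun z hz =>
    h z (Ioc_subset_Icc_self hz))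

lemma intO_D1 (hτ : 0 < τ) (h : C1Field τ (Icc 0 1) q) (hp : PerF q) (ht : t ∈ Icc 0 τ) :
    intO (D1 q t) = 0 := by
  obtain ⟨hi, e⟩ := h.intO_Dd_eq hτ 1 ht
  refine e.trans ?_
  rw [integral_nu3_eq_layers hi]
  exact integral_nu1_eq_zero fun z hz => integral_nu2_D1 hτ uniqueDiffOn_unit h hp ht hz

lemma intO_D2 (hτ : 0 < τ) (h : C1Field τ (Icc 0 1) q) (hp : PerF q) (ht : t ∈ Icc 0 τ) :
    intO (D2 q t) = 0 := by
  obtain ⟨hi, e⟩ := h.intO_Dd_eq hτ 2 ht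
  refine e.trans ?_
  rw [integral_nu3_eq_layers hi]
  exact integral_nu1_eq_zero fun z hz => integral_nu2_D2 hτ uniqueDiffOn_unit h hp ht hz

lemma hasDerivAt_of_within {a b : ℝ} {F : ℝ → ℝ} {F' x : ℝ}
    (h : HasDerivWithinAt F F' (Icc a b) x) (hx : x ∈ Ioo a b) : HasDerivAt F F' x :=
  h.hasDerivAt (Icc_mem_nhds hx.1 hx.2)

lemma intO_D3 (hτ : 0 < τ) (h : C1Field τ (Icc 0 1) q) (ht : t ∈ Icc 0 τ) :
    intO (D3 (Icc 0 1) q t) = intT fun x₁ x₂ => q t x₁ x₂ 1 - q t x₁ x₂ 0 := by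
  unfold intO
  refine intervalIntegral.integral_congr fun x₁ _ => intervalIntegral.integral_congr fun x₂ _ => ?_
  have hd : ∀ z ∈ Icc (0 : ℝ) 1,
      HasDerivWithinAt (fun s => q t x₁ x₂ s) (D3 (Icc 0 1) q t x₁ x₂ z) (Icc 0 1) z :=
    fun z hz => h.hasDerivWithinAt_D3 hτ uniqueDiffOn_unit ht hz
  have hc : ContinuousOn (fun z => D3 (Icc 0 1) q t x₁ x₂ z) (Icc 0 1) :=
    (h.continuousOn_Dd hτ uniqueDiffOn_unit 3).comp (f := fun z : ℝ => (t, x₁, x₂, z))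
      (by fun_prop) fun z hz => ⟨ht, trivial, trivial, hz⟩
  exact intervalIntegral.integral_eq_sub_of_hasDerivAt_of_le zero_le_one
    (fun z hz => (hd z hz).continuousWithinAt)
    (fun z hz => hasDerivAt_of_within (hd z (Ioo_subset_Icc_self hz)) hz)
    (hc.intervalIntegrable_of_Icc zero_le_one)

/-- Fundamental theorem of calculus under an integral. -/
lemma integral_sub_eq_integral_integral {X : Type*} [MeasurableSpace X] {m : Measure X} [SFinite m]
    {q q' : ℝ → X → ℝ} (ht : 0 ≤ t) (h : ∀ᵐ x ∂m, q t x - q 0 x = ∫ r in (0 : ℝ)..t, q' r x)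
    (hi : Integrable (Function.uncurry q') ((volume.restrict (Ioc 0 t)).prod m)) :
    ∫ x, (q t x - q 0 x) ∂m = ∫ r in (0 : ℝ)..t, ∫ x, q' r x ∂m := by
  rw [integral_congr_ae h, intervalIntegral.integral_of_le ht]
  simp only [intervalIntegral.integral_of_le ht]
  exact (integral_integral_swap hi).symm

/-- Fundamental theorem of calculus in time for fields. -/
lemma C1Field.sub_eq_integral_Dt (hτ : 0 < τ) (hI : UniqueDiffOn ℝ I) (h : C1Field τ I q)
    (ht : t ∈ Icc 0 τ) {x₁ x₂ z : ℝ} (hz : z ∈ I) :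
    q t x₁ x₂ z - q 0 x₁ x₂ z = ∫ r in (0 : ℝ)..t, Dt τ q r x₁ x₂ z := by
  have hsub : Icc 0 t ⊆ Icc 0 τ := Icc_subset_Icc_right ht.2
  have hd : ∀ r ∈ Icc 0 τ, HasDerivWithinAt (fun s => q s x₁ x₂ z) (Dt τ q r x₁ x₂ z) (Icc 0 τ) r :=
    fun r hr => h.hasDerivWithinAt_Dt hτ hI hr hz
  have hc : ContinuousOn (fun r => Dt τ q r x₁ x₂ z) (Icc 0 τ) :=
    (h.continuousOn_Dd hτ hI 0).comp (f := fun r : ℝ => (r, x₁, x₂, z))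
      (by fun_prop) fun r hr => ⟨hr, trivial, trivial, hz⟩
  exact (intervalIntegral.integral_eq_sub_of_hasDerivAt_of_le ht.1
    (fun r hr => ((hd r (hsub hr)).continuousWithinAt.mono hsub))
    (fun r hr => hasDerivAt_of_within (hd r (hsub (Ioo_subset_Icc_self hr)))
      ⟨hr.1, hr.2.trans_le ht.2⟩)
    ((hc.mono hsub).intervalIntegrable_of_Icc ht.1)).symm

lemma intO_sub_eq (hτ : 0 < τ) (h : C1Field τ (Icc 0 1) q) (ht : t ∈ Icc 0 τ) :
    intO (q t) - intO (q 0) = ∫ r in (0 : ℝ)..t, intO (Dt τ q r) := by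
  have h0 : (0 : ℝ) ∈ Icc 0 τ := ⟨le_rfl, hτ.le⟩
  obtain ⟨i1, e1⟩ := h.intO_eq ht
  obtain ⟨i0, e0⟩ := h.intO_eq h0
  have hcont := h.continuousOn_Dd hτ uniqueDiffOn_unit 0
  have hi : Integrable (Function.uncurry fun r (x : ℝ × ℝ × ℝ) => Dt τ q r x.1 x.2.1 x.2.2)
      ((volume.restrict (Ioc 0 t)).prod nu3) := by
    have h1 : IntegrableOn (Function.uncurry fun r (x : ℝ × ℝ × ℝ) => Dt τ q r x.1 x.2.1 x.2.2)
        (Icc 0 t ×ˢ Icc 0 1 ×ˢ Icc 0 1 ×ˢ Icc 0 1) volume :=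
      (hcont.mono (prod_mono (Icc_subset_Icc_right ht.2)
        (prod_mono (subset_univ _) (prod_mono (subset_univ _) le_rfl)))).integrableOn_compact
        (isCompact_Icc.prod (isCompact_Icc.prod (isCompact_Icc.prod isCompact_Icc)))
    have h2 := h1.mono_set (prod_mono (Ioc_subset_Icc_self (a := (0 : ℝ)) (b := t))
      (prod_mono (Ioc_subset_Icc_self (a := (0 : ℝ)) (b := 1))
        (prod_mono (Ioc_subset_Icc_self (a := (0 : ℝ)) (b := 1))
          (Ioc_subset_Icc_self (a := (0 : ℝ)) (b := 1)))))
    rwa [IntegrableOn, Measure.volume_eq_prod, Measure.volume_eq_prod, Measure.volume_eq_prod,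
      ← Measure.prod_restrict, ← Measure.prod_restrict, ← Measure.prod_restrict] at h2
  rw [e1, e0, ← integral_sub i1 i0]
  rw [integral_sub_eq_integral_integral (q := fun r (x : ℝ × ℝ × ℝ) => q r x.1 x.2.1 x.2.2) ht.1
    (ae_nu3.mono fun x hx => h.sub_eq_integral_Dt hτ uniqueDiffOn_unit ht hx) hi]
  refine intervalIntegral.integral_congr fun r hr => ?_
  rw [uIcc_of_le ht.1] at hr
  exact (h.intO_Dd_eq hτ 0 ⟨hr.1, hr.2.trans ht.2⟩).2.symm

/-- Continuity in time of channel integrals. -/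
lemma continuousOn_intO {F : ℝ × ℝ × ℝ × ℝ → ℝ} (h : ContinuousOn F (Dom τ (Icc 0 1))) :
    ContinuousOn (fun t => intO fun x₁ x₂ x₃ => F (t, x₁, x₂, x₃)) (Icc 0 τ) := by
  have hi : ∀ t ∈ Icc 0 τ, Integrable (fun x : ℝ × ℝ × ℝ => F (t, x.1, x.2.1, x.2.2)) nu3 :=
    fun t ht => integrable_nu3 (continuousOn_chan_of_continuousOn h ht)
  have hK : IsCompact (Icc 0 τ ×ˢ Icc (0 : ℝ) 1 ×ˢ Icc (0 : ℝ) 1 ×ˢ Icc (0 : ℝ) 1) :=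
    isCompact_Icc.prod (isCompact_Icc.prod (isCompact_Icc.prod isCompact_Icc))
  obtain ⟨C, hC⟩ := hK.exists_bound_of_continuousOn (h.mono (prod_mono le_rfl
    (prod_mono (subset_univ _) (prod_mono (subset_univ _) le_rfl))))
  have hae : ∀ᵐ x ∂nu3, x.1 ∈ Icc (0 : ℝ) 1 ∧ x.2.1 ∈ Icc (0 : ℝ) 1 ∧ x.2.2 ∈ Icc (0 : ℝ) 1 := by
    have h1 : ∀ᵐ z ∂nu1, z ∈ Icc (0 : ℝ) 1 :=
      (ae_restrict_mem measurableSet_Ioc).mono fun z hz => Ioc_subset_Icc_self hz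
    filter_upwards [Measure.quasiMeasurePreserving_fst.ae h1,
      (Measure.quasiMeasurePreserving_fst.comp Measure.quasiMeasurePreserving_snd).ae h1,
      ae_nu3] with x a b c
    exact ⟨a, b, c⟩
  have := continuousOn_of_dominated (μ := nu3) (s := Icc 0 τ)
    (F := fun t (x : ℝ × ℝ × ℝ) => F (t, x.1, x.2.1, x.2.2)) (bound := fun _ => C)
    (fun t ht => (hi t ht).aestronglyMeasurable)
    (fun t ht => hae.mono fun x hx => hC (t, x.1, x.2.1, x.2.2) ⟨ht, hx.1, hx.2.1, hx.2.2⟩)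
    (integrable_const C)
    (hae.mono fun x hx => h.comp (f := fun t : ℝ => (t, x.1, x.2.1, x.2.2)) (by fun_prop)
      fun t ht => ⟨ht, trivial, trivial, hx.2.2⟩)
  exact this.congr fun t ht => EulerLimit.intO_eq (hi t ht)

/-- Continuity in time of torus integrals. -/
lemma continuousOn_intT {F : ℝ → ℝ → ℝ → ℝ}
    (h : ContinuousOn (fun p : ℝ × ℝ × ℝ => F p.1 p.2.1 p.2.2) (Icc 0 τ ×ˢ univ ×ˢ univ)) :
    ContinuousOn (fun t => intT (F t)) (Icc 0 τ) := by
  have hc : ∀ t ∈ Icc 0 τ, Continuous fun x : ℝ × ℝ => F t x.1 x.2 := fun t ht =>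
    h.comp_continuous (f := fun x : ℝ × ℝ => (t, x.1, x.2)) (by fun_prop)
      fun x => ⟨ht, trivial, trivial⟩
  have hK : IsCompact (Icc 0 τ ×ˢ Icc (0 : ℝ) 1 ×ˢ Icc (0 : ℝ) 1) :=
    isCompact_Icc.prod (isCompact_Icc.prod isCompact_Icc)
  obtain ⟨C, hC⟩ := hK.exists_bound_of_continuousOn (h.mono (prod_mono le_rfl
    (prod_mono (subset_univ _) (subset_univ _))))
  have hae : ∀ᵐ x ∂nu2, x.1 ∈ Icc (0 : ℝ) 1 ∧ x.2 ∈ Icc (0 : ℝ) 1 := by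
    have h1 : ∀ᵐ z ∂nu1, z ∈ Icc (0 : ℝ) 1 :=
      (ae_restrict_mem measurableSet_Ioc).mono fun z hz => Ioc_subset_Icc_self hz
    filter_upwards [Measure.quasiMeasurePreserving_fst.ae h1,
      Measure.quasiMeasurePreserving_snd.ae h1] with x a b
    exact ⟨a, b⟩
  have := continuousOn_of_dominated (μ := nu2) (s := Icc 0 τ)
    (F := fun t (x : ℝ × ℝ) => F t x.1 x.2) (bound := fun _ => C)
    (fun t ht => (integrable_nu2 (hc t ht)).aestronglyMeasurable)
    (fun t ht => hae.mono fun x hx => hC (t, x.1, x.2) ⟨ht, hx.1, hx.2⟩)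
    (integrable_const C)
    (.of_forall fun x => h.comp (f := fun t : ℝ => (t, x.1, x.2)) (by fun_prop)
      fun t ht => ⟨ht, trivial, trivial⟩)
  exact this.congr fun t ht => intT_eq (integrable_nu2 (hc t ht))

/-- A continuous function with vanishing primitive vanishes. -/
lemma eq_zero_of_integral_eq_zero (hτ : 0 < τ) {h : ℝ → ℝ} (hc : ContinuousOn h (Icc 0 τ))
    (h0 : ∀ t ∈ Icc 0 τ, ∫ r in (0 : ℝ)..t, h r = 0) (ht : t ∈ Icc 0 τ) : h t = 0 := by
  -- Extension by the end values gives a continuous function on ℝ, whose primitive can be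
  -- differentiated at 0 and τ as well.
  let H : ℝ → ℝ := fun x => h (projIcc 0 τ hτ.le x)
  have hH : Continuous H := hc.comp_continuous (by fun_prop) fun x => (projIcc 0 τ hτ.le x).2
  have e : ∀ x ∈ Icc 0 τ, H x = h x := fun x hx => by simp [H, projIcc_of_mem hτ.le hx]
  have h1 : HasDerivWithinAt (fun x => ∫ r in (0 : ℝ)..x, H r) (H t) (Icc 0 τ) t :=
    (intervalIntegral.integral_hasDerivAt_right (hH.intervalIntegrable _ _)
      (hH.stronglyMeasurableAtFilter _ _) hH.continuousAt).hasDerivWithinAt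
  have h2 : HasDerivWithinAt (fun x => ∫ r in (0 : ℝ)..x, H r) 0 (Icc 0 τ) t := by
    refine (hasDerivWithinAt_const t _ (0 : ℝ)).congr (fun x hx => ?_) ?_
    all_goals
      rw [intervalIntegral.integral_congr (g := h)]
      · first | exact h0 x hx | exact h0 t ht
      · intro r hr
        first
        | rw [uIcc_of_le hx.1] at hr; exact e r ⟨hr.1, hr.2.trans hx.2⟩
        | rw [uIcc_of_le ht.1] at hr; exact e r ⟨hr.1, hr.2.trans ht.2⟩
  rw [← e t ht]
  exact (uniqueDiffOn_Icc hτ t ht).eq_deriv _ h1 h2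

end Fields

end

section

/-! ### The Knudsen layer -/

lemma exists_seq_slope {S : Set ℝ} {t : ℝ} (hS : t ∈ closure (S \ {t})) :
    ∃ s : ℕ → ℝ, (∀ m, s m ∈ S) ∧ Filter.Tendsto s Filter.atTop (nhdsWithin t (S \ {t})) := by
  obtain ⟨s, hs, hl⟩ := mem_closure_iff_seq_limit.1 hS
  exact ⟨s, fun m => (hs m).1, tendsto_nhdsWithin_iff.2 ⟨hl, .of_forall hs⟩⟩

/-- The derivative is a pointwise limit of difference quotients along one sequence that does not
depend on x. Joint measurability of Knudsen derivatives is obtained this way, since it is assumed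
only for the profile itself. -/
lemma measurable_of_hasDerivWithinAt {X : Type*} [MeasurableSpace X] {F : ℝ → X → ℝ} {F' : X → ℝ}
    {S : Set ℝ} {t : ℝ} (hS : t ∈ closure (S \ {t})) (ht : t ∈ S) (hF : ∀ s ∈ S, Measurable (F s))
    (hd : ∀ x, HasDerivWithinAt (fun s => F s x) (F' x) S t) : Measurable F' := by
  obtain ⟨s, hs, hl⟩ := exists_seq_slope hS
  refine measurable_of_tendsto_metrizable (f := fun m x => slope (fun s => F s x) t (s m))
    (fun m => ?_) (tendsto_pi_nhds.2 fun x => (hasDerivWithinAt_iff_tendsto_slope.1 (hd x)).comp hl)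
  simp only [slope_def_field]
  exact ((hF _ (hs m)).sub (hF _ ht)).div_const _

lemma aestronglyMeasurable_of_hasDerivWithinAt {X : Type*} [MeasurableSpace X] {m : Measure X}
    {F : ℝ → X → ℝ} {F' : X → ℝ} {S : Set ℝ} {t : ℝ} (hS : t ∈ closure (S \ {t})) (ht : t ∈ S)
    (hF : ∀ s ∈ S, Measurable (F s))
    (hd : ∀ᵐ x ∂m, HasDerivWithinAt (fun s => F s x) (F' x) S t) : AEStronglyMeasurable F' m := by
  obtain ⟨s, hs, hl⟩ := exists_seq_slope hS
  refine aestronglyMeasurable_of_tendsto_ae Filter.atTop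
    (f := fun m x => slope (fun s => F s x) t (s m)) (fun m => ?_)
    (hd.mono fun x hx => (hasDerivWithinAt_iff_tendsto_slope.1 hx).comp hl)
  simp only [slope_def_field]
  exact (((hF _ (hs m)).sub (hF _ ht)).div_const _).aestronglyMeasurable

lemma mem_closure_diff {S : Set ℝ} {t : ℝ} (hS : UniqueDiffOn ℝ S) (ht : t ∈ S) :
    t ∈ closure (S \ {t}) := by
  have h := (hS t ht).accPt
  rw [AccPt, ← nhdsWithin_inter', inter_comm, ← sdiff_eq] at h
  exact mem_closure_iff_nhdsWithin_neBot.2 h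

/-! ### Exponentially decaying sources -/

/-- Sources in the Knudsen layer decaying exponentially and free of hydrodynamic moments. -/
def ExpNull (S : ℝ → Vel → ℝ) : Prop :=
  (∃ ζ > (0 : ℝ), ∃ C : ℝ, 0 ≤ C ∧ ∀ η > 0, ∀ v, |S η v| ≤ C * Real.exp (-ζ * η) * (1 + ‖v‖)) ∧
    ∀ η > 0, Null (S η)

lemma exp_neg_mul_le {ζ ζ' η : ℝ} (h : ζ ≤ ζ') (hη : 0 ≤ η) :
    Real.exp (-ζ' * η) ≤ Real.exp (-ζ * η) :=
  Real.exp_le_exp.2 (by nlinarith)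

lemma ExpNull.add {S R : ℝ → Vel → ℝ} (hS : ExpNull S) (hR : ExpNull R) :
    ExpNull fun η v => S η v + R η v := by
  obtain ⟨⟨ζ, hζ, C, hC, hb⟩, hn⟩ := hS
  obtain ⟨⟨ζ', hζ', C', hC', hb'⟩, hn'⟩ := hR
  refine ⟨⟨min ζ ζ', lt_min hζ hζ', C + C', by positivity, fun η hη v => ?_⟩,
    fun η hη => (hn η hη).add (hn' η hη)⟩
  have h1 := exp_neg_mul_le (min_le_left ζ ζ') (le_of_lt hη)
  have h2 := exp_neg_mul_le (min_le_right ζ ζ') (le_of_lt hη)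
  calc |S η v + R η v| ≤ |S η v| + |R η v| := abs_add_le _ _
    _ ≤ C * Real.exp (-ζ * η) * (1 + ‖v‖) + C' * Real.exp (-ζ' * η) * (1 + ‖v‖) :=
        add_le_add (hb η hη v) (hb' η hη v)
    _ ≤ C * Real.exp (-(min ζ ζ') * η) * (1 + ‖v‖) + C' * Real.exp (-(min ζ ζ') * η) * (1 + ‖v‖) := by
        gcongr
    _ = _ := by ring

lemma ExpNull.const_mul {S : ℝ → Vel → ℝ} (c : ℝ) (hS : ExpNull S) :
    ExpNull fun η v => c * S η v := by
  obtain ⟨⟨ζ, hζ, C, hC, hb⟩, hn⟩ := hS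
  refine ⟨⟨ζ, hζ, |c| * C, by positivity, fun η hη v => ?_⟩, fun η hη => (hn η hη).const_mul c⟩
  rw [abs_mul, mul_assoc |c|, mul_assoc |c|]
  gcongr
  exact hb η hη v

lemma expNull_zero : ExpNull fun _ _ => 0 :=
  ⟨⟨1, one_pos, 0, le_rfl, fun η _ v => by simp⟩, fun _ _ => null_zero⟩

lemma ExpNull.sum {ι : Type*} (s : Finset ι) {S : ι → ℝ → Vel → ℝ} (hS : ∀ i ∈ s, ExpNull (S i)) :
    ExpNull fun η v => ∑ i ∈ s, S i η v := by
  classical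
  induction s using Finset.induction_on with
  | empty => simpa using expNull_zero
  | insert i s hi ih =>
    simp only [Finset.sum_insert hi]
    exact (hS i (by simp)).add (ih fun j hj => hS j (by simp [hj]))

/-- The powers of η come from the Taylor expansions at the wall. Half of the decay rate absorbs
them, by η^l ≤ l!(2/ζ)^l e^{ζη/2}. -/
lemma ExpNull.pow_mul {S : ℝ → Vel → ℝ} (l : ℕ) (hS : ExpNull S) :
    ExpNull fun η v => η ^ l * S η v := by
  obtain ⟨⟨ζ, hζ, C, hC, hb⟩, hn⟩ := hS
  refine ⟨⟨ζ / 2, by positivity, l.factorial * (2 / ζ) ^ l * C, by positivity, fun η hη v => ?_⟩,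
    fun η hη => (hn η hη).const_mul _⟩
  have hη' : 0 < η := hη
  have h1 : η ^ l ≤ l.factorial * (2 / ζ) ^ l * Real.exp (ζ / 2 * η) := by
    have := Real.pow_div_factorial_le_exp (ζ / 2 * η) (by positivity) l
    rw [div_le_iff₀ (by positivity)] at this
    calc η ^ l = (2 / ζ) ^ l * (ζ / 2 * η) ^ l := by
          rw [← mul_pow]; congr 1; field_simp
      _ ≤ (2 / ζ) ^ l * (Real.exp (ζ / 2 * η) * l.factorial) := by gcongr
      _ = _ := by ring
  have h2 : Real.exp (ζ / 2 * η) * Real.exp (-ζ * η) = Real.exp (-(ζ / 2) * η) := by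
    rw [← Real.exp_add]; congr 1; ring
  rw [abs_mul, abs_of_nonneg (by positivity)]
  calc η ^ l * |S η v| ≤ (l.factorial * (2 / ζ) ^ l * Real.exp (ζ / 2 * η)) *
        (C * Real.exp (-ζ * η) * (1 + ‖v‖)) :=
        mul_le_mul h1 (hb η hη v) (abs_nonneg _) (by positivity)
    _ = l.factorial * (2 / ζ) ^ l * C * (Real.exp (ζ / 2 * η) * Real.exp (-ζ * η)) * (1 + ‖v‖) := by ring
    _ = _ := by rw [h2]

/-- Exponentially decaying bounded functions. -/
def ExpBdd (h : ℝ → Vel → ℝ) : Prop :=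
  (∃ ζ > (0 : ℝ), ∃ C : ℝ, 0 ≤ C ∧ ∀ η > 0, ∀ v, |h η v| ≤ C * Real.exp (-ζ * η)) ∧
    ∀ η > 0, Measurable (h η)

lemma expNull_GamS {g h : ℝ → Vel → ℝ} {A : ℝ} (hA : 0 ≤ A) (hg : ∀ η > 0, Measurable (g η))
    (hgA : ∀ η > 0, ∀ v, |g η v| ≤ A) (hh : ExpBdd h) : ExpNull fun η => GamS (g η) (h η) := by
  obtain ⟨⟨ζ, hζ, C, hC, hb⟩, hm⟩ := hh
  have hk := kerMass_nonneg
  refine ⟨⟨ζ, hζ, 4 * kerMass * (A * C), by positivity, fun η hη v => ?_⟩, fun η hη =>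
    null_GamS ⟨hg η hη, A, hA, hgA η hη⟩ ⟨hm η hη, _, by positivity, hb η hη⟩⟩
  exact (abs_GamS_le (hg η hη) (hm η hη) hA (by positivity) (hgA η hη) (hb η hη) v).trans
    (le_of_eq (by ring))

lemma expNull_GamS_const {g : Vel → ℝ} {h : ℝ → Vel → ℝ} (hg : BddM g) (hh : ExpBdd h) :
    ExpNull fun η => GamS g (h η) := by
  obtain ⟨hm, A, hA, hb⟩ := hg
  exact expNull_GamS hA (fun _ _ => hm) (fun _ _ => hb) hh

lemma expNull_GamS_mul {g h : ℝ → Vel → ℝ} (hg : ExpBdd g) (hh : ExpBdd h) :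
    ExpNull fun η => GamS (g η) (h η) := by
  obtain ⟨⟨ζ, hζ, C, hC, hb⟩, hm⟩ := hg
  refine expNull_GamS hC hm (fun η hη v => (hb η hη v).trans ?_) hh
  refine mul_le_of_le_one_right hC (Real.exp_le_one_iff.2 ?_)
  have : 0 < η := hη
  nlinarith

section Knudsen

variable {n 𝔟 : ℕ} {τ : ℝ} {f : ℤ → Profile} {s : Side} {fb fk : ℤ → Profile} {t x₁ x₂ η : ℝ}

lemma IsKnudsen.bound (hk : IsKnudsen n 𝔟 τ f s fb fk) (i : ℤ) :
    ∃ ζ > (0 : ℝ), ∃ C : ℝ, 0 ≤ C ∧ ∀ t ∈ Icc 0 τ, ∀ x₁ x₂ : ℝ, ∀ η ∈ Ici (0 : ℝ), ∀ v : Vel,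
      |fk i t x₁ x₂ η v| ≤ C * Real.exp (-ζ * η) * ((1 + ‖v‖) ^ 3)⁻¹ ∧
      |Dt τ (slice (fk i) v) t x₁ x₂ η| ≤ C * Real.exp (-ζ * η) * ((1 + ‖v‖) ^ 3)⁻¹ ∧
      |D1 (slice (fk i) v) t x₁ x₂ η| ≤ C * Real.exp (-ζ * η) * ((1 + ‖v‖) ^ 3)⁻¹ ∧
      |D2 (slice (fk i) v) t x₁ x₂ η| ≤ C * Real.exp (-ζ * η) * ((1 + ‖v‖) ^ 3)⁻¹ := by
  obtain ⟨ζ, hζ, C, h⟩ := hk.decay i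
  refine ⟨ζ, hζ, |C|, abs_nonneg C, fun t ht x₁ x₂ η hη v => ?_⟩
  have h1 := h t ht x₁ x₂ η hη v
  have h2 : C * Real.exp (-ζ * η) * ((1 + ‖v‖) ^ 3)⁻¹ ≤ |C| * Real.exp (-ζ * η) * ((1 + ‖v‖) ^ 3)⁻¹ := by
    gcongr; exact le_abs_self C
  have a := abs_nonneg (fk i t x₁ x₂ η v)
  have b := abs_nonneg (Dt τ (slice (fk i) v) t x₁ x₂ η)
  have c := abs_nonneg (D1 (slice (fk i) v) t x₁ x₂ η)
  have d := abs_nonneg (D2 (slice (fk i) v) t x₁ x₂ η)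
  refine ⟨?_, ?_, ?_, ?_⟩ <;> linarith

/-- The profile is controlled only for η ≥ 0; reading it at max(η,0) gives a function measurable on
all of ℝ that agrees with it on the layer. -/
lemma IsKnudsen.measurable_val (hk : IsKnudsen n 𝔟 τ f s fb fk) (i : ℤ) (ht : t ∈ Icc 0 τ) :
    Measurable fun p : (ℝ × ℝ) × (ℝ × Vel) => fk i t p.1.1 p.1.2 (max p.2.1 0) p.2.2 := by
  have := (hk.measurable i t ht).comp
    (by fun_prop : Measurable fun p : (ℝ × ℝ) × (ℝ × Vel) => (p.1, (p.2.1.toNNReal, p.2.2)))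
  simpa only [Function.comp_def, Real.coe_toNNReal'] using this

lemma IsKnudsen.measurable_slice (hk : IsKnudsen n 𝔟 τ f s fb fk) (i : ℤ) (ht : t ∈ Icc 0 τ)
    (hη : 0 ≤ η) : Measurable (fk i t x₁ x₂ η) := by
  have := (hk.measurable_val i ht).comp
    (by fun_prop : Measurable fun v : Vel => (((x₁, x₂), (η, v)) : (ℝ × ℝ) × (ℝ × Vel)))
  simpa only [Function.comp_def, max_eq_left hη] using this

lemma IsKnudsen.wtd (hk : IsKnudsen n 𝔟 τ f s fb fk) (i : ℤ) (ht : t ∈ Icc 0 τ)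
    (hη : 0 ≤ η) : Wtd (fk i t x₁ x₂ η) := by
  obtain ⟨ζ, -, C, -, hb⟩ := hk.bound i
  exact Wtd.of_bound (hk.measurable_slice i ht hη) fun v => (hb t ht x₁ x₂ η hη v).1

/-- With η and v frozen and a dummy normal variable, the calculus of `C1Field` applies to Knudsen
profiles. -/
lemma IsKnudsen.c1 (hk : IsKnudsen n 𝔟 τ f s fb fk) (i : ℤ) (hη : 0 ≤ η) (v : Vel) :
    C1Field τ univ fun t x₁ x₂ _ => fk i t x₁ x₂ η v :=
  (hk.smooth i η hη v).comp (t := Icc 0 τ ×ˢ univ ×ˢ univ)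
    (f := fun p : ℝ × ℝ × ℝ × ℝ => (p.1, p.2.1, p.2.2.1)) (by fun_prop)
    fun p hp => ⟨hp.1, trivial, trivial⟩

lemma le_max_zero (η : ℝ) : 0 ≤ max η 0 := le_max_right _ _

lemma IsKnudsen.measurable_Dt (hτ : 0 < τ) (hk : IsKnudsen n 𝔟 τ f s fb fk) (i : ℤ)
    (ht : t ∈ Icc 0 τ) : Measurable fun p : (ℝ × ℝ) × (ℝ × Vel) =>
      Dt τ (slice (fk i) p.2.2) t p.1.1 p.1.2 (max p.2.1 0) := by
  refine measurable_of_hasDerivWithinAt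
    (F := fun s p => fk i s p.1.1 p.1.2 (max p.2.1 0) p.2.2) (mem_closure_diff (uniqueDiffOn_Icc hτ) ht) ht
    (fun s hs => hk.measurable_val i hs) fun p => ?_
  exact (hk.c1 i (le_max_zero p.2.1) p.2.2).hasDerivWithinAt_Dt hτ uniqueDiffOn_univ ht (mem_univ 0)

lemma IsKnudsen.measurable_D1 (hτ : 0 < τ) (hk : IsKnudsen n 𝔟 τ f s fb fk) (i : ℤ)
    (ht : t ∈ Icc 0 τ) : Measurable fun p : (ℝ × ℝ) × (ℝ × Vel) =>
      D1 (slice (fk i) p.2.2) t p.1.1 p.1.2 (max p.2.1 0) := by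
  refine measurable_of_hasDerivWithinAt (t := 0)
    (F := fun s (p : (ℝ × ℝ) × (ℝ × Vel)) => fk i t (p.1.1 + s) p.1.2 (max p.2.1 0) p.2.2) (mem_closure_diff uniqueDiffOn_univ trivial) trivial
    (fun s _ => (hk.measurable_val i ht).comp (by fun_prop :
      Measurable fun p : (ℝ × ℝ) × (ℝ × Vel) => ((p.1.1 + s, p.1.2), p.2))) fun p => ?_
  have := (hk.c1 i (le_max_zero p.2.1) p.2.2).hasDerivAt_D1 hτ uniqueDiffOn_univ ht (mem_univ 0)
    (x₁ := p.1.1 + 0) (x₂ := p.1.2)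
  have := (this.comp_const_add p.1.1 0).hasDerivWithinAt (s := univ)
  rwa [add_zero] at this

lemma IsKnudsen.measurable_D2 (hτ : 0 < τ) (hk : IsKnudsen n 𝔟 τ f s fb fk) (i : ℤ)
    (ht : t ∈ Icc 0 τ) : Measurable fun p : (ℝ × ℝ) × (ℝ × Vel) =>
      D2 (slice (fk i) p.2.2) t p.1.1 p.1.2 (max p.2.1 0) := by
  refine measurable_of_hasDerivWithinAt (t := 0)
    (F := fun s (p : (ℝ × ℝ) × (ℝ × Vel)) => fk i t p.1.1 (p.1.2 + s) (max p.2.1 0) p.2.2) (mem_closure_diff uniqueDiffOn_univ trivial) trivial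
    (fun s _ => (hk.measurable_val i ht).comp (by fun_prop :
      Measurable fun p : (ℝ × ℝ) × (ℝ × Vel) => ((p.1.1, p.1.2 + s), p.2))) fun p => ?_
  have := (hk.c1 i (le_max_zero p.2.1) p.2.2).hasDerivAt_D2 hτ uniqueDiffOn_univ ht (mem_univ 0)
    (x₁ := p.1.1) (x₂ := p.1.2 + 0)
  have := (this.comp_const_add p.1.2 0).hasDerivWithinAt (s := univ)
  rwa [add_zero] at this

/-- The measure `dη dv` on the Knudsen layer. -/
abbrev layMeas : Measure (ℝ × Vel) := (volume.restrict (Ioi (0 : ℝ))).prod volume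

lemma measurable_knSource (hτ : 0 < τ) (hk : IsKnudsen n 𝔟 τ f s fb fk) (k : ℤ)
    (ht : t ∈ Icc 0 τ) : Measurable fun p : (ℝ × ℝ) × (ℝ × Vel) =>
      knSource n τ fk k t p.1.1 p.1.2 (max p.2.1 0) p.2.2 := by
  unfold knSource tangTransport
  have h1 := hk.measurable_Dt hτ (k + 2 - 2 * n) ht
  have h2 := hk.measurable_D1 hτ (k - n) ht
  have h3 := hk.measurable_D2 hτ (k - n) ht
  exact h1.add (((by fun_prop : Measurable fun p : (ℝ × ℝ) × (ℝ × Vel) => p.2.2 0).mul h2).add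
    ((by fun_prop : Measurable fun p : (ℝ × ℝ) × (ℝ × Vel) => p.2.2 1).mul h3))

lemma norm_mul_inv_le (v : Vel) : ‖v‖ * ((1 + ‖v‖) ^ 3)⁻¹ ≤ 1 := by
  rw [← div_eq_mul_inv, div_le_one (by positivity)]
  have := norm_nonneg v
  nlinarith [pow_nonneg this 2, pow_nonneg this 3]

/-- The cubic velocity weight absorbs the factors v₁, v₂ of the transport term; the slower of the
two exponential rates is kept. -/
lemma knSource_bound (hk : IsKnudsen n 𝔟 τ f s fb fk) (k : ℤ) :
    ∃ ζ > (0 : ℝ), ∃ C : ℝ, 0 ≤ C ∧ ∀ t ∈ Icc 0 τ, ∀ x₁ x₂ : ℝ, ∀ η ≥ (0 : ℝ), ∀ v : Vel,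
      |knSource n τ fk k t x₁ x₂ η v| ≤ C * Real.exp (-ζ * η) := by
  obtain ⟨ζ, hζ, C, hC, hb⟩ := hk.bound (k + 2 - 2 * n)
  obtain ⟨ζ', hζ', C', hC', hb'⟩ := hk.bound (k - n)
  refine ⟨min ζ ζ', lt_min hζ hζ', C + (C' + C'), by positivity, fun t ht x₁ x₂ η hη v => ?_⟩
  have e1 := exp_neg_mul_le (min_le_left ζ ζ') hη
  have e2 := exp_neg_mul_le (min_le_right ζ ζ') hη
  have h0 := (hb t ht x₁ x₂ η hη v).2.1
  have h1 := (hb' t ht x₁ x₂ η hη v).2.2.1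
  have h2 := (hb' t ht x₁ x₂ η hη v).2.2.2
  have hw := inv_pow_le_one v 3
  have hv := norm_mul_inv_le v
  have key : ∀ (j : Fin 3) (d : ℝ), |d| ≤ C' * Real.exp (-ζ' * η) * ((1 + ‖v‖) ^ 3)⁻¹ →
      |v j * d| ≤ C' * Real.exp (-(min ζ ζ') * η) := fun j d hd => by
    rw [abs_mul]
    calc |v j| * |d| ≤ ‖v‖ * (C' * Real.exp (-ζ' * η) * ((1 + ‖v‖) ^ 3)⁻¹) :=
          mul_le_mul (abs_coord_le v j) hd (abs_nonneg _) (norm_nonneg _)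
      _ = C' * Real.exp (-ζ' * η) * (‖v‖ * ((1 + ‖v‖) ^ 3)⁻¹) := by ring
      _ ≤ C' * Real.exp (-ζ' * η) * 1 := by gcongr
      _ ≤ C' * Real.exp (-(min ζ ζ') * η) := by rw [mul_one]; gcongr
  have k0 : |Dt τ (slice (fk (k + 2 - 2 * n)) v) t x₁ x₂ η| ≤ C * Real.exp (-(min ζ ζ') * η) :=
    calc _ ≤ C * Real.exp (-ζ * η) * ((1 + ‖v‖) ^ 3)⁻¹ := h0
      _ ≤ C * Real.exp (-ζ * η) * 1 := by gcongr
      _ ≤ _ := by rw [mul_one]; gcongr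
  unfold knSource tangTransport
  refine (abs_add_le _ _).trans ?_
  have := abs_add_le (v 0 * D1 (slice (fk (k - n)) v) t x₁ x₂ η)
    (v 1 * D2 (slice (fk (k - n)) v) t x₁ x₂ η)
  have k1 := key 0 _ h1
  have k2 := key 1 _ h2
  linarith

lemma integrable_exp_Ioi {ζ : ℝ} (hζ : 0 < ζ) :
    Integrable (fun η => Real.exp (-ζ * η)) (volume.restrict (Ioi (0 : ℝ))) :=
  exp_neg_integrableOn_Ioi 0 hζ

lemma ae_layMeas : ∀ᵐ p ∂layMeas, 0 < p.1 :=
  Measure.quasiMeasurePreserving_fst.ae (ae_restrict_mem measurableSet_Ioi)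

/-- Integrability over the layer from an exponential bound. -/
lemma integrable_layMeas {F : ℝ × Vel → ℝ} (hF : AEStronglyMeasurable F layMeas) {ζ C : ℝ}
    (hζ : 0 < ζ) {ψ : Vel → ℝ} (hψ : PolyB ψ)
    (hb : ∀ᵐ p ∂layMeas, |F p| ≤ C * Real.exp (-ζ * p.1) * (sqrtM p.2 * ψ p.2)) :
    Integrable F layMeas := by
  have h := ((integrable_exp_Ioi hζ).mul_prod hψ.integrable).const_mul C
  refine h.mono' hF (hb.mono fun p hp => ?_)
  rw [Real.norm_eq_abs]
  exact hp.trans (le_of_eq (by ring))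

lemma integrable_mom_knSource (hτ : 0 < τ) (hk : IsKnudsen n 𝔟 τ f s fb fk) (k : ℤ)
    (ht : t ∈ Icc 0 τ) {ψ : Vel → ℝ} (hψ : PolyB ψ) :
    Integrable (fun p : ℝ × Vel => ψ p.2 * (sqrtM p.2 * knSource n τ fk k t x₁ x₂ p.1 p.2))
      layMeas := by
  obtain ⟨ζ, hζ, C, hC, hb⟩ := knSource_bound hk k
  have hm : Measurable fun p : ℝ × Vel => ψ p.2 * (sqrtM p.2 *
      knSource n τ fk k t x₁ x₂ (max p.1 0) p.2) :=
    (hψ.1.comp measurable_snd).mul ((continuous_sqrtM.measurable.comp measurable_snd).mul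
      ((measurable_knSource hτ hk k ht).comp (by fun_prop :
        Measurable fun p : ℝ × Vel => (((x₁, x₂), p) : (ℝ × ℝ) × (ℝ × Vel)))))
  have habs : PolyB fun v => |ψ v| := by
    obtain ⟨a, D, N, hD, h⟩ := hψ
    exact ⟨a.abs, D, N, hD, fun v => by simpa using h v⟩
  refine integrable_layMeas (hm.aestronglyMeasurable.congr ?_) (C := C) hζ habs ?_
  · filter_upwards [ae_layMeas] with p hp
    rw [max_eq_left hp.le]
  · filter_upwards [ae_layMeas] with p hp
    have h1 := hb t ht x₁ x₂ p.1 hp.le p.2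
    have h2 := sqrtM_pos p.2
    rw [abs_mul, abs_mul, abs_of_pos h2]
    calc |ψ p.2| * (sqrtM p.2 * |knSource n τ fk k t x₁ x₂ p.1 p.2|)
        ≤ |ψ p.2| * (sqrtM p.2 * (C * Real.exp (-ζ * p.1))) := by gcongr
      _ = _ := by ring

lemma integrable_mom_eta (hτ : 0 < τ) (hk : IsKnudsen n 𝔟 τ f s fb fk) (k : ℤ)
    (ht : t ∈ Icc 0 τ) {ψ : Vel → ℝ} (hψ : PolyB ψ) :
    IntegrableOn (fun η => mom ψ (knSource n τ fk k t x₁ x₂ η)) (Ioi 0) :=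
  (integrable_mom_knSource hτ hk k ht hψ).integral_prod_left

/-- `Â + 5Ĉ` at the wall is the total mass source. -/
lemma kn0_eq_integral (hτ : 0 < τ) (hk : IsKnudsen n 𝔟 τ f s fb fk) (k : ℤ)
    (ht : t ∈ Icc 0 τ) :
    kn0 n τ s fk k t x₁ x₂ = -s.sgn * ∫ η in Ioi 0, rho (knSource n τ fk k t x₁ x₂ η) := by
  have h1 : IntegrableOn (fun η => rho (knSource n τ fk k t x₁ x₂ η)) (Ioi 0) := by
    simp only [rho_eq_mom]
    exact integrable_mom_eta hτ hk k ht (polyB_const 1)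
  have h2 : IntegrableOn (fun η => theta (knSource n τ fk k t x₁ x₂ η)) (Ioi 0) := by
    simp only [theta_eq_mom]
    exact (integrable_mom_eta hτ hk k ht polyB_energy).const_mul _
  have e1 : (∫ r in Ioi 0, (2 * aHat n τ fk k t x₁ x₂ r + 3 * cHat n τ fk k t x₁ x₂ r))
      = -2 * (∫ η in Ioi 0, rho (knSource n τ fk k t x₁ x₂ η))
        + 3 / 2 * ∫ η in Ioi 0, theta (knSource n τ fk k t x₁ x₂ η) := by
    rw [← integral_const_mul, ← integral_const_mul,
      ← integral_add (h1.const_mul _) (h2.const_mul _)]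
    congr 1; funext r; unfold aHat cHat; ring
  have e2 : (∫ r in Ioi 0, aHat n τ fk k t x₁ x₂ r)
      = -1 * (∫ η in Ioi 0, rho (knSource n τ fk k t x₁ x₂ η))
        + 3 / 2 * ∫ η in Ioi 0, theta (knSource n τ fk k t x₁ x₂ η) := by
    rw [← integral_const_mul, ← integral_const_mul,
      ← integral_add (h1.const_mul _) (h2.const_mul _)]
    congr 1; funext r; unfold aHat; ring
  unfold kn0 AHat CHat
  rw [e1, e2]
  -- The θ contributions of Â and 5Ĉ cancel, and -2ρ + ρ leaves minus the mass source.
  ring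

end Knudsen

end

section

/-! ### The mass flux of the Knudsen layer -/

section Flux

variable {n 𝔟 : ℕ} {τ : ℝ} {f : ℤ → Profile} {s : Side} {fb fk : ℤ → Profile} {t x₁ x₂ η : ℝ}

lemma IsKnudsen.expBdd (hk : IsKnudsen n 𝔟 τ f s fb fk) (i : ℤ) (ht : t ∈ Icc 0 τ) :
    ExpBdd (fk i t x₁ x₂) := by
  obtain ⟨ζ, hζ, C, hC, hb⟩ := hk.bound i
  refine ⟨⟨ζ, hζ, C, hC, fun η hη v => (hb t ht x₁ x₂ η (le_of_lt hη) v).1.trans ?_⟩,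
    fun η hη => hk.measurable_slice i ht (le_of_lt hη)⟩
  exact mul_le_of_le_one_right (by positivity) (inv_pow_le_one v 3)

/-- The normal flux in the Knudsen layer, up to sources free of hydrodynamic moments. -/
lemma IsKnudsen.exists_flux (hf : IsInterior n 𝔟 τ f) (hb : IsViscous n 𝔟 τ f s fb)
    (hk : IsKnudsen n 𝔟 τ f s fb fk) (k : ℤ) (ht : t ∈ Icc 0 τ) :
    ∃ N : ℝ → Vel → ℝ, ExpNull N ∧ ∀ η > 0, ∀ v : Vel, v 2 ≠ 0 →
      v 2 * D3 (Ici 0) (slice (fk k) v) t x₁ x₂ η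
        = s.sgn * (knSource n τ fk k t x₁ x₂ η v + N η v) := by
  have hF : ∀ i, BddM (f i t x₁ x₂ s.pos) := fun i => (hf.wtd i ht s.pos_mem).bddM
  have hB : ∀ i, BddM (fb i t x₁ x₂ 0) := fun i => (hb.wtd i ht self_mem_Ici).bddM
  have hFl : ∀ l ∈ Finset.Icc 1 𝔟, ∀ i, BddM (Dnl (Icc 0 1) l (f i) t x₁ x₂ s.pos) :=
    fun l hl i => ((hf.smooth i).wtd_Dnl uniqueDiffOn_unit
      (by have := (Finset.mem_Icc.1 hl).2; omega) ht s.pos_mem).bddM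
  have hBl : ∀ l ∈ Finset.Icc 1 𝔟, ∀ i, BddM (Dnl (Ici 0) l (fb i) t x₁ x₂ 0) :=
    fun l hl i => ((hb.smooth i).wtd_Dnl uniqueDiffOn_half
      (by have := (Finset.mem_Icc.1 hl).2; omega) ht self_mem_Ici).bddM
  have hK : ∀ i, ExpBdd (fk i t x₁ x₂) := fun i => hk.expBdd i ht
  have h0 : ExpNull fun η => linL (fk k t x₁ x₂ η) := by
    have := (expNull_GamS_const bddM_sqrtM (hK k)).const_mul (-1)
    simp only [neg_one_mul, ← linL_eq] at this
    exact this
  have h1 := ExpNull.sum (Finset.Icc 0 (k - n + 1)) fun i _ =>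
    expNull_GamS_const (hF i) (hK (k - n + 2 - i))
  have h2 := ExpNull.sum (Finset.Icc 1 (k - n + 1)) fun i _ =>
    (expNull_GamS_const (hB i) (hK (k - n + 2 - i))).add
      ((expNull_GamS_mul (hK i) (hK (k - n + 2 - i))).const_mul (1 / 2))
  have h3 := ExpNull.sum (Finset.Icc 1 𝔟) fun l hl =>
    ExpNull.sum (Finset.Icc 0 (k - n + 1 - n * l)) fun i _ =>
      (((expNull_GamS_const (hFl l hl i) (hK (k - n + 2 - n * l - i))).pow_mul l).const_mul
        ((-s.sgn) ^ l / l.factorial))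
  have h4 := ExpNull.sum (Finset.Icc 1 𝔟) fun l hl =>
    ExpNull.sum (Finset.Icc 1 (k - n + 1 - (n - 1) * l)) fun i _ =>
      (((expNull_GamS_const (hBl l hl i) (hK (k - n + 2 - (n - 1) * l - i))).pow_mul l).const_mul
        (1 / l.factorial))
  -- N is L f̂_k minus all quadratic collision terms, the Knudsen equation being taken at index k-n;
  -- the rest is the source.
  refine ⟨_, h0.add ((((h1.add h2).add h3).add h4).const_mul (-1)), fun η hη v hv => ?_⟩
  have e := hk.eqn (k - n) t ht x₁ x₂ η hη v hv
  have e3 : ∀ l : ℕ, ∀ x : ℝ, (-s.sgn * η) ^ l / l.factorial * x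
      = (-s.sgn) ^ l / l.factorial * (η ^ l * x) := fun l x => by rw [mul_pow]; ring
  have e4 : ∀ l : ℕ, ∀ x : ℝ, η ^ l / l.factorial * x = 1 / l.factorial * (η ^ l * x) :=
    fun l x => by ring
  simp only [e3, e4, sub_add_cancel] at e
  have i1 : k + 2 - 2 * n = k - n + 2 - n := by ring
  unfold knSource
  rw [i1]
  have hs := s.sgn_mul_self
  linear_combination (-s.sgn) * e - (v 2 * D3 (Ici 0) (slice (fk k) v) t x₁ x₂ η) * hs

/-- Grazing velocities form a proper subspace. Being null, they do not affect moments, although the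
Knudsen equation and the specular condition say nothing there. -/
lemma ae_coord_ne_zero : ∀ᵐ v : Vel, v 2 ≠ 0 := by
  have h := Measure.addHaar_submodule (volume : Measure Vel)
    (LinearMap.ker (EuclideanSpace.proj (2 : Fin 3) : Vel →L[ℝ] ℝ).toLinearMap) fun h => by
      have : (EuclideanSpace.single (2 : Fin 3) (1 : ℝ) : Vel) ∈ (⊤ : Submodule ℝ Vel) := trivial
      rw [← h, LinearMap.mem_ker] at this
      simp at this
  rw [ae_iff]
  refine measure_mono_null (fun v hv => ?_) h
  simpa using hv

lemma IsKnudsen.hasDerivAt (hk : IsKnudsen n 𝔟 τ f s fb fk) (k : ℤ) (ht : t ∈ Icc 0 τ)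
    (hη : 0 < η) {v : Vel} (hv : v 2 ≠ 0) :
    HasDerivAt (fun r => fk k t x₁ x₂ r v) (D3 (Ici 0) (slice (fk k) v) t x₁ x₂ η) η := by
  have h := ((hk.normal k t ht x₁ x₂ v hv).2 η hη).differentiableAt (Ioi_mem_nhds hη)
  have e : D3 (Ici 0) (slice (fk k) v) t x₁ x₂ η = deriv (fun r => fk k t x₁ x₂ r v) η :=
    derivWithin_of_mem_nhds (Ici_mem_nhds hη)
  rw [e]
  exact h.hasDerivAt

lemma ae_layMeas_ne : ∀ᵐ p ∂layMeas, 0 < p.1 ∧ p.2 2 ≠ 0 :=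
  ae_layMeas.and (Measure.quasiMeasurePreserving_snd.ae ae_coord_ne_zero)

lemma IsKnudsen.aestronglyMeasurable_D3 (hk : IsKnudsen n 𝔟 τ f s fb fk) (k : ℤ)
    (ht : t ∈ Icc 0 τ) : AEStronglyMeasurable
      (fun p : ℝ × Vel => D3 (Ici 0) (slice (fk k) p.2) t x₁ x₂ p.1) layMeas := by
  -- The η-derivative is a derivative in the shift r at r = 0. Shifts r ≥ 0 keep η + r inside the
  -- layer.
  refine aestronglyMeasurable_of_hasDerivWithinAt (t := 0) (S := Ici 0)
    (F := fun r (p : ℝ × Vel) => fk k t x₁ x₂ (max (p.1 + r) 0) p.2)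
    (mem_closure_diff uniqueDiffOn_half self_mem_Ici) self_mem_Ici (fun r _ => ?_) ?_
  · exact (hk.measurable_val k ht).comp (by fun_prop :
      Measurable fun p : ℝ × Vel => (((x₁, x₂), (p.1 + r, p.2)) : (ℝ × ℝ) × (ℝ × Vel)))
  · filter_upwards [ae_layMeas_ne] with p hp
    have h := hk.hasDerivAt (x₁ := x₁) (x₂ := x₂) k ht (η := p.1 + 0) (by simpa using hp.1) hp.2
    have h' := (h.comp_const_add p.1 0).hasDerivWithinAt (s := Ici 0)
    rw [add_zero] at h'
    refine h'.congr (fun r hr => ?_) ?_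
    · have : 0 ≤ p.1 + r := add_nonneg hp.1.le hr
      simp only [max_eq_left this]
    · simp only [add_zero, max_eq_left hp.1.le]

lemma polyB_knSource (hτ : 0 < τ) (hk : IsKnudsen n 𝔟 τ f s fb fk) (k : ℤ)
    (ht : t ∈ Icc 0 τ) (hη : 0 ≤ η) : PolyB (knSource n τ fk k t x₁ x₂ η) := by
  obtain ⟨ζ, hζ, C, hC, hb⟩ := knSource_bound hk k
  have hm := (measurable_knSource hτ hk k ht).comp
    (by fun_prop : Measurable fun v : Vel => (((x₁, x₂), (η, v)) : (ℝ × ℝ) × (ℝ × Vel)))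
  simp only [Function.comp_def, max_eq_left hη] at hm
  exact ⟨hm, C * Real.exp (-ζ * η), 0, by positivity, fun v => by
    simpa using hb t ht x₁ x₂ η hη v⟩

/-- The mass flux of the Knudsen layer at the wall. -/
lemma IsKnudsen.vel_wall (hτ : 0 < τ) (hf : IsInterior n 𝔟 τ f) (hb : IsViscous n 𝔟 τ f s fb)
    (hk : IsKnudsen n 𝔟 τ f s fb fk) (k : ℤ) (ht : t ∈ Icc 0 τ) :
    vel 2 (fk k t x₁ x₂ 0) = kn0 n τ s fk k t x₁ x₂ := by
  obtain ⟨N, ⟨⟨ζ', hζ', C', hC', hN⟩, hN0⟩, hflux⟩ := hk.exists_flux (x₁ := x₁) (x₂ := x₂) hf hb k ht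
  obtain ⟨ζ, hζ, C, hC, hS⟩ := knSource_bound hk k
  have hsgn : |s.sgn| = 1 := by cases s <;> simp [Side.sgn]
  set D : ℝ × Vel → ℝ := fun p => sqrtM p.2 * (p.2 2 * D3 (Ici 0) (slice (fk k) p.2) t x₁ x₂ p.1)
    with hD
  -- There is no assumed bound on ∂_η f̂, but the equation expresses v₃∂_η f̂ by terms that decay
  -- exponentially, which justifies Fubini.
  have hI : Integrable D layMeas := by
    refine integrable_layMeas (ζ := min ζ ζ') (C := C + C') (ψ := fun v => 1 + ‖v‖) ?_ (lt_min hζ hζ')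
      ⟨by fun_prop, 1, 1, zero_le_one, fun v => by
        rw [abs_of_nonneg (by positivity)]; simp⟩ ?_
    · exact (continuous_sqrtM.measurable.comp measurable_snd).aestronglyMeasurable.mul
        ((by fun_prop : Measurable fun p : ℝ × Vel => p.2 2).aestronglyMeasurable.mul
          (hk.aestronglyMeasurable_D3 k ht))
    · filter_upwards [ae_layMeas_ne] with p hp
      have h1 := hS t ht x₁ x₂ p.1 hp.1.le p.2
      have h2 := hN p.1 hp.1 p.2
      have e1 := exp_neg_mul_le (min_le_left ζ ζ') hp.1.le
      have e2 := exp_neg_mul_le (min_le_right ζ ζ') hp.1.le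
      have hn := norm_nonneg p.2
      simp only [hD]
      rw [hflux p.1 hp.1 p.2 hp.2, abs_mul, abs_mul, hsgn, one_mul, abs_of_pos (sqrtM_pos _)]
      have h3 : |knSource n τ fk k t x₁ x₂ p.1 p.2 + N p.1 p.2|
          ≤ (C + C') * Real.exp (-(min ζ ζ') * p.1) * (1 + ‖p.2‖) :=
        calc _ ≤ |knSource n τ fk k t x₁ x₂ p.1 p.2| + |N p.1 p.2| := abs_add_le _ _
          _ ≤ C * Real.exp (-ζ * p.1) * 1 + C' * Real.exp (-ζ' * p.1) * (1 + ‖p.2‖) := by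
              rw [mul_one]; exact add_le_add h1 h2
          _ ≤ C * Real.exp (-(min ζ ζ') * p.1) * (1 + ‖p.2‖)
              + C' * Real.exp (-(min ζ ζ') * p.1) * (1 + ‖p.2‖) := by
              gcongr; linarith
          _ = _ := by ring
      calc _ ≤ sqrtM p.2 * ((C + C') * Real.exp (-(min ζ ζ') * p.1) * (1 + ‖p.2‖)) :=
            mul_le_mul_of_nonneg_left h3 (sqrtM_pos _).le
        _ = _ := by ring
  have hswap := integral_integral_swap (f := fun η v => D (η, v)) hI
  -- In one order of integration the η-integral telescopes to the wall value; in the other the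
  -- v-integral leaves only the mass source.
  have hR : (∫ v : Vel, ∫ η in Ioi 0, D (η, v)) = -vel 2 (fk k t x₁ x₂ 0) := by
    rw [vel, ← integral_neg]
    refine integral_congr_ae ?_
    filter_upwards [ae_coord_ne_zero, hI.prod_left_ae] with v hv hi
    have hc := ((hk.normal k t ht x₁ x₂ v hv).1 0 self_mem_Ici)
    obtain ⟨ζ₁, hζ₁, C₁, hC₁, hb₁⟩ := hk.bound k
    have hlim : Filter.Tendsto (fun η => fk k t x₁ x₂ η v) Filter.atTop (nhds 0) := by
      have h0 : Filter.Tendsto (fun η : ℝ => C₁ * Real.exp (-ζ₁ * η)) Filter.atTop (nhds 0) := by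
        have := (Real.tendsto_exp_atBot.comp
          (Filter.tendsto_id.const_mul_atTop_of_neg (neg_lt_zero.2 hζ₁))).const_mul C₁
        simpa using this
      refine squeeze_zero_norm' ?_ h0
      filter_upwards [Filter.eventually_ge_atTop 0] with η hη
      exact (hb₁ t ht x₁ x₂ η hη v).1.trans
        (mul_le_of_le_one_right (by positivity) (inv_pow_le_one v 3))
    have := integral_Ioi_of_hasDerivAt_of_tendsto
      (f := fun η => sqrtM v * (v 2 * fk k t x₁ x₂ η v)) (a := 0) (m := sqrtM v * (v 2 * 0))
      ((hc.const_mul (v 2)).const_mul (sqrtM v))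
      (fun η hη => ((hk.hasDerivAt k ht hη hv).const_mul (v 2)).const_mul (sqrtM v)) hi
      ((hlim.const_mul (v 2)).const_mul (sqrtM v))
    rw [this]; ring
  have hL : (∫ η in Ioi 0, ∫ v : Vel, D (η, v))
      = s.sgn * ∫ η in Ioi 0, rho (knSource n τ fk k t x₁ x₂ η) := by
    rw [← integral_const_mul]
    refine setIntegral_congr_fun measurableSet_Ioi fun η hη => ?_
    have h1 : (∫ v : Vel, D (η, v)) = mom (fun _ => 1) fun v =>
        s.sgn * (knSource n τ fk k t x₁ x₂ η v + N η v) := by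
      refine integral_congr_ae ?_
      filter_upwards [ae_coord_ne_zero] with v hv
      simp only [hD]
      rw [hflux η hη v hv, one_mul]
    simp only [h1]
    rw [mom_const_mul, mom_add (polyB_const 1) (polyB_knSource hτ hk k ht (le_of_lt hη)) (hN0 η hη).1,
      (hN0 η hη).2 _ (polyB_const 1) (collInv_const 1), add_zero, rho_eq_mom]
  rw [hR, hL] at hswap
  rw [kn0_eq_integral hτ hk k ht]
  linarith

end Flux

end

section

/-! ### The Knudsen correction of the normal velocity -/

section KnudsenFlux

variable {n 𝔟 : ℕ} {τ : ℝ} {f : ℤ → Profile} {s : Side} {fb fk : ℤ → Profile} {t x₁ x₂ η : ℝ}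

lemma IsKnudsen.continuousOn_vel (hk : IsKnudsen n 𝔟 τ f s fb fk) (k : ℤ) :
    ContinuousOn (fun p : ℝ × ℝ × ℝ => vel 2 (fk k p.1 p.2.1 p.2.2 0))
      (Icc 0 τ ×ˢ univ ×ˢ univ) := by
  obtain ⟨ζ, hζ, C, hC, hb⟩ := hk.bound k
  refine continuousOn_of_dominated (bound := fun v => C * (sqrtM v * 1)) (fun p hp => ?_)
    (fun p hp => .of_forall fun v => ?_) ((polyB_const 1).integrable.const_mul C)
    (.of_forall fun v => ?_)
  · exact ((polyB_coord 2).1.mul (continuous_sqrtM.measurable.mul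
      (hk.measurable_slice k hp.1 le_rfl))).aestronglyMeasurable
  · have h := (hb p.1 hp.1 p.2.1 p.2.2 0 self_mem_Ici v).1
    rw [mul_zero, Real.exp_zero, mul_one] at h
    rw [Real.norm_eq_abs, abs_mul, abs_mul, abs_of_pos (sqrtM_pos v)]
    have hs := (sqrtM_pos v).le
    calc |v 2| * (sqrtM v * |fk k p.1 p.2.1 p.2.2 0 v|)
        ≤ ‖v‖ * (sqrtM v * (C * ((1 + ‖v‖) ^ 3)⁻¹)) := by
          gcongr
          exact abs_coord_le v 2
      _ = C * (sqrtM v * (‖v‖ * ((1 + ‖v‖) ^ 3)⁻¹)) := by ring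
      _ ≤ C * (sqrtM v * 1) := by
          gcongr
          exact norm_mul_inv_le v
  · exact ((hk.smooth k 0 self_mem_Ici v).continuousOn.const_mul _).const_mul _

/-- K_k involves derivatives of f̂, but by the flux identity it equals the normal momentum of f̂_k
at the wall, which involves none; continuity follows by domination. -/
lemma IsKnudsen.continuousOn_kn0 (hτ : 0 < τ) (hf : IsInterior n 𝔟 τ f)
    (hb : IsViscous n 𝔟 τ f s fb) (hk : IsKnudsen n 𝔟 τ f s fb fk) (k : ℤ) :
    ContinuousOn (fun p : ℝ × ℝ × ℝ => kn0 n τ s fk k p.1 p.2.1 p.2.2)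
      (Icc 0 τ ×ˢ univ ×ˢ univ) :=
  (hk.continuousOn_vel k).congr fun _ hp => (hk.vel_wall hτ hf hb k hp.1).symm

/-- Both indices of the source, k+2-2n and k-n, are then nonpositive. -/
lemma IsKnudsen.kn0_eq_zero (hn : 2 ≤ n) (hk : IsKnudsen n 𝔟 τ f s fb fk) {k : ℤ} (hkn : k ≤ n) :
    kn0 n τ s fk k t x₁ x₂ = 0 := by
  have h : ∀ η, knSource n τ fk k t x₁ x₂ η = fun _ => 0 := fun η => by
    funext v
    rw [knSource, hk.nonpos _ (by omega), hk.nonpos _ (by omega), Dt_slice_zero,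
      tangTransport_zero, add_zero]
  simp [kn0, AHat, CHat, aHat, cHat, h, rho, theta]

lemma continuous_of_continuousOn_slab {F : ℝ → ℝ → ℝ → ℝ}
    (h : ContinuousOn (fun p : ℝ × ℝ × ℝ => F p.1 p.2.1 p.2.2) (Icc 0 τ ×ˢ univ ×ˢ univ))
    (ht : t ∈ Icc 0 τ) : Continuous fun x : ℝ × ℝ => F t x.1 x.2 :=
  h.comp_continuous (f := fun x : ℝ × ℝ => (t, x.1, x.2)) (by fun_prop)
    fun _ => ⟨ht, trivial, trivial⟩

/-- Without time derivative, the Knudsen correction has mean zero on the torus. -/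
lemma IsKnudsen.intT_kn0 (hτ : 0 < τ) (hf : IsInterior n 𝔟 τ f)
    (hb : IsViscous n 𝔟 τ f s fb) (hk : IsKnudsen n 𝔟 τ f s fb fk) {k : ℤ}
    (hkn : k + 2 - 2 * n ≤ 0) (ht : t ∈ Icc 0 τ) : intT (kn0 n τ s fk k t) = 0 := by
  obtain ⟨ζ, hζ, C, hC, hS⟩ := knSource_bound hk k
  rw [intT_eq (integrable_nu2
    (continuous_of_continuousOn_slab (hk.continuousOn_kn0 hτ hf hb k) ht))]
  set G : (ℝ × ℝ) × (ℝ × Vel) → ℝ := fun q =>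
    sqrtM q.2.2 * knSource n τ fk k t q.1.1 q.1.2 (max q.2.1 0) q.2.2 with hG
  have e1 : ∀ x : ℝ × ℝ, kn0 n τ s fk k t x.1 x.2 = -s.sgn * ∫ p, G (x, p) ∂layMeas := fun x => by
    have hi := integrable_mom_knSource (x₁ := x.1) (x₂ := x.2) hτ hk k ht (polyB_const 1)
    rw [kn0_eq_integral hτ hk k ht]
    congr 1
    have h2 : ∫ p, G (x, p) ∂layMeas = ∫ p : ℝ × Vel, (fun _ => (1 : ℝ)) p.2 *
        (sqrtM p.2 * knSource n τ fk k t x.1 x.2 p.1 p.2) ∂layMeas := by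
      refine integral_congr_ae ?_
      filter_upwards [ae_layMeas] with p hp
      simp only [hG, max_eq_left hp.le, one_mul]
    rw [h2, integral_prod _ hi]
    simp only [rho, one_mul]
  have hmG : Measurable G :=
    (continuous_sqrtM.measurable.comp (measurable_snd.comp measurable_snd)).mul
      (measurable_knSource hτ hk k ht)
  have hGi : Integrable G (nu2.prod layMeas) := by
    have h0 : Integrable (fun q : (ℝ × ℝ) × (ℝ × Vel) =>
        C * ((1 : ℝ) * (Real.exp (-ζ * q.2.1) * (sqrtM q.2.2 * 1)))) (nu2.prod layMeas) :=
      ((integrable_const (1 : ℝ)).mul_prod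
        ((integrable_exp_Ioi hζ).mul_prod (polyB_const 1).integrable)).const_mul C
    refine h0.mono' hmG.aestronglyMeasurable ?_
    filter_upwards [Measure.quasiMeasurePreserving_snd.ae ae_layMeas] with q hq
    have hs := (sqrtM_pos q.2.2).le
    rw [Real.norm_eq_abs, hG]
    simp only [max_eq_left hq.le]
    rw [abs_mul, abs_of_pos (sqrtM_pos _)]
    calc _ ≤ sqrtM q.2.2 * (C * Real.exp (-ζ * q.2.1)) := by
          gcongr; exact hS t ht _ _ _ hq.le _
      _ = _ := by ring
  simp only [e1]
  rw [integral_const_mul, integral_integral_swap (f := fun x p => G (x, p)) hGi]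
  -- Once the torus integral is innermost, only v_∥·∇_∥ f̂_{k-n} is left in the source, and it
  -- integrates to zero by periodicity.
  have e2 : ∀ p : ℝ × Vel, ∫ x, G (x, p) ∂nu2 = 0 := fun p => by
    have hc := hk.c1 (k - n) (le_max_zero p.1) p.2
    have c1 := continuous_slice_of_continuousOn
      (hc.continuousOn_Dd hτ uniqueDiffOn_univ 1) ht (mem_univ 0)
    have c2 := continuous_slice_of_continuousOn
      (hc.continuousOn_Dd hτ uniqueDiffOn_univ 2) ht (mem_univ 0)
    have z1 : ∫ x : ℝ × ℝ, D1 (slice (fk (k - n)) p.2) t x.1 x.2 (max p.1 0) ∂nu2 = 0 :=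
      integral_nu2_d1 (g := fun x₁ x₂ => fk (k - n) t x₁ x₂ (max p.1 0) p.2)
        (fun x₁ x₂ => (hk.periodic _ t x₁ x₂ _ _).1)
        (fun x₁ x₂ => hc.hasDerivAt_D1 hτ uniqueDiffOn_univ ht (mem_univ 0)) c1
    have z2 : ∫ x : ℝ × ℝ, D2 (slice (fk (k - n)) p.2) t x.1 x.2 (max p.1 0) ∂nu2 = 0 :=
      integral_nu2_d2 (g := fun x₁ x₂ => fk (k - n) t x₁ x₂ (max p.1 0) p.2)
        (fun x₁ x₂ => (hk.periodic _ t x₁ x₂ _ _).2)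
        (fun x₁ x₂ => hc.hasDerivAt_D2 hτ uniqueDiffOn_univ ht (mem_univ 0)) c2
    have i1 : Integrable (fun x : ℝ × ℝ => D1 (slice (fk (k - n)) p.2) t x.1 x.2 (max p.1 0)) nu2 :=
      integrable_nu2 c1
    have i2 : Integrable (fun x : ℝ × ℝ => D2 (slice (fk (k - n)) p.2) t x.1 x.2 (max p.1 0)) nu2 :=
      integrable_nu2 c2
    simp only [hG, knSource, tangTransport]
    rw [hk.nonpos _ hkn]
    simp only [Dt_slice_zero, zero_add]
    rw [integral_const_mul, integral_add (i1.const_mul _) (i2.const_mul _), integral_const_mul,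
      integral_const_mul, z1, z2]
    simp
  simp only [e2, integral_zero, mul_zero]

end KnudsenFlux

end

section

/-! ### Decaying fields on a layer -/

/-- Continuity on `[0, τ] × 𝕋²`. -/
abbrev SlabCont (τ : ℝ) (g : ℝ → ℝ → ℝ → ℝ) : Prop :=
  ContinuousOn (fun p : ℝ × ℝ × ℝ => g p.1 p.2.1 p.2.2) (Icc 0 τ ×ˢ univ ×ˢ univ)

/-- Continuous fields on the layer that are `O((1+y)^{-2})`. -/
def Tail (τ : ℝ) (F : Field) : Prop :=
  ContinuousOn F.unc (Dom τ (Ici 0)) ∧ ∃ C : ℝ, 0 ≤ C ∧ ∀ t ∈ Icc 0 τ, ∀ x₁ x₂ : ℝ,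
    ∀ y ∈ Ici (0 : ℝ), |F t x₁ x₂ y| ≤ C * ((1 + y) ^ 2)⁻¹

/-- Integration across the layer. -/
def layInt (F : Field) (t x₁ x₂ : ℝ) : ℝ := ∫ y in Ioi (0 : ℝ), F t x₁ x₂ y

/-- Lebesgue measure on the half line. -/
abbrev half : Measure ℝ := volume.restrict (Ioi 0)

lemma integrable_half_sq : Integrable (fun y : ℝ => ((1 + y) ^ 2)⁻¹) half := by
  have h := (integrable_one_add_norm (E := ℝ) (μ := volume) (r := 2) (by simp)).restrict (s := Ioi 0)
  refine h.congr ((ae_restrict_mem measurableSet_Ioi).mono fun y hy => ?_)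
  have hy' : 0 < y := hy
  simp only
  rw [Real.rpow_neg (by positivity), Real.norm_of_nonneg hy'.le]
  norm_cast

lemma ae_half : ∀ᵐ y ∂half, y ∈ Ici (0 : ℝ) :=
  (ae_restrict_mem measurableSet_Ioi).mono fun _ hy => Ioi_subset_Ici_self hy

variable {τ t : ℝ} {F G : Field}

lemma Tail.add (hF : Tail τ F) (hG : Tail τ G) : Tail τ fun t x₁ x₂ y => F t x₁ x₂ y + G t x₁ x₂ y := by
  obtain ⟨c, C, hC, h⟩ := hF
  obtain ⟨c', C', hC', h'⟩ := hG
  refine ⟨c.add c', C + C', by positivity, fun t ht x₁ x₂ y hy => ?_⟩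
  rw [add_mul]
  exact (abs_add_le _ _).trans (add_le_add (h t ht x₁ x₂ y hy) (h' t ht x₁ x₂ y hy))

lemma Tail.continuousOn_slice (hF : Tail τ F) (ht : t ∈ Icc 0 τ) (x₁ x₂ : ℝ) :
    ContinuousOn (F t x₁ x₂) (Ici 0) :=
  hF.1.comp (f := fun y : ℝ => (t, x₁, x₂, y)) (by fun_prop) fun _ hy => ⟨ht, trivial, trivial, hy⟩

lemma Tail.integrable (hF : Tail τ F) (ht : t ∈ Icc 0 τ) (x₁ x₂ : ℝ) :
    Integrable (F t x₁ x₂) half := by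
  obtain ⟨C, hC, h⟩ := hF.2
  exact (integrable_half_sq.const_mul C).mono'
    (((hF.continuousOn_slice ht x₁ x₂).mono Ioi_subset_Ici_self).aestronglyMeasurable
      measurableSet_Ioi)
    (ae_half.mono fun y hy => h t ht x₁ x₂ y hy)

lemma Tail.slabCont (hF : Tail τ F) : SlabCont τ (layInt F) := by
  obtain ⟨C, hC, h⟩ := hF.2
  refine continuousOn_of_dominated (μ := half) (bound := fun y => C * ((1 + y) ^ 2)⁻¹)
    (fun p hp => (hF.integrable hp.1 p.2.1 p.2.2).aestronglyMeasurable)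
    (fun p hp => ae_half.mono fun y hy => h p.1 hp.1 p.2.1 p.2.2 y hy)
    (integrable_half_sq.const_mul C) (ae_half.mono fun y hy => ?_)
  exact hF.1.comp (f := fun p : ℝ × ℝ × ℝ => (p.1, p.2.1, p.2.2, y)) (by fun_prop)
    fun p hp => ⟨hp.1, trivial, trivial, hy⟩

lemma layInt_add (hF : Tail τ F) (hG : Tail τ G) (ht : t ∈ Icc 0 τ) (x₁ x₂ : ℝ) :
    layInt (fun t x₁ x₂ y => F t x₁ x₂ y + G t x₁ x₂ y) t x₁ x₂ = layInt F t x₁ x₂ + layInt G t x₁ x₂ :=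
  integral_add (hF.integrable ht x₁ x₂) (hG.integrable ht x₁ x₂)

/-- Fundamental theorem of calculus in time on the layer. -/
lemma layInt_sub_eq (hτ : 0 < τ) {q : Field} (hq : C1Field τ (Ici 0) q) (hT : Tail τ q)
    (hF : Tail τ (Dt τ q)) (ht : t ∈ Icc 0 τ) (x₁ x₂ : ℝ) :
    layInt q t x₁ x₂ - layInt q 0 x₁ x₂ = ∫ r in (0 : ℝ)..t, layInt (Dt τ q) r x₁ x₂ := by
  obtain ⟨C, hC, h⟩ := hF.2
  have h0 : (0 : ℝ) ∈ Icc 0 τ := ⟨le_rfl, hτ.le⟩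
  rw [layInt, layInt, ← integral_sub (hT.integrable ht x₁ x₂) (hT.integrable h0 x₁ x₂)]
  refine integral_sub_eq_integral_integral (q := fun r y => q r x₁ x₂ y) ht.1
    (ae_half.mono fun y hy => hq.sub_eq_integral_Dt hτ uniqueDiffOn_half ht hy) ?_
  have hm : AEStronglyMeasurable (Function.uncurry fun r y => Dt τ q r x₁ x₂ y)
      ((volume.restrict (Ioc 0 t)).prod half) := by
    rw [Measure.prod_restrict]
    refine ContinuousOn.aestronglyMeasurable ?_ (measurableSet_Ioc.prod measurableSet_Ioi)
    exact hF.1.comp (f := fun p : ℝ × ℝ => (p.1, x₁, x₂, p.2)) (by fun_prop)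
      fun p hp => ⟨⟨hp.1.1.le, hp.1.2.trans ht.2⟩, trivial, trivial, Ioi_subset_Ici_self hp.2⟩
  refine (((integrable_const (1 : ℝ)).mul_prod integrable_half_sq).const_mul C).mono' hm ?_
  filter_upwards [Measure.quasiMeasurePreserving_snd.ae ae_half,
    Measure.quasiMeasurePreserving_fst.ae (ae_restrict_mem measurableSet_Ioc)] with p hp hp'
  rw [one_mul]
  exact h p.1 ⟨hp'.1.le, hp'.2.trans ht.2⟩ x₁ x₂ p.2 hp

lemma SlabCont.intT_eq {g : ℝ → ℝ → ℝ → ℝ} (h : SlabCont τ g) (ht : t ∈ Icc 0 τ) :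
    Integrable (fun x : ℝ × ℝ => g t x.1 x.2) nu2 ∧ intT (g t) = ∫ x, g t x.1 x.2 ∂nu2 := by
  have := integrable_nu2 (continuous_of_continuousOn_slab h ht)
  exact ⟨this, EulerLimit.intT_eq this⟩

lemma SlabCont.intT_add {g h : ℝ → ℝ → ℝ → ℝ} (hg : SlabCont τ g) (hh : SlabCont τ h)
    (ht : t ∈ Icc 0 τ) :
    intT (fun x₁ x₂ => g t x₁ x₂ + h t x₁ x₂) = intT (g t) + intT (h t) := by
  obtain ⟨i, e⟩ := hg.intT_eq ht
  obtain ⟨i', e'⟩ := hh.intT_eq ht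
  rw [e, e', ← integral_add i i']
  exact EulerLimit.intT_eq (i.add i')

lemma SlabCont.intT_const_mul {g : ℝ → ℝ → ℝ → ℝ} (hg : SlabCont τ g) (a : ℝ) (ht : t ∈ Icc 0 τ) :
    intT (fun x₁ x₂ => a * g t x₁ x₂) = a * intT (g t) := by
  obtain ⟨i, e⟩ := hg.intT_eq ht
  rw [e, ← integral_const_mul]
  exact EulerLimit.intT_eq (i.const_mul a)

lemma SlabCont.intT_sub {g h : ℝ → ℝ → ℝ → ℝ} (hg : SlabCont τ g) (hh : SlabCont τ h)
    (ht : t ∈ Icc 0 τ) :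
    intT (fun x₁ x₂ => g t x₁ x₂ - h t x₁ x₂) = intT (g t) - intT (h t) := by
  obtain ⟨i, e⟩ := hg.intT_eq ht
  obtain ⟨i', e'⟩ := hh.intT_eq ht
  rw [e, e', ← integral_sub i i']
  exact EulerLimit.intT_eq (i.sub i')

lemma SlabCont.continuousOn_intT {g : ℝ → ℝ → ℝ → ℝ} (hg : SlabCont τ g) :
    ContinuousOn (fun t => intT (g t)) (Icc 0 τ) := EulerLimit.continuousOn_intT hg

/-- Fundamental theorem of calculus in time on the torus. -/
lemma SlabCont.intT_sub_eq (hτ : 0 < τ) {Q Q' : ℝ → ℝ → ℝ → ℝ} (hQ : SlabCont τ Q)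
    (hQ' : SlabCont τ Q') (ht : t ∈ Icc 0 τ)
    (h : ∀ x₁ x₂, Q t x₁ x₂ - Q 0 x₁ x₂ = ∫ r in (0 : ℝ)..t, Q' r x₁ x₂) :
    intT (fun x₁ x₂ => Q t x₁ x₂ - Q 0 x₁ x₂) = ∫ r in (0 : ℝ)..t, intT (Q' r) := by
  have h0 : (0 : ℝ) ∈ Icc 0 τ := ⟨le_rfl, hτ.le⟩
  have hi : Integrable (Function.uncurry fun r (x : ℝ × ℝ) => Q' r x.1 x.2)
      ((volume.restrict (Ioc 0 t)).prod nu2) := by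
    have h1 : IntegrableOn (Function.uncurry fun r (x : ℝ × ℝ) => Q' r x.1 x.2)
        (Icc 0 t ×ˢ Icc 0 1 ×ˢ Icc 0 1) volume :=
      (ContinuousOn.mono hQ' (prod_mono (Icc_subset_Icc_right ht.2)
        (prod_mono (subset_univ _) (subset_univ _)))).integrableOn_compact
        (isCompact_Icc.prod (isCompact_Icc.prod isCompact_Icc))
    have h2 := h1.mono_set (prod_mono (Ioc_subset_Icc_self (a := (0 : ℝ)) (b := t))
      (prod_mono (Ioc_subset_Icc_self (a := (0 : ℝ)) (b := 1))
        (Ioc_subset_Icc_self (a := (0 : ℝ)) (b := 1))))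
    rwa [IntegrableOn, Measure.volume_eq_prod, Measure.volume_eq_prod,
      ← Measure.prod_restrict, ← Measure.prod_restrict] at h2
  obtain ⟨i, e⟩ := hQ.intT_eq ht
  obtain ⟨i', e'⟩ := hQ.intT_eq h0
  rw [EulerLimit.intT_eq (g := fun x₁ x₂ => Q t x₁ x₂ - Q 0 x₁ x₂) (i.sub i')]
  rw [integral_sub_eq_integral_integral (q := fun r (x : ℝ × ℝ) => Q r x.1 x.2) ht.1
    (.of_forall fun x => h x.1 x.2) hi]
  refine intervalIntegral.integral_congr fun r hr => ?_
  rw [uIcc_of_le ht.1] at hr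
  exact (hQ'.intT_eq ⟨hr.1, hr.2.trans ht.2⟩).2.symm

lemma Tail.intT_layInt_eq_zero (hF : Tail τ F) (ht : t ∈ Icc 0 τ)
    (h : ∀ y ∈ Ici (0 : ℝ), ∫ x, F t x.1 x.2 y ∂nu2 = 0) : intT (layInt F t) = 0 := by
  obtain ⟨C, hC, hb⟩ := hF.2
  rw [(hF.slabCont.intT_eq ht).2]
  have hi : Integrable (Function.uncurry fun (x : ℝ × ℝ) y => F t x.1 x.2 y) (nu2.prod half) := by
    have hm : AEStronglyMeasurable (Function.uncurry fun (x : ℝ × ℝ) y => F t x.1 x.2 y)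
        (nu2.prod half) := by
      rw [nu2, Measure.prod_restrict, Measure.prod_restrict]
      refine ContinuousOn.aestronglyMeasurable ?_
        ((measurableSet_Ioc.prod measurableSet_Ioc).prod measurableSet_Ioi)
      exact hF.1.comp (f := fun p : (ℝ × ℝ) × ℝ => (t, p.1.1, p.1.2, p.2)) (by fun_prop)
        fun p hp => ⟨ht, trivial, trivial, Ioi_subset_Ici_self hp.2⟩
    refine (((integrable_const (1 : ℝ)).mul_prod integrable_half_sq).const_mul C).mono' hm ?_
    filter_upwards [Measure.quasiMeasurePreserving_snd.ae ae_half] with p hp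
    rw [one_mul]
    exact hb t ht p.1.1 p.1.2 p.2 hp
  refine (integral_integral_swap hi).trans ?_
  rw [integral_congr_ae (ae_half.mono fun y hy => h y hy)]
  simp

/-! ### The viscous layer -/

lemma abs_mom_le {ψ g : Vel → ℝ} (hψ : PolyB ψ) {A : ℝ} (h : ∀ v, |g v| ≤ A) :
    |mom ψ g| ≤ A * ∫ v, |ψ v| * sqrtM v := by
  have hi : Integrable fun v => |ψ v| * sqrtM v := by
    refine (hψ.integrable_mul (polyB_const 1)).abs.congr (.of_forall fun v => ?_)
    simp only [mul_one, abs_mul, abs_of_pos (sqrtM_pos v)]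
  rw [← integral_const_mul, mom, ← Real.norm_eq_abs]
  refine norm_integral_le_of_norm_le (hi.const_mul _) (.of_forall fun v => ?_)
  have h3 := (sqrtM_pos v).le
  rw [Real.norm_eq_abs, abs_mul, abs_mul, abs_of_pos (sqrtM_pos v)]
  calc |ψ v| * (sqrtM v * |g v|) ≤ |ψ v| * (sqrtM v * A) := by gcongr; exact h v
    _ = _ := by ring

section Viscous

variable {n 𝔟 : ℕ} {f : ℤ → Profile} {s : Side} {fb : ℤ → Profile}

lemma IsViscous.bound (hb : IsViscous n 𝔟 τ f s fb) (i : ℤ) :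
    ∃ C : ℝ, 0 ≤ C ∧ ∀ t ∈ Icc 0 τ, ∀ x₁ x₂ : ℝ, ∀ y ∈ Ici (0 : ℝ), ∀ v : Vel,
      |fb i t x₁ x₂ y v| ≤ C * ((1 + y) ^ 2)⁻¹ ∧
      |Dt τ (slice (fb i) v) t x₁ x₂ y| ≤ C * ((1 + y) ^ 2)⁻¹ ∧
      |D1 (slice (fb i) v) t x₁ x₂ y| ≤ C * ((1 + y) ^ 2)⁻¹ ∧
      |D2 (slice (fb i) v) t x₁ x₂ y| ≤ C * ((1 + y) ^ 2)⁻¹ := by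
  obtain ⟨C, h⟩ := hb.decay i
  refine ⟨|C|, abs_nonneg C, fun t ht x₁ x₂ y hy v => ?_⟩
  have h1 := h t ht x₁ x₂ y hy v
  have hy' : 0 ≤ y := hy
  have h2 : C * ((1 + y) ^ 2)⁻¹ * ((1 + ‖v‖) ^ 3)⁻¹ ≤ |C| * ((1 + y) ^ 2)⁻¹ :=
    calc _ ≤ |C| * ((1 + y) ^ 2)⁻¹ * ((1 + ‖v‖) ^ 3)⁻¹ := by gcongr; exact le_abs_self C
      _ ≤ _ := mul_le_of_le_one_right (by positivity) (inv_pow_le_one v 3)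
  have a := abs_nonneg (fb i t x₁ x₂ y v)
  have b := abs_nonneg (Dt τ (slice (fb i) v) t x₁ x₂ y)
  have c := abs_nonneg (D1 (slice (fb i) v) t x₁ x₂ y)
  have d := abs_nonneg (D2 (slice (fb i) v) t x₁ x₂ y)
  refine ⟨?_, ?_, ?_, ?_⟩ <;> linarith

lemma tail_of_mom {q : Field} (hc : ContinuousOn q.unc (Dom τ (Ici 0))) {ψ : Vel → ℝ} (hψ : PolyB ψ)
    {g : ℝ → ℝ → ℝ → ℝ → Vel → ℝ} {C : ℝ} (hC : 0 ≤ C)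
    (h : ∀ t ∈ Icc 0 τ, ∀ x₁ x₂ : ℝ, ∀ y ∈ Ici (0 : ℝ), q t x₁ x₂ y = mom ψ (g t x₁ x₂ y) ∧
      ∀ v, |g t x₁ x₂ y v| ≤ C * ((1 + y) ^ 2)⁻¹) : Tail τ q := by
  have hK : 0 ≤ ∫ v, |ψ v| * sqrtM v :=
    integral_nonneg fun v => mul_nonneg (abs_nonneg _) (sqrtM_pos v).le
  refine ⟨hc, C * ∫ v, |ψ v| * sqrtM v, by positivity, fun t ht x₁ x₂ y hy => ?_⟩
  obtain ⟨e, hb⟩ := h t ht x₁ x₂ y hy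
  rw [e]
  exact (abs_mom_le hψ hb).trans (le_of_eq (by ring))

/-- Moments of a viscous layer profile and their derivatives decay. -/
lemma IsViscous.tail (hτ : 0 < τ) (hb : IsViscous n 𝔟 τ f s fb) (k : ℤ) {ψ : Vel → ℝ}
    (hψ : PolyB ψ) : Tail τ (momF ψ (fb k)) ∧ Tail τ (Dt τ (momF ψ (fb k))) ∧
      Tail τ (D1 (momF ψ (fb k))) ∧ Tail τ (D2 (momF ψ (fb k))) := by
  obtain ⟨C, hC, h⟩ := hb.bound k
  have hc := hb.c1 k hψ
  have hd := hc.continuousOn_Dd hτ uniqueDiffOn_half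
  have hD := fun d t ht x₁ x₂ y hy =>
    ((hb.smooth k).Dd_slice hτ uniqueDiffOn_half d (t := t) (x₁ := x₁) (x₂ := x₂) (z := y) ht hy).2.2 ψ hψ
  exact ⟨tail_of_mom hc.continuousOn hψ hC fun t ht x₁ x₂ y hy =>
      ⟨rfl, fun v => (h t ht x₁ x₂ y hy v).1⟩,
    tail_of_mom (hd 0) hψ hC fun t ht x₁ x₂ y hy =>
      ⟨hD 0 t ht x₁ x₂ y hy, fun v => (h t ht x₁ x₂ y hy v).2.1⟩,
    tail_of_mom (hd 1) hψ hC fun t ht x₁ x₂ y hy =>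
      ⟨hD 1 t ht x₁ x₂ y hy, fun v => (h t ht x₁ x₂ y hy v).2.2.1⟩,
    tail_of_mom (hd 2) hψ hC fun t ht x₁ x₂ y hy =>
      ⟨hD 2 t ht x₁ x₂ y hy, fun v => (h t ht x₁ x₂ y hy v).2.2.2⟩⟩

lemma IsViscous.tail_divPar (hτ : 0 < τ) (hb : IsViscous n 𝔟 τ f s fb) (k : ℤ) :
    Tail τ (divPar (fb k)) :=
  (hb.tail hτ k (polyB_coord 0)).2.2.1.add (hb.tail hτ k (polyB_coord 1)).2.2.2

lemma IsViscous.tail_rho (hτ : 0 < τ) (hb : IsViscous n 𝔟 τ f s fb) (k : ℤ) :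
    Tail τ (rhoF (fb k)) ∧ Tail τ (Dt τ (rhoF (fb k))) := by
  rw [rhoF_eq]
  exact ⟨(hb.tail hτ k (polyB_const 1)).1, (hb.tail hτ k (polyB_const 1)).2.1⟩

/-- The tangential flux has no mean on the torus. -/
lemma IsViscous.intT_divPar (hτ : 0 < τ) (hb : IsViscous n 𝔟 τ f s fb) (k : ℤ)
    (ht : t ∈ Icc 0 τ) : intT (layInt (divPar (fb k)) t) = 0 := by
  refine (hb.tail_divPar hτ k).intT_layInt_eq_zero ht fun y hy => ?_
  have h0 := hb.c1 k (polyB_coord 0)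
  have h1 := hb.c1 k (polyB_coord 1)
  have c0 := continuous_slice_of_continuousOn (h0.continuousOn_Dd hτ uniqueDiffOn_half 1) ht hy
  have c1 := continuous_slice_of_continuousOn (h1.continuousOn_Dd hτ uniqueDiffOn_half 2) ht hy
  unfold divPar
  rw [velF_eq, velF_eq]
  refine (integral_add (integrable_nu2 c0) (integrable_nu2 c1)).trans ?_
  have e0 := integral_nu2_D1 hτ uniqueDiffOn_half h0 ((hb.periodic k).momF _) ht hy
  have e1 := integral_nu2_D2 hτ uniqueDiffOn_half h1 ((hb.periodic k).momF _) ht hy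
  exact (congrArg₂ (· + ·) e0 e1).trans (add_zero 0)

/-- The mass flux of the viscous layer at the wall. -/
lemma IsViscous.vel_wall (hτ : 0 < τ) (hf : IsInterior n 𝔟 τ f) (hb : IsViscous n 𝔟 τ f s fb)
    (k : ℤ) (ht : t ∈ Icc 0 τ) (x₁ x₂ : ℝ) :
    s.sgn * velF 2 (fb k) t x₁ x₂ 0
      = -(layInt (Dt τ (rhoF (fb (k + 1 - n)))) t x₁ x₂ + layInt (divPar (fb (k - 1))) t x₁ x₂) := by
  have hR := (hb.tail_rho hτ (k + 1 - n)).2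
  have hP := hb.tail_divPar hτ (k - 1)
  have hS := hR.add hP
  have hc := hb.c1 k (polyB_coord 2)
  have hd : ∀ y ∈ Ici (0 : ℝ), s.sgn * D3 (Ici 0) (velF 2 (fb k)) t x₁ x₂ y
      = Dt τ (rhoF (fb (k + 1 - n))) t x₁ x₂ y + divPar (fb (k - 1)) t x₁ x₂ y := fun y hy => by
    -- The law is taken at order k-1, because the normal derivative in the viscous equation acts one
    -- order higher.
    have := hb.balance (x₁ := x₁) (x₂ := x₂) hτ hf (polyB_const 1) (collInv_const 1) (k - 1) ht hy
    simp only [one_mul] at this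
    rw [← rhoF_eq, ← velF_eq, ← velF_eq, ← velF_eq, sub_add_cancel,
      show k - 1 + 2 - (n : ℤ) = k + 1 - n by ring] at this
    unfold divPar
    linarith
  have hlim : Filter.Tendsto (fun y => s.sgn * velF 2 (fb k) t x₁ x₂ y) Filter.atTop (nhds (s.sgn * 0)) := by
    obtain ⟨C, hC, h⟩ := (hb.tail hτ k (polyB_coord 2)).1.2
    refine Filter.Tendsto.const_mul _ (squeeze_zero_norm' (a := fun y => C * ((1 + y) ^ 2)⁻¹) ?_ ?_)
    · filter_upwards [Filter.eventually_ge_atTop 0] with y hy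
      exact h t ht x₁ x₂ y hy
    · have h1 : Filter.Tendsto (fun y : ℝ => (1 + y) ^ 2) Filter.atTop Filter.atTop :=
        (Filter.tendsto_pow_atTop two_ne_zero).comp (Filter.tendsto_atTop_add_const_left _ _ Filter.tendsto_id)
      simpa using h1.inv_tendsto_atTop.const_mul C
  have hder : ∀ y ∈ Ici (0 : ℝ), HasDerivWithinAt (fun y => s.sgn * velF 2 (fb k) t x₁ x₂ y)
      (Dt τ (rhoF (fb (k + 1 - n))) t x₁ x₂ y + divPar (fb (k - 1)) t x₁ x₂ y) (Ici 0) y :=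
    fun y hy => by
      rw [← hd y hy]
      exact (hc.hasDerivWithinAt_D3 hτ uniqueDiffOn_half ht hy).const_mul _
  have := integral_Ioi_of_hasDerivAt_of_tendsto (hder 0 self_mem_Ici).continuousWithinAt
    (fun y hy => (hder y (Ioi_subset_Ici_self hy)).hasDerivAt (Ici_mem_nhds hy)) (hS.integrable ht x₁ x₂) hlim
  have e := layInt_add hR hP ht x₁ x₂
  rw [layInt] at e
  rw [← e, this]
  ring

end Viscous

end

section

/-! ### Specular reflection and conservation of mass -/

/-- The specular reflection as a linear isometry. -/
def reflectE : Vel ≃ₗᵢ[ℝ] Vel :=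
  LinearIsometryEquiv.piLpCongrRight 2 fun i : Fin 3 =>
    if i = 2 then LinearIsometryEquiv.neg ℝ else LinearIsometryEquiv.refl ℝ ℝ

lemma reflectE_apply (v : Vel) : reflectE v = reflect v := by
  ext i
  fin_cases i <;> simp [reflectE, reflect]

lemma sqrtM_reflect (v : Vel) : sqrtM (reflect v) = sqrtM v := by
  rw [← reflectE_apply, sqrtM, sqrtM, maxwellian, maxwellian, LinearIsometryEquiv.norm_map]

/-- The normal momentum of a specularly symmetric function vanishes. -/
lemma vel_eq_zero_of_reflect {g : Vel → ℝ} (h : ∀ v : Vel, v 2 ≠ 0 → g v = g (reflect v)) :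
    vel 2 g = 0 := by
  have h1 : vel 2 g = ∫ v : Vel, (reflect v) 2 * (sqrtM (reflect v) * g (reflect v)) := by
    simp only [← reflectE_apply]
    exact (reflectE.measurePreserving.integral_comp
      reflectE.toHomeomorph.measurableEmbedding fun v : Vel => v 2 * (sqrtM v * g v)).symm
  have h2 : (∫ v : Vel, (reflect v) 2 * (sqrtM (reflect v) * g (reflect v))) = -vel 2 g := by
    rw [vel, ← integral_neg]
    refine integral_congr_ae (ae_coord_ne_zero.mono fun v hv => ?_)
    simp only
    rw [sqrtM_reflect, ← h v hv]
    simp [reflect]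
  linarith

section Walls

variable {n 𝔟 : ℕ} {τ : ℝ} {f : ℤ → Profile} {fb fk : Side → ℤ → Profile} {t x₁ x₂ : ℝ}

/-- Under the specular condition, the normal velocity at the wall is the one prescribed by the
boundary layers. -/
lemma SpecularAt.velF_eq_bdryU3 (hτ : 0 < τ) (hf : IsInterior n 𝔟 τ f)
    (hfb : ∀ s, IsViscous n 𝔟 τ f s (fb s)) (hfk : ∀ s, IsKnudsen n 𝔟 τ f s (fb s) (fk s)) {k : ℤ}
    (h : SpecularAt τ f fb fk k) (s : Side) (ht : t ∈ Icc 0 τ) :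
    velF 2 (f k) t x₁ x₂ s.pos = bdryU3 n τ s (fb s) (fk s) k t x₁ x₂ := by
  have h0 := vel_eq_zero_of_reflect (h s t ht x₁ x₂)
  have w1 := (hf.wtd (x₁ := x₁) (x₂ := x₂) k ht s.pos_mem).polyB
  have w2 := ((hfb s).wtd (x₁ := x₁) (x₂ := x₂) k ht (y := 0) self_mem_Ici).polyB
  have w3 := ((hfk s).wtd (x₁ := x₁) (x₂ := x₂) k ht le_rfl).polyB
  rw [vel_eq_mom, mom_add (polyB_coord 2) (w1.add w2) w3, mom_add (polyB_coord 2) w1 w2,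
    ← vel_eq_mom, ← vel_eq_mom, ← vel_eq_mom, (hfk s).vel_wall hτ hf (hfb s) k ht] at h0
  rw [bdryU3, velF, velF]
  linarith

/-- At order 0 the viscous layer is absent and the Knudsen correction is zero, so d_0 = 0. -/
lemma SpecularAt.velF_zero (hn : 2 ≤ n) (hτ : 0 < τ) (hf : IsInterior n 𝔟 τ f)
    (hfb : ∀ s, IsViscous n 𝔟 τ f s (fb s)) (hfk : ∀ s, IsKnudsen n 𝔟 τ f s (fb s) (fk s))
    (h : SpecularAt τ f fb fk 0) (s : Side) (ht : t ∈ Icc 0 τ) :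
    velF 2 (f 0) t x₁ x₂ s.pos = 0 := by
  rw [h.velF_eq_bdryU3 hτ hf hfb hfk s ht, bdryU3, (hfk s).kn0_eq_zero hn (by omega),
    (hfb s).nonpos 0 le_rfl, velF_eq, momF_zero]
  simp

end Walls

/-! ### Conservation laws integrated over the channel -/

section Balance

variable {τ t : ℝ}

lemma intO_neg (g : ℝ → ℝ → ℝ → ℝ) : intO (fun x₁ x₂ x₃ => -g x₁ x₂ x₃) = -intO g := by
  simp [intO]

/-- Integrated conservation law. -/
lemma intO_balance (hτ : 0 < τ) {q₀ q₁ q₂ q₃ : Field} (c₀ : C1Field τ (Icc 0 1) q₀)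
    (c₁ : C1Field τ (Icc 0 1) q₁) (c₂ : C1Field τ (Icc 0 1) q₂) (c₃ : C1Field τ (Icc 0 1) q₃)
    (p₁ : PerF q₁) (p₂ : PerF q₂) (ht : t ∈ Icc 0 τ)
    (h : ∀ x₁ x₂, ∀ z ∈ Icc (0 : ℝ) 1, Dt τ q₀ t x₁ x₂ z + D1 q₁ t x₁ x₂ z + D2 q₂ t x₁ x₂ z
      + D3 (Icc 0 1) q₃ t x₁ x₂ z = 0) :
    intO (Dt τ q₀ t) = -intT fun x₁ x₂ => q₃ t x₁ x₂ 1 - q₃ t x₁ x₂ 0 := by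
  obtain ⟨i₀, e₀⟩ := c₀.intO_Dd_eq hτ 0 ht
  obtain ⟨i₁, e₁⟩ := c₁.intO_Dd_eq hτ 1 ht
  obtain ⟨i₂, e₂⟩ := c₂.intO_Dd_eq hτ 2 ht
  obtain ⟨i₃, e₃⟩ := c₃.intO_Dd_eq hτ 3 ht
  have z₁ := intO_D1 hτ c₁ p₁ ht
  have z₂ := intO_D2 hτ c₂ p₂ ht
  have z₃ := intO_D3 hτ c₃ ht
  change intO (Dd τ (Icc 0 1) 1 q₁ t) = 0 at z₁
  change intO (Dd τ (Icc 0 1) 2 q₂ t) = 0 at z₂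
  change intO (Dd τ (Icc 0 1) 3 q₃ t) = _ at z₃
  have hs : ∫ x : ℝ × ℝ × ℝ, (Dd τ (Icc 0 1) 0 q₀ t x.1 x.2.1 x.2.2
      + Dd τ (Icc 0 1) 1 q₁ t x.1 x.2.1 x.2.2 + Dd τ (Icc 0 1) 2 q₂ t x.1 x.2.1 x.2.2
      + Dd τ (Icc 0 1) 3 q₃ t x.1 x.2.1 x.2.2) ∂nu3 = 0 := by
    exact (integral_congr_ae (ae_nu3.mono fun x hx => h x.1 x.2.1 x.2.2 hx)).trans
      (integral_zero _ _)
  have a₁ := integral_add ((i₀.add i₁).add i₂) i₃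
  have a₂ := integral_add (i₀.add i₁) i₂
  have a₃ := integral_add i₀ i₁
  simp only [Pi.add_apply] at a₁ a₂ a₃
  change intO (Dd τ (Icc 0 1) 0 q₀ t) = _
  linarith

variable {n 𝔟 : ℕ} {f : ℤ → Profile}

/-- Conservation of collision invariants over the channel. -/
lemma IsInterior.intO_Dt (hτ : 0 < τ) (hf : IsInterior n 𝔟 τ f) {φ : Vel → ℝ} (hφ : PolyB φ)
    (iφ : CollInv φ) (k : ℤ) (ht : t ∈ Icc 0 τ) :
    intO (Dt τ (momF φ (f (k + 2 - n))) t)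
      = -intT fun x₁ x₂ => momF (fun v => φ v * v 2) (f k) t x₁ x₂ 1
        - momF (fun v => φ v * v 2) (f k) t x₁ x₂ 0 :=
  intO_balance hτ (hf.c1 _ hφ) (hf.c1 _ (hφ.mul (polyB_coord 0))) (hf.c1 _ (hφ.mul (polyB_coord 1)))
    (hf.c1 _ (hφ.mul (polyB_coord 2))) ((hf.periodic k).momF _) ((hf.periodic k).momF _) ht
    fun _ _ _ hz => hf.balance hτ hφ iφ k ht hz

lemma IsInterior.intO_Dt_rho (hτ : 0 < τ) (hf : IsInterior n 𝔟 τ f) (k : ℤ) (ht : t ∈ Icc 0 τ) :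
    intO (Dt τ (rhoF (f (k + 2 - n))) t)
      = -intT fun x₁ x₂ => velF 2 (f k) t x₁ x₂ 1 - velF 2 (f k) t x₁ x₂ 0 := by
  have := hf.intO_Dt hτ (polyB_const 1) (collInv_const 1) k ht
  simpa only [one_mul, ← rhoF_eq, ← velF_eq] using this

/-- The specular condition implies the compatibility condition. -/
lemma SpecularAt.compatible {fb fk : Side → ℤ → Profile} (hτ : 0 < τ) (hf : IsInterior n 𝔟 τ f)
    (hfb : ∀ s, IsViscous n 𝔟 τ f s (fb s)) (hfk : ∀ s, IsKnudsen n 𝔟 τ f s (fb s) (fk s)) {k : ℤ}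
    (h : SpecularAt τ f fb fk k) : Compatible n τ f fb fk k := fun t ht => by
  rw [intO_neg]
  rw [hf.intO_Dt_rho hτ k ht, neg_neg]
  refine intT_congr fun x₁ x₂ => ?_
  rw [← h.velF_eq_bdryU3 hτ hf hfb hfk Side.upper ht, ← h.velF_eq_bdryU3 hτ hf hfb hfk Side.lower ht]
  rfl

end Balance

/-! ### Pressures -/

section Pressure

variable {n 𝔟 : ℕ} {τ : ℝ} {f : ℤ → Profile} {t : ℝ}

lemma IsInterior.c1_dotU (hf : IsInterior n 𝔟 τ f) (m : ℤ) : C1Field τ (Icc 0 1) (dotU f m) := by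
  have h : ∀ i j, C1Field τ (Icc 0 1) (velF i (f j)) := fun i j => hf.c1 j (polyB_coord i)
  change ContDiffOn ℝ 1 (fun p => ∑ i, (velF i (f 0)).unc p * (velF i (f m)).unc p) _
  exact ContDiffOn.sum fun i _ => ContDiffOn.mul (h i 0) (h i m)

lemma C1Field.sub_const_mul {I : Set ℝ} {p q : Field} (hp : C1Field τ I p) (hq : C1Field τ I q) (a : ℝ) :
    C1Field τ I fun t x₁ x₂ z => p t x₁ x₂ z - a * q t x₁ x₂ z :=
  ContDiffOn.sub hp (contDiffOn_const.mul hq)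

lemma pressure_eq_of_le (n : ℕ) (f : ℤ → Profile) {k : ℤ} (hk : k ≤ n - 3) :
    pressure n f k = rhoTheta f k := by
  funext t x₁ x₂ z; rw [pressure, if_pos hk]

lemma pressure_eq_zero (n : ℕ) (f : ℤ → Profile) : pressure n f (n - 2) =
    fun t x₁ x₂ z => rhoTheta f (n - 2) t x₁ x₂ z - (1 / 3) * dotU f 0 t x₁ x₂ z := by
  funext t x₁ x₂ z; rw [pressure, if_neg (by omega), if_pos rfl]

lemma pressure_eq_pos (n : ℕ) (f : ℤ → Profile) {m : ℤ} (hm : 1 ≤ m) : pressure n f (n - 2 + m) =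
    fun t x₁ x₂ z => rhoTheta f (n - 2 + m) t x₁ x₂ z - (2 / 3) * dotU f m t x₁ x₂ z := by
  funext t x₁ x₂ z
  rw [pressure, if_neg (by omega), if_neg (by omega), add_sub_cancel_left]

lemma intO_sub_const_mul {p q : Field} (hp : C1Field τ (Icc 0 1) p) (hq : C1Field τ (Icc 0 1) q)
    (a : ℝ) (ht : t ∈ Icc 0 τ) :
    intO (fun x₁ x₂ z => p t x₁ x₂ z - a * q t x₁ x₂ z) = intO (p t) - a * intO (q t) := by
  obtain ⟨i, e⟩ := hp.intO_eq ht
  obtain ⟨j, e'⟩ := hq.intO_eq ht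
  rw [((hp.sub_const_mul hq a).intO_eq ht).2, e, e', ← integral_const_mul, ← integral_sub i (j.const_mul a)]

lemma intO_const (c : ℝ) : intO (fun _ _ _ => c) = c := by simp [intO]

/-- A `C¹` field is determined by its spatial gradient and its mean. -/
lemma uniqueWithMean (hτ : 0 < τ) {p : Field} (hp : C1Field τ (Icc 0 1) p) {c : ℝ → ℝ}
    (h : HasMean τ p c) : UniqueWithMean τ p c := by
  refine ⟨h, fun q hq hg hm t ht x₁ x₂ x₃ hx => ?_⟩
  have hQ : C1Field τ (Icc 0 1) fun _ x₁ x₂ z => q t x₁ x₂ z :=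
    (hq t ht).comp (t := univ ×ˢ univ ×ˢ Icc 0 1) (f := fun p : ℝ × ℝ × ℝ × ℝ => p.2) (by fun_prop)
      fun p hp => hp.2
  -- The difference q - p is constant in x at fixed t; averaging shows that the constant is zero.
  -- The factor 1 matches the form of `intO_sub_const_mul`.
  have hc : ∀ y₁ y₂, ∀ y₃ ∈ Icc (0 : ℝ) 1,
      q t y₁ y₂ y₃ - 1 * p t y₁ y₂ y₃ = q t x₁ x₂ x₃ - p t x₁ x₂ x₃ := fun y₁ y₂ y₃ hy => by
    rw [one_mul]
    refine eq_of_grad_eq_zero (q := fun x₁ x₂ x₃ => q t x₁ x₂ x₃ - p t x₁ x₂ x₃)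
      (fun x₁ x₂ z hz => ?_) (fun x₁ x₂ z hz => ?_) (fun x₁ x₂ z hz => ?_) _ _ _ _ hy hx
    · have := (hQ.hasDerivAt_D1 (x₁ := x₁) (x₂ := x₂) hτ uniqueDiffOn_unit ht hz).sub
        (hp.hasDerivAt_D1 (x₁ := x₁) (x₂ := x₂) hτ uniqueDiffOn_unit ht hz)
      rwa [show D1 (fun _ x₁ x₂ z => q t x₁ x₂ z) t x₁ x₂ z = D1 p t x₁ x₂ z from
        (hg t ht x₁ x₂ z hz).1, sub_self] at this
    · have := (hQ.hasDerivAt_D2 (x₁ := x₁) (x₂ := x₂) hτ uniqueDiffOn_unit ht hz).sub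
        (hp.hasDerivAt_D2 (x₁ := x₁) (x₂ := x₂) hτ uniqueDiffOn_unit ht hz)
      rwa [show D2 (fun _ x₁ x₂ z => q t x₁ x₂ z) t x₁ x₂ z = D2 p t x₁ x₂ z from
        (hg t ht x₁ x₂ z hz).2.1, sub_self] at this
    · have := (hQ.hasDerivWithinAt_D3 (x₁ := x₁) (x₂ := x₂) hτ uniqueDiffOn_unit ht hz).sub
        (hp.hasDerivWithinAt_D3 (x₁ := x₁) (x₂ := x₂) hτ uniqueDiffOn_unit ht hz)
      rwa [show D3 (Icc 0 1) (fun _ x₁ x₂ z => q t x₁ x₂ z) t x₁ x₂ z = D3 (Icc 0 1) p t x₁ x₂ z from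
        (hg t ht x₁ x₂ z hz).2.2, sub_self] at this
  have e := intO_sub_const_mul hQ hp 1 ht
  rw [intO_congr hc, intO_const] at e
  have e1 : intO (q t) = intO (p t) := (hm t ht).trans (h t ht).symm
  change _ = intO (q t) - 1 * intO (p t) at e
  linarith

end Pressure

end

section

/-! ### The energy balance and the compatibility condition -/

section TimeIntegral

variable {τ t : ℝ}

lemma integral_congr_time {a b : ℝ → ℝ} (ht : t ∈ Icc 0 τ) (h : ∀ r ∈ Icc 0 τ, a r = b r) :
    ∫ r in (0 : ℝ)..t, a r = ∫ r in (0 : ℝ)..t, b r := by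
  refine intervalIntegral.integral_congr fun r hr => ?_
  rw [uIcc_of_le ht.1] at hr
  exact h r ⟨hr.1, hr.2.trans ht.2⟩

lemma intervalIntegrable_time {a : ℝ → ℝ} (ha : ContinuousOn a (Icc 0 τ)) (ht : t ∈ Icc 0 τ) :
    IntervalIntegrable a volume 0 t :=
  (ha.mono (Icc_subset_Icc_right ht.2)).intervalIntegrable_of_Icc ht.1

end TimeIntegral

variable {n 𝔟 : ℕ} {τ : ℝ} {f : ℤ → Profile} {fb fk : Side → ℤ → Profile} {t x₁ x₂ : ℝ}

/-- The rate of change of the mass of the viscous layers. -/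
def layRate (τ : ℝ) (fb : Side → ℤ → Profile) (j : ℤ) (t x₁ x₂ : ℝ) : ℝ :=
  layInt (Dt τ (rhoF (fb Side.upper j))) t x₁ x₂ + layInt (Dt τ (rhoF (fb Side.lower j))) t x₁ x₂

/-- The difference of the Knudsen corrections at the two walls. -/
def knJump (n : ℕ) (τ : ℝ) (fk : Side → ℤ → Profile) (k : ℤ) (t x₁ x₂ : ℝ) : ℝ :=
  kn0 n τ Side.upper (fk Side.upper) k t x₁ x₂ - kn0 n τ Side.lower (fk Side.lower) k t x₁ x₂

/-- The difference of the heat fluxes at the two walls. -/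
def heatJump (f : ℤ → Profile) (k : ℤ) (t x₁ x₂ : ℝ) : ℝ :=
  momF burnettW (f k) t x₁ x₂ 1 - momF burnettW (f k) t x₁ x₂ 0

lemma C1Field.slabCont {I : Set ℝ} {q : Field} (h : C1Field τ I q) {z : ℝ} (hz : z ∈ I) :
    SlabCont τ fun t x₁ x₂ => q t x₁ x₂ z :=
  h.continuousOn.comp (f := fun p : ℝ × ℝ × ℝ => (p.1, p.2.1, p.2.2, z)) (by fun_prop)
    fun _ hp => ⟨hp.1, trivial, trivial, hz⟩

section SlabAlgebra

variable {g h : ℝ → ℝ → ℝ → ℝ}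

lemma SlabCont.add (hg : SlabCont τ g) (hh : SlabCont τ h) :
    SlabCont τ fun t x₁ x₂ => g t x₁ x₂ + h t x₁ x₂ := ContinuousOn.add hg hh

lemma SlabCont.sub (hg : SlabCont τ g) (hh : SlabCont τ h) :
    SlabCont τ fun t x₁ x₂ => g t x₁ x₂ - h t x₁ x₂ := ContinuousOn.sub hg hh

lemma SlabCont.mul (hg : SlabCont τ g) (hh : SlabCont τ h) :
    SlabCont τ fun t x₁ x₂ => g t x₁ x₂ * h t x₁ x₂ := ContinuousOn.mul hg hh

lemma SlabCont.const_mul (hg : SlabCont τ g) (a : ℝ) :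
    SlabCont τ fun t x₁ x₂ => a * g t x₁ x₂ := ContinuousOn.mul continuousOn_const hg

end SlabAlgebra

lemma slabCont_heatJump (hf : IsInterior n 𝔟 τ f) (k : ℤ) : SlabCont τ (heatJump f k) :=
  ((hf.c1 k polyB_burnettW).slabCont Side.upper.pos_mem).sub
    ((hf.c1 k polyB_burnettW).slabCont Side.lower.pos_mem)

lemma slabCont_layRate (hτ : 0 < τ) (hfb : ∀ s, IsViscous n 𝔟 τ f s (fb s)) (j : ℤ) :
    SlabCont τ (layRate τ fb j) :=
  ((hfb _).tail_rho hτ j).2.slabCont.add ((hfb _).tail_rho hτ j).2.slabCont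

lemma slabCont_knJump (hτ : 0 < τ) (hf : IsInterior n 𝔟 τ f)
    (hfb : ∀ s, IsViscous n 𝔟 τ f s (fb s)) (hfk : ∀ s, IsKnudsen n 𝔟 τ f s (fb s) (fk s)) (k : ℤ) :
    SlabCont τ (knJump n τ fk k) :=
  ((hfk _).continuousOn_kn0 hτ hf (hfb _) k).sub ((hfk _).continuousOn_kn0 hτ hf (hfb _) k)

/-- The prescribed normal velocity in terms of the fluxes of the layers. -/
lemma sgn_mul_bdryU3 (hτ : 0 < τ) (hf : IsInterior n 𝔟 τ f)
    (hfb : ∀ s, IsViscous n 𝔟 τ f s (fb s)) (s : Side) (k : ℤ) (ht : t ∈ Icc 0 τ) :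
    s.sgn * bdryU3 n τ s (fb s) (fk s) k t x₁ x₂
      = layInt (Dt τ (rhoF (fb s (k + 1 - n)))) t x₁ x₂ + layInt (divPar (fb s (k - 1))) t x₁ x₂
        - s.sgn * kn0 n τ s (fk s) k t x₁ x₂ := by
  have := (hfb s).vel_wall hτ hf k ht x₁ x₂
  rw [bdryU3]
  linear_combination -this

/-- Order k+n-2 is the one whose mass law carries ∂_tρ_k. The prescribed wall velocities are
replaced by layer fluxes, whose tangential divergences have zero mean on the torus. -/
lemma compatible_iff (hτ : 0 < τ) (hf : IsInterior n 𝔟 τ f)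
    (hfb : ∀ s, IsViscous n 𝔟 τ f s (fb s)) (hfk : ∀ s, IsKnudsen n 𝔟 τ f s (fb s) (fk s)) (k : ℤ) :
    Compatible n τ f fb fk (k + n - 2) ↔ ∀ t ∈ Icc 0 τ, intO (Dt τ (rhoF (f k)) t)
      = -intT (layRate τ fb (k - 1) t) + intT (knJump n τ fk (k + n - 2) t) := by
  refine forall₂_congr fun t ht => ?_
  have cR := slabCont_layRate hτ hfb (k - 1)
  have cK := slabCont_knJump hτ hf hfb hfk (k + n - 2)
  have cV : ∀ s, SlabCont τ (layInt (divPar (fb s (k + n - 2 - 1)))) := fun s =>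
    ((hfb s).tail_divPar hτ _).slabCont
  have e : intT (fun x₁ x₂ =>
      bdryU3 n τ Side.upper (fb Side.upper) (fk Side.upper) (k + n - 2) t x₁ x₂
        - bdryU3 n τ Side.lower (fb Side.lower) (fk Side.lower) (k + n - 2) t x₁ x₂)
      = intT (layRate τ fb (k - 1) t) - intT (knJump n τ fk (k + n - 2) t) := by
    have h1 : ∀ x₁ x₂, bdryU3 n τ Side.upper (fb Side.upper) (fk Side.upper) (k + n - 2) t x₁ x₂
        - bdryU3 n τ Side.lower (fb Side.lower) (fk Side.lower) (k + n - 2) t x₁ x₂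
        = (layRate τ fb (k - 1) t x₁ x₂ - knJump n τ fk (k + n - 2) t x₁ x₂)
          + (layInt (divPar (fb Side.upper (k + n - 2 - 1))) t x₁ x₂
            + layInt (divPar (fb Side.lower (k + n - 2 - 1))) t x₁ x₂) := fun x₁ x₂ => by
      have hu := sgn_mul_bdryU3 (fk := fk) (x₁ := x₁) (x₂ := x₂) hτ hf hfb Side.upper (k + n - 2) ht
      have hl := sgn_mul_bdryU3 (fk := fk) (x₁ := x₁) (x₂ := x₂) hτ hf hfb Side.lower (k + n - 2) ht
      rw [show k + n - 2 + 1 - (n : ℤ) = k - 1 by ring] at hu hl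
      simp only [Side.sgn] at hu hl
      rw [layRate, knJump]
      linarith
    rw [intT_congr h1, SlabCont.intT_add (cR.sub cK) ((cV _).add (cV _)) ht,
      SlabCont.intT_add (cV _) (cV _) ht, (hfb _).intT_divPar hτ _ ht, (hfb _).intT_divPar hτ _ ht,
      SlabCont.intT_sub cR cK ht]
    ring
  rw [e, intO_neg, show k + n - 2 + 2 - (n : ℤ) = k by ring]
  constructor <;> intro h <;> linarith

/-- The energy balance in terms of the heat flux at the walls. -/
lemma intO_Dt_rhoTheta (hτ : 0 < τ) (hf : IsInterior n 𝔟 τ f) (k : ℤ) (ht : t ∈ Icc 0 τ) :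
    intO (Dt τ (rhoTheta f k) t)
      = -(2 / 3) * intT (heatJump f (k + n - 2) t) + 5 / 3 * intO (Dt τ (rhoF (f k)) t) := by
  have h1 := hf.intO_Dt hτ (polyB_norm_sq.const_mul (1 / 3)) (collInv_norm_sq.const_mul (1 / 3))
    (k + n - 2) ht
  have h2 := hf.intO_Dt_rho hτ (k + n - 2) ht
  rw [show k + n - 2 + 2 - (n : ℤ) = k by ring] at h1 h2
  have h3 : intO (Dt τ (rhoTheta f k) t) = intO (Dt τ (momF (fun v => 1 / 3 * ‖v‖ ^ 2) (f k)) t) :=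
    intO_congr fun x₁ x₂ x₃ hx => Dd_congr (I := Icc 0 1)
      (q := rhoTheta f k) (q' := momF (fun v => 1 / 3 * ‖v‖ ^ 2) (f k)) (fun p hp => hf.rhoTheta_eq (x₁ := p.2.1) (x₂ := p.2.2.1) k hp.1 hp.2.2.2) 0 ht hx
  have cH := slabCont_heatJump hf (k + n - 2)
  have cU : SlabCont τ fun t x₁ x₂ => velF 2 (f (k + n - 2)) t x₁ x₂ 1
      - velF 2 (f (k + n - 2)) t x₁ x₂ 0 :=
    ((hf.c1 _ (polyB_coord 2)).slabCont Side.upper.pos_mem).sub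
      ((hf.c1 _ (polyB_coord 2)).slabCont Side.lower.pos_mem)
  have h4 : ∀ (s : Side) x₁ x₂, momF (fun v => 1 / 3 * ‖v‖ ^ 2 * v 2) (f (k + n - 2)) t x₁ x₂ s.pos
      = 2 / 3 * momF burnettW (f (k + n - 2)) t x₁ x₂ s.pos
        + 5 / 3 * velF 2 (f (k + n - 2)) t x₁ x₂ s.pos := fun s x₁ x₂ => by
    have hw := (hf.wtd (x₁ := x₁) (x₂ := x₂) (k + n - 2) ht s.pos_mem).polyB
    -- The energy flux splits into heat flux and enthalpy flux; this is the origin of the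
    -- coefficients 2/3 and 5/3 in all the formulas.
    have h5 : (fun v : Vel => 1 / 3 * ‖v‖ ^ 2 * v 2)
        = fun v => 2 / 3 * burnettW v + 5 / 3 * v 2 := by
      funext v; rw [burnettW]; ring
    rw [h5, momF, mom_left_add (polyB_burnettW.const_mul _) ((polyB_coord 2).const_mul _) hw,
      mom_left_const_mul, mom_left_const_mul]
    rfl
  have h6 : intT (fun x₁ x₂ => momF (fun v => 1 / 3 * ‖v‖ ^ 2 * v 2) (f (k + n - 2)) t x₁ x₂ 1
      - momF (fun v => 1 / 3 * ‖v‖ ^ 2 * v 2) (f (k + n - 2)) t x₁ x₂ 0)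
      = 2 / 3 * intT (heatJump f (k + n - 2) t) + 5 / 3 * intT (fun x₁ x₂ =>
        velF 2 (f (k + n - 2)) t x₁ x₂ 1 - velF 2 (f (k + n - 2)) t x₁ x₂ 0) := by
    rw [← cH.intT_const_mul _ ht, ← cU.intT_const_mul _ ht,
      ← (cH.const_mul _).intT_add (cU.const_mul _) ht]
    refine intT_congr fun x₁ x₂ => ?_
    have hu := h4 Side.upper x₁ x₂
    have hl := h4 Side.lower x₁ x₂
    simp only [Side.pos] at hu hl
    rw [hu, hl, heatJump]
    ring
  rw [h3, h1, h6, h2]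
  ring

/-- The compatibility condition as an integrated energy balance. -/
lemma compatible_iff_energy (hτ : 0 < τ) (hf : IsInterior n 𝔟 τ f)
    (hfb : ∀ s, IsViscous n 𝔟 τ f s (fb s)) (hfk : ∀ s, IsKnudsen n 𝔟 τ f s (fb s) (fk s)) (k : ℤ) :
    Compatible n τ f fb fk (k + n - 2) ↔ ∀ t ∈ Icc 0 τ, intO (rhoTheta f k t)
      = intO (rhoTheta f k 0) - 2 / 3 * (∫ r in (0 : ℝ)..t, intT (heatJump f (k + n - 2) r))
        - 5 / 3 * (∫ r in (0 : ℝ)..t, intT (layRate τ fb (k - 1) r))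
        + 5 / 3 * ∫ r in (0 : ℝ)..t, intT (knJump n τ fk (k + n - 2) r) := by
  have cH := (slabCont_heatJump hf (k + n - 2)).continuousOn_intT
  have cR := (slabCont_layRate hτ hfb (k - 1)).continuousOn_intT
  have cK := (slabCont_knJump hτ hf hfb hfk (k + n - 2)).continuousOn_intT
  have cX : ContinuousOn (fun t => intO (Dt τ (rhoF (f k)) t)) (Icc 0 τ) := by
    rw [rhoF_eq]
    exact continuousOn_intO ((hf.c1 k (polyB_const 1)).continuousOn_Dd hτ uniqueDiffOn_unit 0)
  have hE : ∀ t ∈ Icc 0 τ, intO (rhoTheta f k t) - intO (rhoTheta f k 0)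
      = -(2 / 3) * (∫ r in (0 : ℝ)..t, intT (heatJump f (k + n - 2) r))
        + 5 / 3 * ∫ r in (0 : ℝ)..t, intO (Dt τ (rhoF (f k)) r) := fun t ht => by
    rw [intO_sub_eq hτ (hf.c1_rhoTheta k) ht,
      integral_congr_time ht fun r hr => intO_Dt_rhoTheta hτ hf k hr,
      intervalIntegral.integral_add ((intervalIntegrable_time cH ht).const_mul _)
        ((intervalIntegrable_time cX ht).const_mul _), intervalIntegral.integral_const_mul,
      intervalIntegral.integral_const_mul]
  have hX : ∀ t ∈ Icc 0 τ, ∫ r in (0 : ℝ)..t, (intO (Dt τ (rhoF (f k)) r)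
      - (-intT (layRate τ fb (k - 1) r) + intT (knJump n τ fk (k + n - 2) r)))
      = (∫ r in (0 : ℝ)..t, intO (Dt τ (rhoF (f k)) r))
        - (-(∫ r in (0 : ℝ)..t, intT (layRate τ fb (k - 1) r))
          + ∫ r in (0 : ℝ)..t, intT (knJump n τ fk (k + n - 2) r)) := fun t ht => by
    have iR := intervalIntegrable_time cR ht
    have iK := intervalIntegrable_time cK ht
    have iR' : IntervalIntegrable (fun r => -intT (layRate τ fb (k - 1) r)) volume 0 t := iR.neg
    rw [intervalIntegral.integral_sub (intervalIntegrable_time cX ht) (iR'.add iK),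
      intervalIntegral.integral_add iR' iK, intervalIntegral.integral_neg]
  rw [compatible_iff hτ hf hfb hfk]
  constructor
  · intro h t ht
    have h1 := hE t ht
    have h2 := hX t ht
    rw [integral_congr_time (b := fun _ => 0) ht fun r hr => by rw [h r hr, sub_self]] at h2
    simp only [intervalIntegral.integral_zero] at h2
    linarith
  · intro h t ht
    -- Comparison with the energy law, which holds unconditionally, shows that the mismatch in the
    -- compatibility condition has zero time integral over every [0,t]. Being continuous, it
    -- vanishes.
    refine sub_eq_zero.1 (eq_zero_of_integral_eq_zero (h := fun r => intO (Dt τ (rhoF (f k)) r)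
      - (-intT (layRate τ fb (k - 1) r) + intT (knJump n τ fk (k + n - 2) r))) hτ
      (cX.sub (cR.neg.add cK)) (fun r hr => ?_) ht)
    have h1 := hE r hr
    have h2 := h r hr
    exact (hX r hr).trans (by linarith)

/-- The rate of change of the mass of the layers, integrated in time. -/
lemma integral_layRate (hτ : 0 < τ) (hfb : ∀ s, IsViscous n 𝔟 τ f s (fb s)) (j : ℤ)
    (ht : t ∈ Icc 0 τ) : ∫ r in (0 : ℝ)..t, intT (layRate τ fb j r)
      = intT fun x₁ x₂ => ∫ y in Ioi (0 : ℝ),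
        ((rhoF (fb Side.upper j) t x₁ x₂ y + rhoF (fb Side.lower j) t x₁ x₂ y)
          - (rhoF (fb Side.upper j) 0 x₁ x₂ y + rhoF (fb Side.lower j) 0 x₁ x₂ y)) := by
  have h0 : (0 : ℝ) ∈ Icc 0 τ := ⟨le_rfl, hτ.le⟩
  have c : ∀ s, C1Field τ (Ici 0) (rhoF (fb s j)) := fun s => by
    rw [rhoF_eq]; exact (hfb s).c1 j (polyB_const 1)
  have T := fun s => ((hfb s).tail_rho hτ j).1
  have T' := fun s => ((hfb s).tail_rho hτ j).2
  have iR : ∀ s x₁ x₂, IntervalIntegrable (fun r => layInt (Dt τ (rhoF (fb s j))) r x₁ x₂) volume 0 t :=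
    fun s x₁ x₂ => intervalIntegrable_time ((T' s).slabCont.comp (f := fun r : ℝ => (r, x₁, x₂))
      (by fun_prop) fun r hr => ⟨hr, trivial, trivial⟩) ht
  rw [← SlabCont.intT_sub_eq hτ (Q := fun t x₁ x₂ => layInt (rhoF (fb Side.upper j)) t x₁ x₂
    + layInt (rhoF (fb Side.lower j)) t x₁ x₂) ((T _).slabCont.add (T _).slabCont)
    (slabCont_layRate hτ hfb j) ht fun x₁ x₂ => ?_]
  · refine intT_congr fun x₁ x₂ => ?_
    have a := fun s => (T s).integrable ht x₁ x₂
    have a0 := fun s => (T s).integrable h0 x₁ x₂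
    have e1 := integral_sub ((a Side.upper).add (a Side.lower)) ((a0 Side.upper).add (a0 Side.lower))
    have e2 := integral_add (a Side.upper) (a Side.lower)
    have e3 := integral_add (a0 Side.upper) (a0 Side.lower)
    simp only [Pi.add_apply] at e1
    rw [e1, e2, e3]
    rfl
  · simp only [layRate]
    rw [intervalIntegral.integral_add (iR _ x₁ x₂) (iR _ x₁ x₂), ← layInt_sub_eq hτ (c _) (T _) (T' _) ht,
      ← layInt_sub_eq hτ (c _) (T _) (T' _) ht]
    ring

end

section

/-! ### The heat flux at the walls -/

section HeatFlux

variable {n 𝔟 : ℕ} {τ : ℝ} {f : ℤ → Profile} {fb fk : Side → ℤ → Profile} {t x₁ x₂ : ℝ}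

/-- The heat flux of order `n - 2` is convective. -/
lemma IsInterior.heatFlux_zero (hn : 3 ≤ n) (hf : IsInterior n 𝔟 τ f) {z : ℝ} (ht : t ∈ Icc 0 τ)
    (hz : z ∈ Icc (0 : ℝ) 1) : momF burnettW (f (0 + n - 2)) t x₁ x₂ z
      = 5 / 2 * (velF 2 (f 0) t x₁ x₂ z * thetaF (f 0) t x₁ x₂ z) := by
  refine mom_burnett_of_linL_eq (hf.eq_macroP (by omega) ht hz) (hf.wtd _ ht hz)
    (hf.continuous _ ht hz) fun v => ?_
  rw [hf.linL_eq _ ht hz, hf.neg (0 + n - 2 - n + 2 - n) (by omega), hf.neg (0 + n - 2 - n) (by omega),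
    Dt_slice_zero, transport_zero, show (0 : ℤ) + n - 2 - n + 2 = 0 by ring]
  simp

/-- Splitting off the end terms matters because i = 0 and i = k each give half of Γ_s(f₀,f_k), which
must be separated from the sum over i,j ≥ 1 in G. -/
lemma sum_Icc_ends {k : ℤ} (hk : 1 ≤ k) (a : ℤ → ℝ) :
    ∑ i ∈ Finset.Icc 0 k, a i = a 0 + (∑ i ∈ Finset.Icc 1 (k - 1), a i) + a k := by
  have h1 : Finset.Icc 0 k = insert 0 (insert k (Finset.Icc 1 (k - 1))) := by
    ext i; simp only [Finset.mem_Icc, Finset.mem_insert]; omega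
  rw [h1, Finset.sum_insert (by simp; omega), Finset.sum_insert (by simp)]
  ring

/-- The heat flux at a wall where `u_{0,3}` vanishes. -/
lemma IsInterior.heatFlux_wall (hn : 3 ≤ n) (hf : IsInterior n 𝔟 τ f) {k : ℤ} (hk : 1 ≤ k) (s : Side)
    (ht : t ∈ Icc 0 τ) (h0 : velF 2 (f 0) t x₁ x₂ s.pos = 0) :
    momF burnettW (f (k + n - 2)) t x₁ x₂ s.pos
      = B3G n τ f (k - 1) s t x₁ x₂
        + 5 / 2 * (theta0W f s t x₁ x₂ * velF 2 (f k) t x₁ x₂ s.pos) := by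
  have hz := s.pos_mem
  have w := fun i => hf.wtd (x₁ := x₁) (x₂ := x₂) i ht hz
  have key := integral_burnett_LInv (hf.eq_macroP (x₁ := x₁) (x₂ := x₂) (k := 0) (by omega) ht hz)
    (w k) (w (k + n - 2)) (hf.continuous _ ht hz)
    (T := fun v => -Dt τ (slice (f (k - 1 + 1 - n)) v) t x₁ x₂ s.pos
      - transport (f (k - 1 - 1)) t x₁ x₂ s.pos v)
    (Null.sum (Finset.Icc 1 (k - 1)) fun i _ =>
      (null_GamS (w i).bddM (w (k - 1 + 1 - i)).bddM).const_mul (1 / 2)) fun v => by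
    rw [hf.linL_eq _ ht hz, show k + n - 2 - (n : ℤ) + 2 = k by ring,
      show k + n - 2 - (n : ℤ) = k - 1 - 1 by ring, sum_Icc_ends hk, sub_zero, sub_self,
      GamS_comm (f k t x₁ x₂ s.pos), sub_add_cancel]
    ring
  have hB : B3G n τ f (k - 1) s t x₁ x₂ = mom burnettW (f (k + n - 2) t x₁ x₂ s.pos)
      - 5 / 2 * (vel 2 (f 0 t x₁ x₂ s.pos) * theta (f k t x₁ x₂ s.pos)
        + theta (f 0 t x₁ x₂ s.pos) * vel 2 (f k t x₁ x₂ s.pos)) := by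
    rw [← key, B3G, Gfun, sub_add_cancel]
  rw [velF] at h0
  rw [hB, h0, momF, theta0W, thetaF, velF]
  ring

/-! ### Layer contributions to the heat flux -/

variable (fb) in
/-- The convected time derivative of the mass of the layers. -/
def rateFlux (τ : ℝ) (f : ℤ → Profile) (j : ℤ) (t x₁ x₂ : ℝ) : ℝ :=
  ∫ y in Ioi (0 : ℝ),
    (Dt τ (rhoF (fb Side.upper j)) t x₁ x₂ y * theta0W f Side.upper t x₁ x₂
      + Dt τ (rhoF (fb Side.lower j)) t x₁ x₂ y * theta0W f Side.lower t x₁ x₂)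

variable (fb) in
/-- The convected tangential divergence of the layers. -/
def divFlux (f : ℤ → Profile) (j : ℤ) (t x₁ x₂ : ℝ) : ℝ :=
  ∫ y in Ioi (0 : ℝ),
    (divPar (fb Side.upper j) t x₁ x₂ y * theta0W f Side.upper t x₁ x₂
      + divPar (fb Side.lower j) t x₁ x₂ y * theta0W f Side.lower t x₁ x₂)

/-- The convected Knudsen corrections. -/
def knFlux (n : ℕ) (τ : ℝ) (f : ℤ → Profile) (fk : Side → ℤ → Profile) (k : ℤ) (t x₁ x₂ : ℝ) : ℝ :=
  kn0 n τ Side.upper (fk Side.upper) k t x₁ x₂ * theta0W f Side.upper t x₁ x₂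
    - kn0 n τ Side.lower (fk Side.lower) k t x₁ x₂ * theta0W f Side.lower t x₁ x₂

/-- The difference of `⟨ℬ₃, G_j⟩` at the two walls. -/
def burnettJump (n : ℕ) (τ : ℝ) (f : ℤ → Profile) (j : ℤ) (t x₁ x₂ : ℝ) : ℝ :=
  B3G n τ f j Side.upper t x₁ x₂ - B3G n τ f j Side.lower t x₁ x₂

lemma integral_half_combination {F G : Field} (hF : Tail τ F) (hG : Tail τ G) (ht : t ∈ Icc 0 τ)
    (a b : ℝ) : ∫ y in Ioi (0 : ℝ), (F t x₁ x₂ y * a + G t x₁ x₂ y * b)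
      = layInt F t x₁ x₂ * a + layInt G t x₁ x₂ * b := by
  rw [integral_add ((hF.integrable ht x₁ x₂).mul_const a) ((hG.integrable ht x₁ x₂).mul_const b),
    integral_mul_const, integral_mul_const]
  rfl

lemma rateFlux_eq (hτ : 0 < τ) (hfb : ∀ s, IsViscous n 𝔟 τ f s (fb s)) (j : ℤ) (ht : t ∈ Icc 0 τ) :
    rateFlux fb τ f j t x₁ x₂
      = layInt (Dt τ (rhoF (fb Side.upper j))) t x₁ x₂ * theta0W f Side.upper t x₁ x₂
        + layInt (Dt τ (rhoF (fb Side.lower j))) t x₁ x₂ * theta0W f Side.lower t x₁ x₂ :=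
  integral_half_combination ((hfb _).tail_rho hτ j).2 ((hfb _).tail_rho hτ j).2 ht _ _

lemma divFlux_eq (hτ : 0 < τ) (hfb : ∀ s, IsViscous n 𝔟 τ f s (fb s)) (j : ℤ) (ht : t ∈ Icc 0 τ) :
    divFlux fb f j t x₁ x₂
      = layInt (divPar (fb Side.upper j)) t x₁ x₂ * theta0W f Side.upper t x₁ x₂
        + layInt (divPar (fb Side.lower j)) t x₁ x₂ * theta0W f Side.lower t x₁ x₂ :=
  integral_half_combination ((hfb _).tail_divPar hτ j) ((hfb _).tail_divPar hτ j) ht _ _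

lemma IsInterior.slabCont_theta0W (hf : IsInterior n 𝔟 τ f) (s : Side) : SlabCont τ (theta0W f s) := by
  have : C1Field τ (Icc 0 1) (thetaF (f 0)) := by
    rw [thetaF_eq]; exact hf.c1 0 (polyB_energy.const_mul _)
  exact this.slabCont s.pos_mem

lemma slabCont_rateFlux (hτ : 0 < τ) (hf : IsInterior n 𝔟 τ f)
    (hfb : ∀ s, IsViscous n 𝔟 τ f s (fb s)) (j : ℤ) : SlabCont τ (rateFlux fb τ f j) :=
  (((((hfb _).tail_rho hτ j).2.slabCont).mul (hf.slabCont_theta0W _)).add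
    ((((hfb _).tail_rho hτ j).2.slabCont).mul (hf.slabCont_theta0W _))).congr
    fun _ hp => rateFlux_eq hτ hfb j hp.1

lemma slabCont_divFlux (hτ : 0 < τ) (hf : IsInterior n 𝔟 τ f)
    (hfb : ∀ s, IsViscous n 𝔟 τ f s (fb s)) (j : ℤ) : SlabCont τ (divFlux fb f j) :=
  (((((hfb _).tail_divPar hτ j).slabCont).mul (hf.slabCont_theta0W _)).add
    ((((hfb _).tail_divPar hτ j).slabCont).mul (hf.slabCont_theta0W _))).congr
    fun _ hp => divFlux_eq hτ hfb j hp.1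

lemma slabCont_knFlux (hτ : 0 < τ) (hf : IsInterior n 𝔟 τ f)
    (hfb : ∀ s, IsViscous n 𝔟 τ f s (fb s)) (hfk : ∀ s, IsKnudsen n 𝔟 τ f s (fb s) (fk s)) (k : ℤ) :
    SlabCont τ (knFlux n τ f fk k) :=
  (SlabCont.mul ((hfk _).continuousOn_kn0 hτ hf (hfb _) k) (hf.slabCont_theta0W _)).sub
    (SlabCont.mul ((hfk _).continuousOn_kn0 hτ hf (hfb _) k) (hf.slabCont_theta0W _))

/-- The heat flux through the walls. -/
lemma heatJump_eq (hn : 3 ≤ n) (hτ : 0 < τ) (hf : IsInterior n 𝔟 τ f)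
    (hfb : ∀ s, IsViscous n 𝔟 τ f s (fb s)) (hfk : ∀ s, IsKnudsen n 𝔟 τ f s (fb s) (fk s)) {k : ℤ}
    (hk : 1 ≤ k) (h0 : SpecularAt τ f fb fk 0) (h : SpecularAt τ f fb fk k) (ht : t ∈ Icc 0 τ) :
    heatJump f (k + n - 2) t x₁ x₂ = burnettJump n τ f (k - 1) t x₁ x₂
      + 5 / 2 * (rateFlux fb τ f (k + 1 - n) t x₁ x₂ + divFlux fb f (k - 1) t x₁ x₂
        - knFlux n τ f fk k t x₁ x₂) := by
  have e : ∀ s : Side, momF burnettW (f (k + n - 2)) t x₁ x₂ s.pos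
      = B3G n τ f (k - 1) s t x₁ x₂
        + 5 / 2 * (theta0W f s t x₁ x₂ * bdryU3 n τ s (fb s) (fk s) k t x₁ x₂) := fun s => by
    rw [hf.heatFlux_wall hn hk s ht (h0.velF_zero (by omega) hτ hf hfb hfk s ht),
      h.velF_eq_bdryU3 hτ hf hfb hfk s ht]
  have hu := sgn_mul_bdryU3 (fk := fk) (x₁ := x₁) (x₂ := x₂) hτ hf hfb Side.upper k ht
  have hl := sgn_mul_bdryU3 (fk := fk) (x₁ := x₁) (x₂ := x₂) hτ hf hfb Side.lower k ht
  have eu := e Side.upper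
  have el := e Side.lower
  simp only [Side.pos, Side.sgn] at hu hl eu el
  rw [heatJump, eu, el, rateFlux_eq hτ hfb _ ht, divFlux_eq hτ hfb _ ht, burnettJump, knFlux]
  linear_combination (5 / 2 * theta0W f Side.upper t x₁ x₂) * hu
    + (5 / 2 * theta0W f Side.lower t x₁ x₂) * hl

lemma integral_heatJump (hn : 3 ≤ n) (hτ : 0 < τ) (hf : IsInterior n 𝔟 τ f)
    (hfb : ∀ s, IsViscous n 𝔟 τ f s (fb s)) (hfk : ∀ s, IsKnudsen n 𝔟 τ f s (fb s) (fk s)) {k : ℤ}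
    (hk : 1 ≤ k) (h0 : SpecularAt τ f fb fk 0) (h : SpecularAt τ f fb fk k) (ht : t ∈ Icc 0 τ) :
    ∫ r in (0 : ℝ)..t, intT (heatJump f (k + n - 2) r)
      = (∫ r in (0 : ℝ)..t, intT (burnettJump n τ f (k - 1) r))
        + 5 / 2 * ((∫ r in (0 : ℝ)..t, intT (rateFlux fb τ f (k + 1 - n) r))
          + (∫ r in (0 : ℝ)..t, intT (divFlux fb f (k - 1) r))
          - ∫ r in (0 : ℝ)..t, intT (knFlux n τ f fk k r)) := by
  have cR := slabCont_rateFlux hτ hf hfb (k + 1 - n)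
  have cD := slabCont_divFlux hτ hf hfb (k - 1)
  have cK := slabCont_knFlux hτ hf hfb hfk k
  have cS := ((cR.add cD).sub cK).const_mul (5 / 2)
  -- L⁻¹ is defined pointwise by choice, so ⟨ℬ₃,G⟩ has no evident regularity in (t,x_∥). Its wall
  -- jump is continuous because the heat flux identity writes it as a difference of continuous
  -- terms.
  have cB : SlabCont τ (burnettJump n τ f (k - 1)) :=
    ((slabCont_heatJump hf (k + n - 2)).sub cS).congr fun p hp => by
      have := heatJump_eq (x₁ := p.2.1) (x₂ := p.2.2) hn hτ hf hfb hfk hk h0 h hp.1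
      simp only
      linarith
  have e : ∀ r ∈ Icc 0 τ, intT (heatJump f (k + n - 2) r) = intT (burnettJump n τ f (k - 1) r)
      + 5 / 2 * (intT (rateFlux fb τ f (k + 1 - n) r) + intT (divFlux fb f (k - 1) r)
        - intT (knFlux n τ f fk k r)) := fun r hr => by
    rw [← cR.intT_add cD hr, ← (cR.add cD).intT_sub cK hr,
      ← ((cR.add cD).sub cK).intT_const_mul _ hr, ← cB.intT_add cS hr]
    exact intT_congr fun x₁ x₂ => heatJump_eq hn hτ hf hfb hfk hk h0 h hr
  have iR := intervalIntegrable_time cR.continuousOn_intT ht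
  have iD := intervalIntegrable_time cD.continuousOn_intT ht
  have iK := intervalIntegrable_time cK.continuousOn_intT ht
  have iB := intervalIntegrable_time cB.continuousOn_intT ht
  rw [integral_congr_time ht e, intervalIntegral.integral_add iB (((iR.add iD).sub iK).const_mul _),
    intervalIntegral.integral_const_mul, intervalIntegral.integral_sub (iR.add iD) iK,
    intervalIntegral.integral_add iR iD]

/-- The compatibility condition of order `k + n - 2` as a formula for the mean of `ρ_k + θ_k`. -/
lemma compatible_iff_mean (hn : 3 ≤ n) (hτ : 0 < τ) (hf : IsInterior n 𝔟 τ f)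
    (hfb : ∀ s, IsViscous n 𝔟 τ f s (fb s)) (hfk : ∀ s, IsKnudsen n 𝔟 τ f s (fb s) (fk s)) {k : ℤ}
    (hk : 1 ≤ k) (h0 : SpecularAt τ f fb fk 0) (h : SpecularAt τ f fb fk k) :
    Compatible n τ f fb fk (k + n - 2) ↔ ∀ t ∈ Icc 0 τ, intO (rhoTheta f k t)
      = intO (rhoTheta f k 0) + mainTerms n τ f fb k t
        - 5 / 3 * (∫ r in (0 : ℝ)..t, intT (rateFlux fb τ f (k + 1 - n) r))
        + 5 / 3 * (∫ r in (0 : ℝ)..t, intT (knJump n τ fk (k + n - 2) r))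
        + 5 / 3 * ∫ r in (0 : ℝ)..t, intT (knFlux n τ f fk k r) := by
  rw [compatible_iff_energy hτ hf hfb hfk]
  refine forall₂_congr fun t ht => ?_
  have hm : mainTerms n τ f fb k t
      = -(2 / 3) * (∫ r in (0 : ℝ)..t, intT (burnettJump n τ f (k - 1) r))
        - 5 / 3 * (∫ r in (0 : ℝ)..t, intT (layRate τ fb (k - 1) r))
        - 5 / 3 * (∫ r in (0 : ℝ)..t, intT (divFlux fb f (k - 1) r)) := by
    rw [integral_layRate hτ hfb _ ht]
    rfl
  rw [hm, integral_heatJump hn hτ hf hfb hfk hk h0 h ht]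
  constructor <;> intro e <;> linarith

lemma IsViscous.Dt_rhoF_zero {s : Side} {fb : ℤ → Profile} (hb : IsViscous n 𝔟 τ f s fb) {j : ℤ}
    (hj : j ≤ 0) : Dt τ (rhoF (fb j)) = 0 := by
  rw [hb.nonpos _ hj, rhoF_eq, momF_zero]
  funext t x₁ x₂ y
  exact Dd_zero_field τ (Ici 0) 0 t x₁ x₂ y

lemma intT_zero : intT (fun _ _ => 0) = 0 := by simp [intT]

/-- For `k ≤ n - 2` the layers contribute only through the main terms. -/
lemma compatible_iff_mean_of_le (hn : 3 ≤ n) (hτ : 0 < τ) (hf : IsInterior n 𝔟 τ f)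
    (hfb : ∀ s, IsViscous n 𝔟 τ f s (fb s)) (hfk : ∀ s, IsKnudsen n 𝔟 τ f s (fb s) (fk s)) {k : ℤ}
    (hk : 1 ≤ k) (hkn : k ≤ n - 2) (h0 : SpecularAt τ f fb fk 0) (h : SpecularAt τ f fb fk k) :
    Compatible n τ f fb fk (k + n - 2) ↔ ∀ t ∈ Icc 0 τ, intO (rhoTheta f k t)
      = intO (rhoTheta f k 0) + mainTerms n τ f fb k t := by
  rw [compatible_iff_mean hn hτ hf hfb hfk hk h0 h]
  refine forall₂_congr fun t ht => ?_
  -- For k ≤ n-2 the viscous index k+1-n is negative.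
  have e1 : ∀ r, intT (rateFlux fb τ f (k + 1 - n) r) = 0 := fun r => by
    have hz : ∀ s, Dt τ (rhoF (fb s (k + 1 - n))) = 0 := fun s => (hfb s).Dt_rhoF_zero (by omega)
    rw [← intT_zero]
    refine intT_congr fun x₁ x₂ => ?_
    simp [rateFlux, hz]
  -- At order k+n-2 ≤ 2n-4 the Knudsen source may be nonzero, but it has no time derivative, so only
  -- its mean on the torus vanishes.
  have e2 : ∀ r ∈ Icc 0 τ, intT (knJump n τ fk (k + n - 2) r) = 0 := fun r hr => by
    have := fun s => (hfk s).intT_kn0 hτ hf (hfb s) (k := k + n - 2) (by omega) hr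
    unfold knJump
    rw [SlabCont.intT_sub ((hfk _).continuousOn_kn0 hτ hf (hfb _) _)
      ((hfk _).continuousOn_kn0 hτ hf (hfb _) _) hr, this, this, sub_zero]
  -- Multiplied by θ_0, a zero mean would not be enough; here k ≤ n makes the correction itself
  -- vanish.
  have e3 : ∀ r, intT (knFlux n τ f fk k r) = 0 := fun r => by
    rw [← intT_zero]
    refine intT_congr fun x₁ x₂ => ?_
    rw [knFlux, (hfk _).kn0_eq_zero (by omega) (by omega), (hfk _).kn0_eq_zero (by omega) (by omega)]
    ring
  rw [integral_congr_time ht e2]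
  simp only [e1, e3, intervalIntegral.integral_zero, mul_zero, sub_zero, add_zero]

/-- All three wall terms of the energy balance vanish: the heat flux is convective and u_{0,3} = 0
on the walls, while the layer terms have indices too low to be present. -/
lemma compatible_zero_iff (hn : 3 ≤ n) (hτ : 0 < τ) (hf : IsInterior n 𝔟 τ f)
    (hfb : ∀ s, IsViscous n 𝔟 τ f s (fb s)) (hfk : ∀ s, IsKnudsen n 𝔟 τ f s (fb s) (fk s))
    (h0 : SpecularAt τ f fb fk 0) :
    Compatible n τ f fb fk (n - 2) ↔ ∀ t ∈ Icc 0 τ, intO (rhoTheta f 0 t) = intO (rhoTheta f 0 0) := by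
  have := compatible_iff_energy hτ hf hfb hfk 0
  rw [show (0 : ℤ) + n - 2 = n - 2 by ring] at this
  rw [this]
  refine forall₂_congr fun t ht => ?_
  have e1 : ∀ r ∈ Icc 0 τ, intT (heatJump f (n - 2) r) = 0 := fun r hr => by
    rw [← intT_zero]
    refine intT_congr fun x₁ x₂ => ?_
    have e : ∀ s : Side, momF burnettW (f (n - 2)) r x₁ x₂ s.pos = 0 := fun s => by
      have := hf.heatFlux_zero (x₁ := x₁) (x₂ := x₂) hn hr s.pos_mem
      rw [h0.velF_zero (by omega) hτ hf hfb hfk s hr, zero_add] at this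
      rw [this]; ring
    have eu := e Side.upper
    have el := e Side.lower
    simp only [Side.pos] at eu el
    rw [heatJump, eu, el, sub_zero]
  have e2 : ∀ r ∈ Icc 0 τ, intT (layRate τ fb (0 - 1) r) = 0 := fun r _ => by
    have hz : ∀ s, Dt τ (rhoF (fb s (0 - 1))) = 0 := fun s => (hfb s).Dt_rhoF_zero (by omega)
    rw [← intT_zero]
    refine intT_congr fun x₁ x₂ => ?_
    simp only [layRate, layInt, hz, Pi.zero_apply, integral_zero, add_zero]
  have e3 : ∀ r ∈ Icc 0 τ, intT (knJump n τ fk (n - 2) r) = 0 := fun r _ => by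
    rw [← intT_zero]
    refine intT_congr fun x₁ x₂ => ?_
    rw [knJump, (hfk _).kn0_eq_zero (by omega) (by omega), (hfk _).kn0_eq_zero (by omega) (by omega),
      sub_zero]
  rw [integral_congr_time ht e1, integral_congr_time ht e2, integral_congr_time ht e3]
  simp

lemma IsInterior.intO_rhoTheta (hτ : 0 < τ) (hf : IsInterior n 𝔟 τ f) {k : ℤ} (hk : k ≤ n - 3)
    (ht : t ∈ Icc 0 τ) (x₁ x₂ : ℝ) {x₃ : ℝ} (hx : x₃ ∈ Icc (0 : ℝ) 1) :
    intO (rhoTheta f k t) = rhoTheta f k t x₁ x₂ x₃ := by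
  rw [← intO_const (rhoTheta f k t x₁ x₂ x₃)]
  exact intO_congr fun y₁ y₂ y₃ hy => hf.rhoTheta_const hτ hk ht y₁ y₂ x₁ x₂ hy hx

/-- Ω has volume 1 and p_k does not depend on x, so a condition on the mean is a condition on the
value at every point. -/
lemma IsInterior.forall_mean_iff (hτ : 0 < τ) (hf : IsInterior n 𝔟 τ f) {k : ℤ} (hk : k ≤ n - 3)
    (c : ℝ → ℝ) :
    (∀ t ∈ Icc 0 τ, intO (rhoTheta f k t) = intO (rhoTheta f k 0) + c t) ↔
      ∀ t ∈ Icc 0 τ, ∀ x₁ x₂ y₁ y₂ : ℝ, ∀ x₃ ∈ Icc (0 : ℝ) 1, ∀ y₃ ∈ Icc (0 : ℝ) 1,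
        pressure n f k t x₁ x₂ x₃ = rhoTheta f k 0 y₁ y₂ y₃ + c t := by
  have h0 : (0 : ℝ) ∈ Icc 0 τ := ⟨le_rfl, hτ.le⟩
  rw [pressure_eq_of_le n f hk]
  refine forall₂_congr fun t ht => ⟨fun h x₁ x₂ y₁ y₂ x₃ hx y₃ hy => ?_, fun h => ?_⟩
  · rw [← hf.intO_rhoTheta hτ hk ht x₁ x₂ hx, h, hf.intO_rhoTheta hτ hk h0 y₁ y₂ hy]
  · have hz : (0 : ℝ) ∈ Icc (0 : ℝ) 1 := ⟨le_rfl, zero_le_one⟩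
    rw [hf.intO_rhoTheta hτ hk ht 0 0 hz, h 0 0 0 0 0 hz 0 hz, hf.intO_rhoTheta hτ hk h0 0 0 hz]

end HeatFlux

end

end EulerLimit

end

/-! ### Assembly of the six cases -/

theorem lemma2p2 (n 𝔟 : ℕ) (hn : 3 ≤ n) (τ : ℝ) (hτ : 0 < τ)
    (f : ℤ → EulerLimit.Profile) (fb fk : EulerLimit.Side → ℤ → EulerLimit.Profile)
    (hf : EulerLimit.IsInterior n 𝔟 τ f)
    (hfb : ∀ s, EulerLimit.IsViscous n 𝔟 τ f s (fb s))
    (hfk : ∀ s, EulerLimit.IsKnudsen n 𝔟 τ f s (fb s) (fk s)) :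
    -- the specular condition at order `k` forces the compatibility condition at order `k`
    (∀ k : ℤ, 0 ≤ k → EulerLimit.SpecularAt τ f fb fk k →
      EulerLimit.Compatible n τ f fb fk k) ∧
    -- `p_k` is independent of `x` for `0 ≤ k ≤ n - 3`
    (∀ k : ℤ, 0 ≤ k → k ≤ n - 3 → ∀ t ∈ Icc 0 τ, ∀ x₁ x₂ y₁ y₂ : ℝ,
      ∀ x₃ ∈ Icc (0 : ℝ) 1, ∀ y₃ ∈ Icc (0 : ℝ) 1,
        EulerLimit.pressure n f k t x₁ x₂ x₃ = EulerLimit.pressure n f k t y₁ y₂ y₃) ∧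
    -- `k = 0`
    (EulerLimit.SpecularAt τ f fb fk 0 →
      (EulerLimit.Compatible n τ f fb fk (n - 2) ↔
        ∀ t ∈ Icc 0 τ, ∀ x₁ x₂ y₁ y₂ : ℝ, ∀ x₃ ∈ Icc (0 : ℝ) 1, ∀ y₃ ∈ Icc (0 : ℝ) 1,
          EulerLimit.pressure n f 0 t x₁ x₂ x₃ = EulerLimit.rhoTheta f 0 0 y₁ y₂ y₃)) ∧
    -- `1 ≤ k ≤ n - 3`
    (∀ k : ℤ, 1 ≤ k → k ≤ n - 3 →
      EulerLimit.SpecularAt τ f fb fk 0 → EulerLimit.SpecularAt τ f fb fk k →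
      (EulerLimit.Compatible n τ f fb fk (k + n - 2) ↔
        ∀ t ∈ Icc 0 τ, ∀ x₁ x₂ y₁ y₂ : ℝ, ∀ x₃ ∈ Icc (0 : ℝ) 1, ∀ y₃ ∈ Icc (0 : ℝ) 1,
          EulerLimit.pressure n f k t x₁ x₂ x₃ =
            EulerLimit.rhoTheta f k 0 y₁ y₂ y₃ + EulerLimit.mainTerms n τ f fb k t)) ∧
    -- `k = n - 2`
    (EulerLimit.SpecularAt τ f fb fk 0 → EulerLimit.SpecularAt τ f fb fk (n - 2) →
      (EulerLimit.Compatible n τ f fb fk (2 * n - 4) ↔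
        EulerLimit.HasMean τ (EulerLimit.pressure n f (n - 2))
          (EulerLimit.meanC0 n τ f fb)) ∧
      (EulerLimit.Compatible n τ f fb fk (2 * n - 4) →
        EulerLimit.UniqueWithMean τ (EulerLimit.pressure n f (n - 2))
          (EulerLimit.meanC0 n τ f fb))) ∧
    -- `k = n - 2 + m ≥ n - 1`
    (∀ m : ℤ, 1 ≤ m →
      EulerLimit.SpecularAt τ f fb fk 0 → EulerLimit.SpecularAt τ f fb fk (n - 2 + m) →
      (EulerLimit.Compatible n τ f fb fk (2 * n - 4 + m) ↔
        EulerLimit.HasMean τ (EulerLimit.pressure n f (n - 2 + m))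
          (EulerLimit.meanC n τ f fb fk m)) ∧
      (EulerLimit.Compatible n τ f fb fk (2 * n - 4 + m) →
        EulerLimit.UniqueWithMean τ (EulerLimit.pressure n f (n - 2 + m))
          (EulerLimit.meanC n τ f fb fk m))) := by
  refine ⟨fun k _ h => h.compatible hτ hf hfb hfk, ?_, ?_, ?_, ?_, ?_⟩
  · intro k _ hk t ht x₁ x₂ y₁ y₂ x₃ hx y₃ hy
    rw [EulerLimit.pressure_eq_of_le n f hk]
    exact hf.rhoTheta_const hτ hk ht x₁ x₂ y₁ y₂ hx hy
  · intro s0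
    have := hf.forall_mean_iff hτ (k := 0) (by omega) fun _ => 0
    simp only [add_zero] at this
    rw [EulerLimit.compatible_zero_iff hn hτ hf hfb hfk s0, this]
  · intro k hk hkn s0 sk
    rw [EulerLimit.compatible_iff_mean_of_le hn hτ hf hfb hfk hk (by omega) s0 sk,
      hf.forall_mean_iff hτ hkn]
  · intro s0 sk
    have hc : EulerLimit.Compatible n τ f fb fk (2 * n - 4) ↔
        EulerLimit.HasMean τ (EulerLimit.pressure n f (n - 2)) (EulerLimit.meanC0 n τ f fb) := by
      have := EulerLimit.compatible_iff_mean_of_le hn hτ hf hfb hfk (by omega) le_rfl s0 sk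
      rw [show (n : ℤ) - 2 + n - 2 = 2 * n - 4 by ring] at this
      rw [this]
      refine forall₂_congr fun t ht => ?_
      rw [EulerLimit.pressure_eq_zero,
        EulerLimit.intO_sub_const_mul (hf.c1_rhoTheta _) (hf.c1_dotU 0) _ ht, EulerLimit.meanC0]
      constructor <;> intro e <;> linarith
    refine ⟨hc, fun h => EulerLimit.uniqueWithMean hτ ?_ (hc.1 h)⟩
    rw [EulerLimit.pressure_eq_zero]
    exact (hf.c1_rhoTheta _).sub_const_mul (hf.c1_dotU 0) _
  · intro m hm s0 sk
    have hc : EulerLimit.Compatible n τ f fb fk (2 * n - 4 + m) ↔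
        EulerLimit.HasMean τ (EulerLimit.pressure n f (n - 2 + m))
          (EulerLimit.meanC n τ f fb fk m) := by
      -- With k = n-2+m the orders k+n-2 and k+1-n become 2n-4+m and m-1. All layer terms are kept
      -- here; the u_0·u_m term comes only from passing from ρ+θ to the pressure.
      have := EulerLimit.compatible_iff_mean hn hτ hf hfb hfk (by omega) s0 sk
      rw [show (n : ℤ) - 2 + m + n - 2 = 2 * n - 4 + m by ring,
        show (n : ℤ) - 2 + m + 1 - n = m - 1 by ring] at this
      rw [this]
      refine forall₂_congr fun t ht => ?_
      rw [EulerLimit.pressure_eq_pos n f hm,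
        EulerLimit.intO_sub_const_mul (hf.c1_rhoTheta _) (hf.c1_dotU m) _ ht, EulerLimit.meanC]
      unfold EulerLimit.rateFlux EulerLimit.knJump EulerLimit.knFlux
      constructor <;> intro e <;> linarith
    refine ⟨hc, fun h => EulerLimit.uniqueWithMean hτ ?_ (hc.1 h)⟩
    rw [EulerLimit.pressure_eq_pos n f hm]
    exact (hf.c1_rhoTheta _).sub_const_mul (hf.c1_dotU m) _
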